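/- Let $\Omega\subset\mathbb R^3$ be a bounded open set, $T>0$, $Q_T=\Omega\times(0,T)$, let $\lambda\in C_0^\infty(Q_T)$ be nonnegative (extended by zero to $\mathbb R^4$), let $E,M_S,M_f\ge 0$ and let $\mu<4/3$. Then there is a constant $c>0$, depending only on $\Omega,T,\lambda,E,M_S,M_f,\mu$, with the following property. Let $m>1$ and $\varepsilon>0$, write $P_\varepsilon=1+\varepsilon\varrho^m$, and let $\varrho\ge 0$ and $\mathbf u$ (with values in $\mathbb R^3$) be measurable on $Q_T$ with $$\|\varrho^{3/2}P_\varepsilon\|_{L^\infty(0,T;L^1(\Omega))}+\|\varrho|\mathbf u|^2\|_{L^\infty(0,T;L^1(\Omega))}+\|\mathbf u\|_{L^2(0,T;W^{1,2}(\Omega))}\le E .$$ Let $\mathbb S$ be a matrix field with $\|\mathbb S\|_{L^2(Q_T)}\le M_S$ (for example the viscous stress tensor $\nu_1(\nabla\mathbf u+\nabla\mathbf u^\top)+\nu_2\,\mathrm{div}\,\mathbf u\,\mathbb I$) and $\mathbf f$ a vector field with $\|\mathbf f\|_{L^\infty(Q_T)}\le M_f$, and suppose that $$\int_{Q_T}\varrho\mathbf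 u\cdot\partial_t\boldsymbol\xi+\int_{Q_T}\big(\varrho\mathbf u\otimes\mathbf u+\varrho^{3/2}P_\varepsilon\mathbb I-\mathbb S\big):\nabla\boldsymbol\xi+\int_{Q_T}\varrho\mathbf f\cdot\boldsymbol\xi=0,\qquad \int_{Q_T}\big(\varrho\,\partial_t\psi+\varrho\mathbf u\cdot\nabla\psi\big)=0$$ for all $\boldsymbol\xi\in C_0^\infty(Q_T;\mathbb R^3)$ and $\psi\in C_0^\infty(Q_T)$. Put $\rho=\lambda^4\varrho$ and $\mathbf v=\lambda\mathbf u$, both extended by zero to $\mathbb R^4$. For $\eta\in\mathbb R^3\setminus\{0\}$ and $w\in\mathbb R^3$ let $\Pi^\parallel(\eta)w=\frac{\eta\cdot w}{|\eta|^2}\eta$ and $\Pi^\bot(\eta)w=w-\Pi^\parallel(\eta)w$, and set $$\mathbf E^\parallel(x,y,t)=\tfrac12\big|\Pi^\parallel(x-y)(\mathbf v(x,t)-\mathbf v(y,t))\big|^2+\rho(x,t)^{1/2}P_\varepsilon(x,t),$$ $$\mathbf E^\bot(x,y,t)=\tfrac12\big|\Pi^\bot(x-y)(\mathbf v(x,t)-\mathbf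 v(y,t))\big|^2+2\rho(x,t)^{1/2}P_\varepsilon(x,t),$$ $$\Gamma(r)=\frac1r\int_{\mathbb R^4}\rho(x,t)\Big(\int_{B(x,r)}\rho(y,t)\,\mathbf E^\parallel(x,y,t)\,dy\Big)dx\,dt,$$ $$W(r)=\int_0^r\Big\{\int_{\mathbb R^4}\rho(x,t)\Big(\int_{B(x,s)}\rho(y,t)\,\mathbf E^\bot(x,y,t)\,dy\Big)dx\,dt\Big\}\frac{ds}{s^2}.$$ Then $\Gamma(r)$ and $W(r)$ are finite and $$\Gamma(r)+W(r)\le c\,|\log r|^{-\mu}\qquad\text{for all } r\in(0,e^{-1}).$$ In particular $c$ does not depend on $\varepsilon$, $m$, $\varrho$, $\mathbf u$, $\mathbb S$, $\mathbf f$ or $r$. -/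

import Mathlib

open Set MeasureTheory
open scoped ENNReal NNReal ContDiff

namespace CompressibleNS

/-- Physical space `ℝ³` with its Euclidean norm. -/
abbrev E3 := EuclideanSpace ℝ (Fin 3)

/-- Space-time `ℝ⁴ = ℝ³ × ℝ`; a point is `(x, t)`, the measure is Lebesgue measure. -/
abbrev SpaceTime := E3 × ℝ

/-- The cylinder `Q_T = Ω × (0, T)`. -/
def cylinder (Ω : Set E3) (T : ℝ) : Set SpaceTime := Ω ×ˢ Ioo 0 T

/-- The `j`-th standard unit vector of `ℝ³`. -/
noncomputable def unitVec (j : Fin 3) : E3 := EuclideanSpace.single j 1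

/-- `φ ∈ C₀^∞(U)`. -/
def IsTestFunction {X F : Type*} [NormedAddCommGroup X] [NormedSpace ℝ X]
    [NormedAddCommGroup F] [NormedSpace ℝ F] (U : Set X) (φ : X → F) : Prop :=
  ContDiff ℝ ∞ φ ∧ HasCompactSupport φ ∧ tsupport φ ⊆ U

/-- The time derivative `∂_t g`. -/
noncomputable def timeDeriv {F : Type*} [NormedAddCommGroup F] [NormedSpace ℝ F]
    (g : SpaceTime → F) (z : SpaceTime) : F :=
  fderiv ℝ g z (0, 1)

/-- The spatial derivative `∂_{x_j} g`. -/
noncomputable def spaceDeriv {F : Type*} [NormedAddCommGroup F] [NormedSpace ℝ F]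
    (j : Fin 3) (g : SpaceTime → F) (z : SpaceTime) : F :=
  fderiv ℝ g z (unitVec j, 0)

/-- `G` is the weak gradient of the vector field `w` in `Ω`: `G i j = ∂_j w_i` in the sense of
distributions. -/
def HasWeakGradient (Ω : Set E3) (w : E3 → E3) (G : E3 → Matrix (Fin 3) (Fin 3) ℝ) : Prop :=
  LocallyIntegrableOn w Ω volume ∧
  (∀ i j, LocallyIntegrableOn (fun x => G x i j) Ω volume) ∧
  ∀ φ : E3 → ℝ, IsTestFunction Ω φ → ∀ i j,
    ∫ x in Ω, w x i * fderiv ℝ φ x (unitVec j) = -∫ x in Ω, G x i j * φ x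

/-- The factor `P_ε(s) = 1 + ε s^m` in the pressure law `p(s) = s^{3/2} P_ε(s)`. -/
noncomputable def pressureFactor (ε m s : ℝ) : ℝ := 1 + ε * s ^ m

/-- The energy norm
`‖ϱ^{3/2} P_ε(ϱ)‖_{L^∞(0,T;L¹(Ω))} + ‖ϱ |u|²‖_{L^∞(0,T;L¹(Ω))} + ‖u‖_{L²(0,T;W^{1,2}(Ω))}`,
with values in `[0, ∞]`; `Du` stands for the spatial weak gradient of `u`. -/
noncomputable def energyNorm (Ω : Set E3) (T ε m : ℝ) (ϱ : SpaceTime → ℝ) (u : SpaceTime → E3)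
    (Du : SpaceTime → Matrix (Fin 3) (Fin 3) ℝ) : ℝ≥0∞ :=
  essSup (fun t => ∫⁻ x in Ω,
      ENNReal.ofReal (ϱ (x, t) ^ (3 / 2 : ℝ) * pressureFactor ε m (ϱ (x, t))))
    (volume.restrict (Ioo 0 T))
  + essSup (fun t => ∫⁻ x in Ω, ENNReal.ofReal (ϱ (x, t) * ‖u (x, t)‖ ^ 2))
    (volume.restrict (Ioo 0 T))
  + (∫⁻ z in cylinder Ω T,
      ENNReal.ofReal (‖u z‖ ^ 2 + ∑ i, ∑ j, Du z i j ^ 2)) ^ (1 / 2 : ℝ)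

/-- Weak form, inside `Q_T`, of the momentum equation
`∂_t(ϱu) + div(ϱ u ⊗ u) + ∇(ϱ^{3/2} P_ε(ϱ)) = div S + ϱ f`. -/
def MomentumBalance (Ω : Set E3) (T ε m : ℝ) (S : SpaceTime → Matrix (Fin 3) (Fin 3) ℝ)
    (f : SpaceTime → E3) (ϱ : SpaceTime → ℝ) (u : SpaceTime → E3) : Prop :=
  ∀ ξ : SpaceTime → E3, IsTestFunction (cylinder Ω T) ξ →
    (∫ z in cylinder Ω T, ϱ z * ∑ i, u z i * timeDeriv ξ z i)
    + (∫ z in cylinder Ω T, ∑ i, ∑ j,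
        (ϱ z * u z i * u z j
          + (if i = j then ϱ z ^ (3 / 2 : ℝ) * pressureFactor ε m (ϱ z) else 0)
          - S z i j) * spaceDeriv j ξ z i)
    + (∫ z in cylinder Ω T, ϱ z * ∑ i, f z i * ξ z i) = 0

/-- Weak form, inside `Q_T`, of the mass balance equation `∂_t ϱ + div(ϱ u) = 0`. -/
def MassBalance (Ω : Set E3) (T : ℝ) (ϱ : SpaceTime → ℝ) (u : SpaceTime → E3) : Prop :=
  ∀ ψ : SpaceTime → ℝ, IsTestFunction (cylinder Ω T) ψ →
    ∫ z in cylinder Ω T, (ϱ z * timeDeriv ψ z + ϱ z * ∑ j, u z j * spaceDeriv j ψ z) = 0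

/-- `(ϱ, u)` is a weak solution in `Q_T` of the compressible Navier-Stokes equations with the
pressure `ϱ^{3/2}(1 + ε ϱ^m)`, the stress tensor `S` and the force density `f`. The quantities
`E`, `MS`, `Mf` bound the energy norm, `‖S‖_{L²(Q_T)}` and `‖f‖_{L^∞(Q_T)}`. The Newtonian tensor
`ν₁ (∇u + ∇uᵀ) + ν₂ (div u) I` is one particular choice of `S`. -/
structure IsWeakSolution (Ω : Set E3) (T ε m : ℝ) (E MS Mf : ℝ≥0)
    (S : SpaceTime → Matrix (Fin 3) (Fin 3) ℝ) (f : SpaceTime → E3)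
    (ϱ : SpaceTime → ℝ) (u : SpaceTime → E3) : Prop where
  density_meas : AEStronglyMeasurable ϱ (volume.restrict (cylinder Ω T))
  velocity_meas : AEStronglyMeasurable u (volume.restrict (cylinder Ω T))
  stress_meas : ∀ i j,
    AEStronglyMeasurable (fun z => S z i j) (volume.restrict (cylinder Ω T))
  force_meas : AEStronglyMeasurable f (volume.restrict (cylinder Ω T))
  density_nonneg : ∀ᵐ z ∂(volume.restrict (cylinder Ω T)), 0 ≤ ϱ z
  /-- `u` has a spatial weak gradient and the energy norm is at most `E`. -/
  energy_le : ∃ Du : SpaceTime → Matrix (Fin 3) (Fin 3) ℝ,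
    (∀ i j, AEStronglyMeasurable (fun z => Du z i j) (volume.restrict (cylinder Ω T))) ∧
    (∀ᵐ t ∂(volume.restrict (Ioo 0 T)),
      HasWeakGradient Ω (fun x => u (x, t)) (fun x => Du (x, t))) ∧
    energyNorm Ω T ε m ϱ u Du ≤ E
  stress_le : (∫⁻ z in cylinder Ω T,
    ENNReal.ofReal (∑ i, ∑ j, S z i j ^ 2)) ^ (1 / 2 : ℝ) ≤ MS
  force_le : ∀ᵐ z ∂(volume.restrict (cylinder Ω T)), ‖f z‖ ≤ Mf
  momentum : MomentumBalance Ω T ε m S f ϱ u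
  mass : MassBalance Ω T ϱ u

/-- The localized density `ρ = lam⁴ ϱ`, which vanishes outside the support of `lam`. -/
def locDensity (lam ϱ : SpaceTime → ℝ) (z : SpaceTime) : ℝ := lam z ^ 4 * ϱ z

/-- The localized velocity `v = lam u`, which vanishes outside the support of `lam`. -/
noncomputable def locVelocity (lam : SpaceTime → ℝ) (u : SpaceTime → E3) (z : SpaceTime) : E3 :=
  lam z • u z

/-- `Π^∥(η) w`, the orthogonal projection of `w` onto the line spanned by `η`. -/
noncomputable def projPar (η w : E3) : E3 := (inner ℝ η w / ‖η‖ ^ 2) • η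

/-- `Π^⊥(η) w`, the orthogonal projection of `w` onto the plane orthogonal to `η`. -/
noncomputable def projPerp (η w : E3) : E3 := w - projPar η w

/-- `E^∥(x,y,t) = ½ |Π^∥(x-y)(v(x,t) - v(y,t))|² + ρ(x,t)^{1/2} P_ε(x,t)`,
where `P_ε = 1 + ε ϱ^m` is taken at the original density. -/
noncomputable def energyPar (lam : SpaceTime → ℝ) (ε m : ℝ) (ϱ : SpaceTime → ℝ)
    (u : SpaceTime → E3) (x y : E3) (t : ℝ) : ℝ :=
  (1 / 2) * ‖projPar (x - y) (locVelocity lam u (x, t) - locVelocity lam u (y, t))‖ ^ 2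
    + locDensity lam ϱ (x, t) ^ (1 / 2 : ℝ) * pressureFactor ε m (ϱ (x, t))

/-- `E^⊥(x,y,t) = ½ |Π^⊥(x-y)(v(x,t) - v(y,t))|² + 2 ρ(x,t)^{1/2} P_ε(x,t)`. -/
noncomputable def energyPerp (lam : SpaceTime → ℝ) (ε m : ℝ) (ϱ : SpaceTime → ℝ)
    (u : SpaceTime → E3) (x y : E3) (t : ℝ) : ℝ :=
  (1 / 2) * ‖projPerp (x - y) (locVelocity lam u (x, t) - locVelocity lam u (y, t))‖ ^ 2
    + 2 * (locDensity lam ϱ (x, t) ^ (1 / 2 : ℝ) * pressureFactor ε m (ϱ (x, t)))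

/-- `∫_{ℝ⁴} ρ(x,t) (∫_{B(x,s)} ρ(y,t) e(x,y,t) dy) dx dt` for a nonnegative `e`, as an element
of `[0, ∞]`. -/
noncomputable def pairEnergy (ρ : SpaceTime → ℝ) (e : E3 → E3 → ℝ → ℝ) (s : ℝ) : ℝ≥0∞ :=
  ∫⁻ z : SpaceTime, ENNReal.ofReal (ρ z) *
    ∫⁻ y in Metric.ball z.1 s, ENNReal.ofReal (ρ (y, z.2) * e z.1 y z.2)

/-- `Γ(r) = r⁻¹ ∫_{ℝ⁴} ρ(x,t) (∫_{B(x,r)} ρ(y,t) E^∥(x,y,t) dy) dx dt`. -/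
noncomputable def Gam (lam : SpaceTime → ℝ) (ε m : ℝ) (ϱ : SpaceTime → ℝ)
    (u : SpaceTime → E3) (r : ℝ) : ℝ≥0∞ :=
  ENNReal.ofReal (1 / r) * pairEnergy (locDensity lam ϱ) (energyPar lam ε m ϱ u) r

/-- `W(r) = ∫_0^r {∫_{ℝ⁴} ρ(x,t) (∫_{B(x,s)} ρ(y,t) E^⊥(x,y,t) dy) dx dt} ds / s²`. -/
noncomputable def W (lam : SpaceTime → ℝ) (ε m : ℝ) (ϱ : SpaceTime → ℝ)
    (u : SpaceTime → E3) (r : ℝ) : ℝ≥0∞ :=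
  ∫⁻ s in Ioo 0 r,
    pairEnergy (locDensity lam ϱ) (energyPerp lam ε m ϱ u) s * ENNReal.ofReal (1 / s ^ 2)

end CompressibleNS

namespace CompressibleNS

open Filter Topology

/-! Let X(s) (`pressureMass`) be the integral of ρ^{3/2}P_ε(x,t) ρ(y,t) over pairs with |x - y| < s.
Three inequalities, with constants that depend only on the data, force the decay: (a) Γ(r) + W(r) ≤
C (Γ(s) + s) for r ≤ s/2 (`exists_Gam_add_W_le`); (b) Γ(s) ≤ C (X(4s)/s)^{4/7}
(`exists_Gam_le_pressureMass`); (c) ∫_0^r 2 X(s) ds/s² ≤ W(r), because E^⊥ contains 2ρ^{1/2}P_ε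
(`two_mul_pressureMass_le_perp`).

For (a), the momentum equation is tested with λ⁶ (k * λ⁴ϱ), where the convolution is in space only
and k(x) = x (|x|² + r²)^{-1/2}, cut off at |x| = s. Up to the cutoff k is the gradient of a
smoothed |x|. The mass balance replaces the time derivative of λ⁴ϱ, and what is left is an integral
over pairs of simultaneous points (`integral_twoPoint`). Exchanging the two points and averaging
turns the convective terms into the quadratic form of ∇k on v(x) - v(y), and the pressure is
multiplied by div k. Since ∇k acts as one scalar across x - y and as another along it, the principal
part is a combination of ρρE^⊥ and ρρE^∥ (`mainPart_eq`). The transverse coefficient is about 1/|x -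
y|, which integrates to W by Fubini. The longitudinal one is at least 1/(3r) for |x - y| < r, which
gives Γ(r), and at least -C/s elsewhere, which costs Γ(s). All other terms are O(s)
(`lintegral_remainder_le`).

For (b), the fluctuation of v over pairs at distance less than s is bounded at each time in two
ways, by the kinetic energy and by a Sobolev inequality averaged over balls. Each bound carries a
power of the pressure mass of close pairs, and the geometric mean with weights 4/7 and 3/7 is
integrated in time by Hölder (`exists_fluctuation_le`).

Then the exponent is bootstrapped. If W(√r) ≤ w, then (c) and ∫ dσ/σ ≥ |log r|/4 over (8r, √r) give
a scale σ there with X(σ)/σ of order (w + √r)/|log r|. By (b) and (a), decay with exponent μ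
improves to exponent (4/7)(1 + μ). Starting from the uniform bound, μ = 0, the iterates increase to
the fixed point 4/3 (`hasLogDecay_of_lt`). -/

/-! ### Integrals over pairs of simultaneous points as limits of mollification in time -/

theorem integrable_pair {A B : SpaceTime → ℝ} {C : ℝ≥0} (hA : Integrable A) (hB : Measurable B)
    (hBC : ∀ t, ∫⁻ y, ‖B (y, t)‖ₑ ≤ C) :
    Integrable (fun w : SpaceTime × E3 => A w.1 * B (w.2, w.1.2)) := by
  have hm : AEStronglyMeasurable (fun w : SpaceTime × E3 => A w.1 * B (w.2, w.1.2)) :=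
    (hA.1.comp_fst).mul (hB.comp (by fun_prop : Measurable
      fun w : SpaceTime × E3 => (w.2, w.1.2))).aestronglyMeasurable
  refine ⟨hm, ?_⟩
  rw [HasFiniteIntegral, Measure.volume_eq_prod, lintegral_prod _ hm.enorm]
  calc ∫⁻ z : SpaceTime, ∫⁻ y, ‖A z * B (y, z.2)‖ₑ
      ≤ ∫⁻ z : SpaceTime, ‖A z‖ₑ * C := by
        refine lintegral_mono fun z => ?_
        simp only [enorm_mul]
        rw [lintegral_const_mul _ (by fun_prop)]
        gcongr
        exact hBC z.2
    _ < ⊤ := by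
        rw [lintegral_mul_const' _ _ (by simp)]
        exact ENNReal.mul_lt_top hA.2 (by simp)

/-- The convolution in space, at a fixed time, of `B` with the kernel `k`. -/
noncomputable def sliceConv (B : SpaceTime → ℝ) (k : E3 → ℝ) (z : SpaceTime) : ℝ :=
  ∫ y, B (y, z.2) * k (z.1 - y)

theorem stronglyMeasurable_sliceConv {B : SpaceTime → ℝ} {k : E3 → ℝ} (hB : Measurable B)
    (hk : Measurable k) : StronglyMeasurable (sliceConv B k) := by
  have : StronglyMeasurable (fun w : SpaceTime × E3 => B (w.2, w.1.2) * k (w.1.1 - w.2)) := by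
    apply Measurable.stronglyMeasurable
    fun_prop
  exact this.integral_prod_right

theorem norm_sliceConv_le {B : SpaceTime → ℝ} {k : E3 → ℝ} {C M : ℝ≥0}
    (hBC : ∀ t, ∫⁻ y, ‖B (y, t)‖ₑ ≤ C) (hM : ∀ x, ‖k x‖ ≤ M) (z : SpaceTime) :
    ‖sliceConv B k z‖ ≤ C * M := by
  have h : ‖sliceConv B k z‖ₑ ≤ C * M := by
    refine (enorm_integral_le_lintegral_enorm _).trans ?_
    calc ∫⁻ y, ‖B (y, z.2) * k (z.1 - y)‖ₑ ≤ ∫⁻ y, ‖B (y, z.2)‖ₑ * M := by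
          refine lintegral_mono fun y => ?_
          rw [enorm_mul]
          gcongr
          rw [enorm_le_coe]
          exact hM _
      _ ≤ C * M := by
          rw [lintegral_mul_const' _ _ (by simp)]
          gcongr
          exact hBC _
  rw [← ENNReal.coe_mul, enorm_le_coe] at h
  exact_mod_cast h

theorem integral_pair_eq {A B : SpaceTime → ℝ} {k : E3 → ℝ} {C M : ℝ≥0} (hA : Integrable A)
    (hB : Measurable B) (hBC : ∀ t, ∫⁻ y, ‖B (y, t)‖ₑ ≤ C) (hk : Measurable k)
    (hM : ∀ x, ‖k x‖ ≤ M) :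
    Integrable (fun w : SpaceTime × E3 => A w.1 * (B (w.2, w.1.2) * k (w.1.1 - w.2))) ∧
    ∫ w : SpaceTime × E3, A w.1 * (B (w.2, w.1.2) * k (w.1.1 - w.2)) =
      ∫ z, A z * sliceConv B k z := by
  have hi : Integrable (fun w : SpaceTime × E3 => A w.1 * (B (w.2, w.1.2) * k (w.1.1 - w.2))) := by
    have := (integrable_pair hA hB hBC).mul_bdd (c := (M : ℝ))
      (g := fun w : SpaceTime × E3 => k (w.1.1 - w.2))
      (Measurable.aestronglyMeasurable (by fun_prop)) (ae_of_all _ fun w => hM _)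
    simpa [mul_assoc] using this
  refine ⟨hi, ?_⟩
  rw [Measure.volume_eq_prod, integral_prod _ (by rwa [← Measure.volume_eq_prod])]
  congr 1
  ext z
  exact integral_const_mul (A z) _

theorem integral_bump_mul_eq {B : SpaceTime → ℝ} {k : E3 → ℝ} {θ : ℝ → ℝ} {M : ℝ≥0}
    (hB : Integrable B) (hk : Measurable k) (hM : ∀ x, ‖k x‖ ≤ M)
    (hθ : Continuous θ) (hθc : HasCompactSupport θ) (z : SpaceTime) :
    ∫ z' : SpaceTime, B z' * (k (z.1 - z'.1) * θ (z.2 - z'.2)) =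
      ∫ τ, θ (z.2 - τ) * sliceConv B k (z.1, τ) := by
  obtain ⟨N, hN⟩ := hθc.exists_bound_of_continuous hθ
  have hi : Integrable (fun z' : SpaceTime => B z' * (k (z.1 - z'.1) * θ (z.2 - z'.2))) := by
    refine hB.mul_bdd (c := M * N) (Measurable.aestronglyMeasurable (by fun_prop)) (ae_of_all _ fun w => ?_)
    rw [norm_mul]
    gcongr
    · exact hM _
    · exact hN _
  rw [Measure.volume_eq_prod, integral_prod_symm _ (by rwa [← Measure.volume_eq_prod])]
  congr 1
  ext τ
  rw [sliceConv, ← integral_const_mul]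
  congr 1
  ext y
  ring

/-- A convolution in space alone is not smooth in time and cannot enter a test function, so it is
mollified in time. The spatial convolution is bounded by C·M, which dominates. For every fixed x,
Lebesgue differentiation in t gives convergence at almost every t. -/
theorem tendsto_integral_bump_mul {A B : SpaceTime → ℝ} {k : E3 → ℝ} {C M : ℝ≥0}
    {θ : ℕ → ContDiffBump (0 : ℝ)} (hθ : Tendsto (fun n => (θ n).rOut) atTop (𝓝 0))
    (hθ' : ∀ n, (θ n).rOut ≤ 2 * (θ n).rIn)
    (hA : Integrable A) (hB : Measurable B) (hBi : Integrable B)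
    (hBC : ∀ t, ∫⁻ y, ‖B (y, t)‖ₑ ≤ C) (hk : Measurable k) (hM : ∀ x, ‖k x‖ ≤ M) :
    Tendsto (fun n => ∫ z : SpaceTime, A z * ∫ z' : SpaceTime,
        B z' * (k (z.1 - z'.1) * (θ n).normed volume (z.2 - z'.2))) atTop
      (𝓝 (∫ w : SpaceTime × E3, A w.1 * (B (w.2, w.1.2) * k (w.1.1 - w.2)))) := by
  rw [(integral_pair_eq hA hB hBC hk hM).2]
  set Φ := sliceConv B k with hΦ
  have hΦm : Measurable Φ := (stronglyMeasurable_sliceConv hB hk).measurable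
  have hΦb : ∀ z, ‖Φ z‖ ≤ C * M := norm_sliceConv_le hBC hM
  have hin : ∀ n (z : SpaceTime), ∫ z' : SpaceTime,
        B z' * (k (z.1 - z'.1) * (θ n).normed volume (z.2 - z'.2)) =
      ∫ τ, (θ n).normed volume (z.2 - τ) * Φ (z.1, τ) := fun n z =>
    integral_bump_mul_eq hBi hk hM (θ n).continuous_normed (θ n).hasCompactSupport_normed z
  simp only [hin]
  have hFm : ∀ n, Measurable fun z : SpaceTime =>
      ∫ τ, (θ n).normed volume (z.2 - τ) * Φ (z.1, τ) := by
    intro n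
    have : StronglyMeasurable (fun w : SpaceTime × ℝ =>
        (θ n).normed volume (w.1.2 - w.2) * Φ (w.1.1, w.2)) := by
      apply Measurable.stronglyMeasurable
      have := (θ n).continuous_normed (μ := volume)
      fun_prop
    exact this.integral_prod_right.measurable
  have hint : ∀ n t, Integrable fun τ => (θ n).normed volume (t - τ) := fun n t =>
    (θ n).integrable_normed.comp_sub_left t
  have hFb : ∀ n (z : SpaceTime), ‖∫ τ, (θ n).normed volume (z.2 - τ) * Φ (z.1, τ)‖ ≤ C * M := by
    intro n z
    calc _ ≤ ∫ τ, (θ n).normed volume (z.2 - τ) * (C * M) := by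
          refine norm_integral_le_of_norm_le ((hint n z.2).mul_const _) (ae_of_all _ fun τ => ?_)
          rw [norm_mul, Real.norm_of_nonneg ((θ n).nonneg_normed _)]
          gcongr
          · exact (θ n).nonneg_normed _
          · exact hΦb _
      _ = C * M := by
          rw [integral_mul_const, integral_sub_left_eq_self (fun τ => (θ n).normed volume τ),
            (θ n).integral_normed, one_mul]
  refine tendsto_integral_of_dominated_convergence (fun z => ‖A z‖ * (C * M))
    (fun n => hA.1.mul (hFm n).aestronglyMeasurable) (hA.norm.mul_const _) (fun n => ?_) ?_
  · refine ae_of_all _ fun z => ?_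
    rw [norm_mul]
    gcongr
    exact hFb n z
  -- Measurability of the convergence set lets Fubini turn "for every x, for a.e. t" into a.e.
  -- convergence in space-time.
  · have hset : MeasurableSet {z : SpaceTime | Tendsto
        (fun n => ∫ τ, (θ n).normed volume (z.2 - τ) * Φ (z.1, τ)) atTop (𝓝 (Φ z))} :=
      measurableSet_tendsto_fun hFm hΦm
    have hae : ∀ᵐ z : SpaceTime, Tendsto
        (fun n => ∫ τ, (θ n).normed volume (z.2 - τ) * Φ (z.1, τ)) atTop (𝓝 (Φ z)) := by
      rw [Measure.volume_eq_prod, Measure.ae_prod_iff_ae_ae hset]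
      refine ae_of_all _ fun x => ?_
      have hloc : LocallyIntegrable (fun τ => Φ (x, τ)) := by
        have h1 : LocallyIntegrable (fun _ : ℝ => (C * M : ℝ)) := locallyIntegrable_const _
        refine h1.mono (Measurable.aestronglyMeasurable (by fun_prop)) (ae_of_all _ fun τ => ?_)
        exact (hΦb _).trans (Real.le_norm_self _)
      filter_upwards [ContDiffBump.ae_convolution_tendsto_right_of_locallyIntegrable hθ
        (Eventually.of_forall hθ') hloc] with t ht
      simpa [convolution_eq_swap] using ht
    filter_upwards [hae] with z hz
    exact hz.const_mul _

/-! ### Space-time convolution with product kernels, and the mass balance -/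

instance : (volume : Measure SpaceTime).IsAddHaarMeasure :=
  Measure.prod.instIsAddHaarMeasure volume volume

/-- The tensor product of a kernel in space and a kernel in time. -/
def tensorKernel (k : E3 → ℝ) (θ : ℝ → ℝ) (z : SpaceTime) : ℝ := k z.1 * θ z.2

/-- The space-time convolution of `B` with a tensor product kernel. -/
noncomputable def bumpConv (B : SpaceTime → ℝ) (k : E3 → ℝ) (θ : ℝ → ℝ) (z : SpaceTime) : ℝ :=
  ∫ z' : SpaceTime, B z' * (k (z.1 - z'.1) * θ (z.2 - z'.2))

/-- The partial derivative in direction `j` of a function on `ℝ³`. -/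
noncomputable def partialDeriv (j : Fin 3) (k : E3 → ℝ) (x : E3) : ℝ := fderiv ℝ k x (unitVec j)

theorem fderiv_tensorKernel {k : E3 → ℝ} {θ : ℝ → ℝ} (hk : ContDiff ℝ ∞ k) (hθ : ContDiff ℝ ∞ θ)
    (z : SpaceTime) (v : SpaceTime) :
    fderiv ℝ (tensorKernel k θ) z v = fderiv ℝ k z.1 v.1 * θ z.2 + k z.1 * (deriv θ z.2 * v.2) := by
  have h1 : HasFDerivAt (fun z : SpaceTime => k z.1)
      ((fderiv ℝ k z.1).comp (ContinuousLinearMap.fst ℝ E3 ℝ)) z :=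
    ((hk.differentiable (by simp)) z.1).hasFDerivAt.comp z hasFDerivAt_fst
  have h2 : HasFDerivAt (fun z : SpaceTime => θ z.2)
      ((fderiv ℝ θ z.2).comp (ContinuousLinearMap.snd ℝ E3 ℝ)) z :=
    ((hθ.differentiable (by simp)) z.2).hasFDerivAt.comp z hasFDerivAt_snd
  have h3 : HasFDerivAt (tensorKernel k θ) _ z := h1.mul h2
  have h4 : fderiv ℝ θ z.2 v.2 = deriv θ z.2 * v.2 := by
    rw [fderiv_eq_smul_deriv, smul_eq_mul, mul_comm]
  rw [h3.fderiv]
  simp [h4]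
  ring

theorem contDiff_tensorKernel {k : E3 → ℝ} {θ : ℝ → ℝ} (hk : ContDiff ℝ ∞ k)
    (hθ : ContDiff ℝ ∞ θ) : ContDiff ℝ ∞ (tensorKernel k θ) :=
  (hk.comp contDiff_fst).mul (hθ.comp contDiff_snd)

theorem hasCompactSupport_tensorKernel {k : E3 → ℝ} {θ : ℝ → ℝ} (hk : HasCompactSupport k)
    (hθ : HasCompactSupport θ) : HasCompactSupport (tensorKernel k θ) := by
  refine HasCompactSupport.intro (hk.isCompact.prod hθ.isCompact) fun z hz => ?_
  simp only [mem_prod, not_and_or] at hz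
  rcases hz with h | h
  · simp [tensorKernel, image_eq_zero_of_notMem_tsupport h]
  · simp [tensorKernel, image_eq_zero_of_notMem_tsupport h]

theorem continuous_partialDeriv {k : E3 → ℝ} (hk : ContDiff ℝ ∞ k) (j : Fin 3) :
    Continuous (partialDeriv j k) :=
  (hk.continuous_fderiv (by simp)).clm_apply continuous_const

theorem hasCompactSupport_partialDeriv {k : E3 → ℝ} (hk : HasCompactSupport k) (j : Fin 3) :
    HasCompactSupport (partialDeriv j k) :=
  hk.fderiv_apply ℝ _

theorem bumpConv_eq_convolution (B : SpaceTime → ℝ) (k : E3 → ℝ) (θ : ℝ → ℝ) :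
    bumpConv B k θ =
      convolution B (tensorKernel k θ) (ContinuousLinearMap.mul ℝ ℝ) volume := by
  ext z
  simp [bumpConv, convolution, tensorKernel]

theorem fderiv_bumpConv {B : SpaceTime → ℝ} {k : E3 → ℝ} {θ : ℝ → ℝ} (hB : Integrable B)
    (hk : ContDiff ℝ ∞ k) (hkc : HasCompactSupport k) (hθ : ContDiff ℝ ∞ θ)
    (hθc : HasCompactSupport θ) (z v : SpaceTime) :
    fderiv ℝ (bumpConv B k θ) z v =
      ∫ z' : SpaceTime, B z' * fderiv ℝ (tensorKernel k θ) (z - z') v := by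
  have hc := hasCompactSupport_tensorKernel hkc hθc
  have hd := contDiff_tensorKernel hk hθ
  have h := hc.hasFDerivAt_convolution_right (ContinuousLinearMap.mul ℝ ℝ) hB.locallyIntegrable
    (hd.of_le (by simp)) z
  rw [bumpConv_eq_convolution, h.fderiv, convolution_precompR_apply _ hB.locallyIntegrable
    (hc.fderiv ℝ) (hd.continuous_fderiv (by simp))]
  simp [convolution]

theorem contDiff_bumpConv {B : SpaceTime → ℝ} {k : E3 → ℝ} {θ : ℝ → ℝ} (hB : Integrable B)
    (hk : ContDiff ℝ ∞ k) (hkc : HasCompactSupport k) (hθ : ContDiff ℝ ∞ θ)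
    (hθc : HasCompactSupport θ) : ContDiff ℝ ∞ (bumpConv B k θ) := by
  rw [bumpConv_eq_convolution]
  exact (hasCompactSupport_tensorKernel hkc hθc).contDiff_convolution_right (n := ⊤) _
    hB.locallyIntegrable (contDiff_tensorKernel hk hθ)

theorem spaceDeriv_bumpConv {B : SpaceTime → ℝ} {k : E3 → ℝ} {θ : ℝ → ℝ} (hB : Integrable B)
    (hk : ContDiff ℝ ∞ k) (hkc : HasCompactSupport k) (hθ : ContDiff ℝ ∞ θ)
    (hθc : HasCompactSupport θ) (z : SpaceTime) (j : Fin 3) :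
    spaceDeriv j (bumpConv B k θ) z = bumpConv B (partialDeriv j k) θ z := by
  rw [spaceDeriv, fderiv_bumpConv hB hk hkc hθ hθc]
  simp [bumpConv, partialDeriv, fderiv_tensorKernel hk hθ]

theorem timeDeriv_bumpConv {B : SpaceTime → ℝ} {k : E3 → ℝ} {θ : ℝ → ℝ} (hB : Integrable B)
    (hk : ContDiff ℝ ∞ k) (hkc : HasCompactSupport k) (hθ : ContDiff ℝ ∞ θ)
    (hθc : HasCompactSupport θ) (z : SpaceTime) :
    timeDeriv (bumpConv B k θ) z = bumpConv B k (deriv θ) z := by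
  rw [timeDeriv, fderiv_bumpConv hB hk hkc hθ hθc]
  simp [bumpConv, fderiv_tensorKernel hk hθ]

theorem integrable_mul_kernel {B : SpaceTime → ℝ} {k : E3 → ℝ} {θ : ℝ → ℝ} (hB : Integrable B)
    (hk : Continuous k) (hkc : HasCompactSupport k) (hθ : Continuous θ)
    (hθc : HasCompactSupport θ) (z : SpaceTime) :
    Integrable (fun z' : SpaceTime => B z' * (k (z.1 - z'.1) * θ (z.2 - z'.2))) := by
  obtain ⟨M, hM⟩ := hkc.exists_bound_of_continuous hk
  obtain ⟨N, hN⟩ := hθc.exists_bound_of_continuous hθ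
  have := (norm_nonneg _).trans (hM 0)
  refine hB.mul_bdd (c := M * N) (Continuous.aestronglyMeasurable (by fun_prop))
    (ae_of_all _ fun w => ?_)
  rw [norm_mul]
  gcongr
  · exact hM _
  · exact hN _

theorem integrable_mul_bumpConv {A B : SpaceTime → ℝ} {k : E3 → ℝ} {θ : ℝ → ℝ}
    (hA : Integrable A) (hB : Integrable B)
    (hk : Continuous k) (hkc : HasCompactSupport k) (hθ : Continuous θ)
    (hθc : HasCompactSupport θ) : Integrable (fun z => A z * bumpConv B k θ z) := by
  obtain ⟨M, hM⟩ := hkc.exists_bound_of_continuous hk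
  obtain ⟨N, hN⟩ := hθc.exists_bound_of_continuous hθ
  have := (norm_nonneg _).trans (hM 0)
  have hcont : Continuous (tensorKernel k θ) :=
    (hk.comp continuous_fst).mul (hθ.comp continuous_snd)
  have hc : Continuous (bumpConv B k θ) := by
    rw [bumpConv_eq_convolution]
    exact (hasCompactSupport_tensorKernel hkc hθc).continuous_convolution_right _
      hB.locallyIntegrable hcont
  refine hA.mul_bdd (c := ∫ z', ‖B z'‖ * (M * N)) hc.aestronglyMeasurable
    (ae_of_all _ fun z => ?_)
  refine norm_integral_le_of_norm_le (hB.norm.mul_const _) (ae_of_all _ fun z' => ?_)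
  rw [norm_mul, norm_mul]
  gcongr
  · exact hM _
  · exact hN _

theorem isTestFunction_mul {X : Type*} [NormedAddCommGroup X] [NormedSpace ℝ X] {U : Set X}
    {β f : X → ℝ} (hβ : IsTestFunction U β)
    (hf : ContDiff ℝ ∞ f) : IsTestFunction U (fun z => β z * f z) :=
  ⟨hβ.1.mul hf, hβ.2.1.mul_right, (tsupport_mul_subset_left).trans hβ.2.2⟩

theorem fderiv_mul_apply {X : Type*} [NormedAddCommGroup X] [NormedSpace ℝ X] {α f : X → ℝ}
    (hα : ContDiff ℝ ∞ α) (hf : ContDiff ℝ ∞ f) (z v : X) :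
    fderiv ℝ (fun z => α z * f z) z v = α z * fderiv ℝ f z v + fderiv ℝ α z v * f z := by
  rw [fderiv_fun_mul (hα.differentiable (by simp) z) (hf.differentiable (by simp) z)]
  simp [mul_comm]

theorem fderiv_reflected_kernel {k : E3 → ℝ} {θ : ℝ → ℝ} (hk : ContDiff ℝ ∞ k)
    (hθ : ContDiff ℝ ∞ θ) (z z' v : SpaceTime) :
    fderiv ℝ (fun z' => tensorKernel k θ (z - z')) z' v =
      -fderiv ℝ (tensorKernel k θ) (z - z') v := by
  have h := ((contDiff_tensorKernel hk hθ).differentiable (by simp) (z - z')).hasFDerivAt.comp z'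
    ((hasFDerivAt_id z').const_sub z)
  have h' : HasFDerivAt (fun z' => tensorKernel k θ (z - z')) _ z' := h
  rw [h'.fderiv]
  simp

/-- The mass balance, tested with the reflected kernel times a cutoff. -/
theorem bumpConv_deriv_eq {U : Set SpaceTime} {ϱ : SpaceTime → ℝ} {J : Fin 3 → SpaceTime → ℝ}
    (hϱ : Integrable ϱ) (hJ : ∀ j, Integrable (J j))
    (hmass : ∀ ψ : SpaceTime → ℝ, IsTestFunction U ψ →
      ∫ z, (ϱ z * timeDeriv ψ z + ∑ j, J j z * spaceDeriv j ψ z) = 0)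
    {β : SpaceTime → ℝ} (hβ : IsTestFunction U β)
    {k : E3 → ℝ} {θ : ℝ → ℝ}
    (hk : ContDiff ℝ ∞ k) (hkc : HasCompactSupport k) (hθ : ContDiff ℝ ∞ θ)
    (hθc : HasCompactSupport θ) (z : SpaceTime) :
    bumpConv (fun z => β z * ϱ z) k (deriv θ) z =
      bumpConv (fun z => timeDeriv β z * ϱ z + ∑ j, spaceDeriv j β z * J j z) k θ z
        + ∑ j, bumpConv (fun z => -(β z * J j z)) (partialDeriv j k) θ z := by
  have hψ := hmass (fun z' => β z' * tensorKernel k θ (z - z'))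
    (isTestFunction_mul hβ ((contDiff_tensorKernel hk hθ).comp (contDiff_const.sub contDiff_id)))
  have hcd : ContDiff ℝ ∞ fun z' => tensorKernel k θ (z - z') :=
    (contDiff_tensorKernel hk hθ).comp (contDiff_const.sub contDiff_id)
  simp only [timeDeriv, spaceDeriv, fderiv_mul_apply hβ.1 hcd, fderiv_reflected_kernel hk hθ,
    fderiv_tensorKernel hk hθ] at hψ
  simp only [map_zero, Prod.fst_sub, Prod.snd_sub, mul_one, mul_zero, zero_mul, zero_add,
    add_zero, tensorKernel] at hψ
  have hθ' : Continuous (deriv θ) := hθ.continuous_deriv (by simp)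
  have hbd : ∀ v, ∃ C, ∀ z, ‖fderiv ℝ β z v‖ ≤ C := fun v =>
    (hβ.2.1.fderiv_apply ℝ v).exists_bound_of_continuous
      ((hβ.1.continuous_fderiv (by simp)).clm_apply continuous_const)
  have hbm : ∀ v, AEStronglyMeasurable (fun z => fderiv ℝ β z v) := fun v =>
    ((hβ.1.continuous_fderiv (by simp)).clm_apply continuous_const).aestronglyMeasurable
  obtain ⟨Cβ, hCβ⟩ := hβ.2.1.exists_bound_of_continuous hβ.1.continuous
  have i1 : Integrable (fun z => β z * ϱ z) :=
    hϱ.bdd_mul hβ.1.continuous.aestronglyMeasurable (ae_of_all _ hCβ)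
  have i2 : Integrable (fun z => timeDeriv β z * ϱ z) := by
    obtain ⟨C, hC⟩ := hbd (0, 1)
    exact hϱ.bdd_mul (hbm _) (ae_of_all _ hC)
  have i3 : ∀ j, Integrable (fun z => spaceDeriv j β z * J j z) := by
    intro j
    obtain ⟨C, hC⟩ := hbd (unitVec j, 0)
    exact (hJ j).bdd_mul (hbm _) (ae_of_all _ hC)
  have i4 : ∀ j, Integrable (fun z => -(β z * J j z)) := fun j =>
    ((hJ j).bdd_mul hβ.1.continuous.aestronglyMeasurable (ae_of_all _ hCβ)).neg
  have i5 : Integrable (fun z => timeDeriv β z * ϱ z + ∑ j, spaceDeriv j β z * J j z) :=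
    i2.add (integrable_finsetSum _ fun j _ => i3 j)
  have j1 := integrable_mul_kernel i1 hk.continuous hkc hθ' hθc.deriv z
  have j2 := integrable_mul_kernel i5 hk.continuous hkc hθ.continuous hθc z
  have j3 := fun j => integrable_mul_kernel (i4 j) (continuous_partialDeriv hk j)
    (hasCompactSupport_partialDeriv hkc j) hθ.continuous hθc z
  -- Reflecting the kernel flips the sign of each of its derivatives, so the tested mass balance is
  -- minus the difference of the two sides.
  rw [← sub_eq_zero, ← neg_eq_zero, ← hψ]
  simp only [bumpConv]
  have j4 := integrable_finsetSum Finset.univ fun j _ => j3 j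
  rw [← integral_finsetSum _ fun j _ => j3 j, ← integral_add j2 j4,
    ← integral_sub j1 (j2.fun_add j4), ← integral_neg]
  congr 1
  ext z'
  simp only [partialDeriv, timeDeriv, spaceDeriv, Fin.sum_univ_three]
  ring

/-! ### The two-point identity -/

/-- The second point `(y, t)` of a pair `((x, t), y)` of simultaneous points. -/
def other (w : SpaceTime × E3) : SpaceTime := (w.2, w.1.2)

/-- The displacement `x - y` of a pair `((x, t), y)` of simultaneous points. -/
def displ (w : SpaceTime × E3) : E3 := w.1.1 - w.2

theorem measurable_other : Measurable other := by unfold other; fun_prop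
theorem measurable_displ : Measurable displ := by unfold displ; fun_prop

/-- A sequence of bump functions in time that shrinks to a point. -/
noncomputable def timeBump (n : ℕ) : ContDiffBump (0 : ℝ) where
  rIn := 1 / (n + 1)
  rOut := 2 * (1 / (n + 1))
  rIn_pos := by positivity
  rIn_lt_rOut := by
    have : (0 : ℝ) < 1 / (n + 1) := by positivity
    linarith

theorem tendsto_timeBump : Tendsto (fun n => (timeBump n).rOut) atTop (𝓝 0) := by
  have := (tendsto_one_div_add_atTop_nhds_zero_nat (𝕜 := ℝ)).const_mul 2
  simpa [timeBump] using this

/-- A function in `L¹` of space-time that is bounded in `L¹` of space, uniformly in time. -/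
structure SliceBounded (B : SpaceTime → ℝ) : Prop where
  meas : Measurable B
  integrable : Integrable B
  bound : ∃ C : ℝ≥0, ∀ t, ∫⁻ y, ‖B (y, t)‖ₑ ≤ C

theorem SliceBounded.bdd_mul {B g : SpaceTime → ℝ} (hB : SliceBounded B) (hg : Measurable g)
    {M : ℝ} (hM : ∀ z, ‖g z‖ ≤ M) : SliceBounded (fun z => g z * B z) := by
  refine ⟨hg.mul hB.meas, hB.integrable.bdd_mul hg.aestronglyMeasurable (ae_of_all _ hM), ?_⟩
  obtain ⟨C, hC⟩ := hB.bound
  refine ⟨M.toNNReal * C, fun t => ?_⟩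
  calc ∫⁻ y, ‖g (y, t) * B (y, t)‖ₑ ≤ ∫⁻ y, (M.toNNReal : ℝ≥0∞) * ‖B (y, t)‖ₑ := by
        refine lintegral_mono fun y => ?_
        rw [enorm_mul]
        gcongr
        rw [enorm_le_coe, ← NNReal.coe_le_coe]
        exact (hM _).trans (Real.le_coe_toNNReal M)
    _ ≤ _ := by
        rw [lintegral_const_mul' _ _ (by simp), ENNReal.coe_mul]
        gcongr
        exact hC t

theorem SliceBounded.add {B B' : SpaceTime → ℝ} (hB : SliceBounded B) (hB' : SliceBounded B') :
    SliceBounded (fun z => B z + B' z) := by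
  refine ⟨hB.meas.add hB'.meas, hB.integrable.add hB'.integrable, ?_⟩
  obtain ⟨C, hC⟩ := hB.bound
  obtain ⟨C', hC'⟩ := hB'.bound
  refine ⟨C + C', fun t => ?_⟩
  calc ∫⁻ y, ‖B (y, t) + B' (y, t)‖ₑ ≤ ∫⁻ y, (‖B (y, t)‖ₑ + ‖B' (y, t)‖ₑ) :=
        lintegral_mono fun y => enorm_add_le _ _
    _ ≤ _ := by
        have := hB.meas
        rw [lintegral_add_left (by fun_prop), ENNReal.coe_add]
        gcongr
        · exact hC t
        · exact hC' t

theorem SliceBounded.neg {B : SpaceTime → ℝ} (hB : SliceBounded B) :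
    SliceBounded (fun z => -B z) := by
  refine ⟨hB.meas.neg, hB.integrable.neg, ?_⟩
  obtain ⟨C, hC⟩ := hB.bound
  exact ⟨C, fun t => by simpa using hC t⟩

/-- Once no derivative falls on the time mollifier, every term of a mollified identity has the form
A · (B * (k ⊗ θ_n)) and converges to an integral over pairs. A finite family of such terms passes to
the limit together. -/
theorem integral_pair_eq_zero {ι : Type*} [Fintype ι] {A B : ι → SpaceTime → ℝ}
    {k : ι → E3 → ℝ} (hA : ∀ a, Integrable (A a)) (hB : ∀ a, SliceBounded (B a))
    (hk : ∀ a, Continuous (k a)) (hkc : ∀ a, HasCompactSupport (k a))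
    (h : ∀ n, ∫ z, ∑ a, A a z * bumpConv (B a) (k a) ((timeBump n).normed volume) z = 0) :
    Integrable (fun w => ∑ a, A a w.1 * (B a (other w) * k a (displ w))) ∧
    ∫ w, ∑ a, A a w.1 * (B a (other w) * k a (displ w)) = 0 := by
  have hM : ∀ a, ∃ M : ℝ≥0, ∀ x, ‖k a x‖ ≤ M := fun a => by
    obtain ⟨M, hM⟩ := (hkc a).exists_bound_of_continuous (hk a)
    exact ⟨M.toNNReal, fun x => (hM x).trans (Real.le_coe_toNNReal M)⟩
  have hi : ∀ a, Integrable (fun w => A a w.1 * (B a (other w) * k a (displ w))) := fun a => by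
    obtain ⟨M, hM⟩ := hM a
    obtain ⟨C, hC⟩ := (hB a).bound
    exact (integral_pair_eq (hA a) (hB a).meas hC (hk a).measurable hM).1
  refine ⟨integrable_finsetSum _ fun a _ => hi a, ?_⟩
  rw [integral_finsetSum _ fun a _ => hi a]
  have hlim : Tendsto (fun n => ∑ a, ∫ z, A a z *
      bumpConv (B a) (k a) ((timeBump n).normed volume) z) atTop
      (𝓝 (∑ a, ∫ w, A a w.1 * (B a (other w) * k a (displ w)))) := by
    refine tendsto_finsetSum _ fun a _ => ?_
    obtain ⟨M, hM⟩ := hM a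
    obtain ⟨C, hC⟩ := (hB a).bound
    exact tendsto_integral_bump_mul tendsto_timeBump (fun n => le_rfl) (hA a) (hB a).meas
      (hB a).integrable hC (hk a).measurable hM
  refine tendsto_nhds_unique hlim (tendsto_const_nhds.congr fun n => ?_)
  refine (h n).symm.trans ?_
  rw [integral_finsetSum]
  exact fun a _ => integrable_mul_bumpConv (hA a) (hB a).integrable (hk a) (hkc a)
    (timeBump n).continuous_normed (timeBump n).hasCompactSupport_normed

/-- The integrand of the two-point identity: the `i`-th momentum equation, tested with
`α · (k * (β ϱ))`, after elimination of the time derivative by the mass balance. -/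
noncomputable def twoPoint (ϱ m F α β : SpaceTime → ℝ) (J T : Fin 3 → SpaceTime → ℝ) (k : E3 → ℝ)
    (w : SpaceTime × E3) : ℝ :=
  m w.1 * (timeDeriv α w.1 * (β (other w) * ϱ (other w) * k (displ w))
    + α w.1 * ((timeDeriv β (other w) * ϱ (other w)
        + ∑ j, spaceDeriv j β (other w) * J j (other w)) * k (displ w)
      - ∑ j, β (other w) * J j (other w) * partialDeriv j k (displ w)))
  + (∑ j, T j w.1 * (spaceDeriv j α w.1 * (β (other w) * ϱ (other w) * k (displ w))
      + α w.1 * (β (other w) * ϱ (other w) * partialDeriv j k (displ w))))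
  + F w.1 * (α w.1 * (β (other w) * ϱ (other w) * k (displ w)))

/-- The test function is α times the space-time convolution of βϱ with k ⊗ θ_n. The derivative θ_n'
from the time derivative would diverge as n grows. The mass balance trades it for ∂_tβ, ∇β and ∇k,
and then the limit exists. -/
theorem integral_twoPoint {U : Set SpaceTime} {ϱ m F : SpaceTime → ℝ}
    {J T : Fin 3 → SpaceTime → ℝ}
    (hϱ : SliceBounded ϱ) (hJ : ∀ j, SliceBounded (J j))
    (hm : Integrable m) (hT : ∀ j, Integrable (T j)) (hF : Integrable F)
    (hmass : ∀ ψ : SpaceTime → ℝ, IsTestFunction U ψ →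
      ∫ z, (ϱ z * timeDeriv ψ z + ∑ j, J j z * spaceDeriv j ψ z) = 0)
    (hmom : ∀ ξ : SpaceTime → ℝ, IsTestFunction U ξ →
      ∫ z, (m z * timeDeriv ξ z + ∑ j, T j z * spaceDeriv j ξ z + F z * ξ z) = 0)
    {α β : SpaceTime → ℝ} (hα : IsTestFunction U α) (hβ : IsTestFunction U β)
    {k : E3 → ℝ} (hk : ContDiff ℝ ∞ k) (hkc : HasCompactSupport k) :
    Integrable (twoPoint ϱ m F α β J T k) ∧ ∫ w, twoPoint ϱ m F α β J T k w = 0 := by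
  have hbd : ∀ {γ : SpaceTime → ℝ}, IsTestFunction U γ → ∀ v, ∃ C, ∀ z, ‖fderiv ℝ γ z v‖ ≤ C :=
    fun hγ v => (hγ.2.1.fderiv_apply ℝ v).exists_bound_of_continuous
      ((hγ.1.continuous_fderiv (by simp)).clm_apply continuous_const)
  have hbm : ∀ {γ : SpaceTime → ℝ}, IsTestFunction U γ → ∀ v, Measurable fun z => fderiv ℝ γ z v :=
    fun hγ v => ((hγ.1.continuous_fderiv (by simp)).clm_apply continuous_const).measurable
  obtain ⟨Cα, hCα⟩ := hα.2.1.exists_bound_of_continuous hα.1.continuous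
  obtain ⟨Cβ, hCβ⟩ := hβ.2.1.exists_bound_of_continuous hβ.1.continuous
  have mα := hα.1.continuous.measurable
  have mβ := hβ.1.continuous.measurable
  -- the factors at the first point
  have aα : ∀ {f : SpaceTime → ℝ}, Integrable f → Integrable fun z => f z * α z := fun hf =>
    hf.mul_bdd mα.aestronglyMeasurable (ae_of_all _ hCα)
  have aα' : ∀ {f : SpaceTime → ℝ} (v), Integrable f →
      Integrable fun z => f z * fderiv ℝ α z v := fun v hf => by
    obtain ⟨C, hC⟩ := hbd hα v
    exact hf.mul_bdd (hbm hα v).aestronglyMeasurable (ae_of_all _ hC)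
  -- the factors at the second point
  have b1 : SliceBounded fun z => β z * ϱ z := hϱ.bdd_mul mβ hCβ
  have b2 : SliceBounded fun z => timeDeriv β z * ϱ z + ∑ j, spaceDeriv j β z * J j z := by
    obtain ⟨C, hC⟩ := hbd hβ (0, 1)
    refine (hϱ.bdd_mul (hbm hβ _) hC).add ?_
    have h : ∀ j, SliceBounded fun z => spaceDeriv j β z * J j z := fun j => by
      obtain ⟨C, hC⟩ := hbd hβ (unitVec j, 0)
      exact (hJ j).bdd_mul (hbm hβ _) hC
    simpa only [Fin.sum_univ_three] using ((h 0).add (h 1)).add (h 2)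
  have b3 : ∀ j, SliceBounded fun z => -(β z * J j z) := fun j => ((hJ j).bdd_mul mβ hCβ).neg
  -- The first block holds the three terms without a sum over directions: ∂_tα, the derivatives of
  -- β, and the force. The others, indexed by direction, hold the convective flux of the mass
  -- balance against ∂_jk, the flux T against ∂_jα, and T against ∂_jk.
  let A : (Fin 3 ⊕ Fin 3 ⊕ Fin 3 ⊕ Fin 3) → SpaceTime → ℝ :=
    Sum.elim ![fun z => m z * timeDeriv α z, fun z => m z * α z, fun z => F z * α z]
      (Sum.elim (fun _ z => m z * α z) (Sum.elim (fun j z => T j z * spaceDeriv j α z)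
        (fun j z => T j z * α z)))
  let B : (Fin 3 ⊕ Fin 3 ⊕ Fin 3 ⊕ Fin 3) → SpaceTime → ℝ :=
    Sum.elim ![fun z => β z * ϱ z,
        fun z => timeDeriv β z * ϱ z + ∑ j, spaceDeriv j β z * J j z, fun z => β z * ϱ z]
      (Sum.elim (fun j z => -(β z * J j z)) (Sum.elim (fun _ z => β z * ϱ z)
        (fun _ z => β z * ϱ z)))
  let κ : (Fin 3 ⊕ Fin 3 ⊕ Fin 3 ⊕ Fin 3) → E3 → ℝ :=
    Sum.elim (fun _ => k)
      (Sum.elim (fun j => partialDeriv j k) (Sum.elim (fun _ => k) (fun j => partialDeriv j k)))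
  have hA : ∀ a, Integrable (A a) := by
    rintro (a | j | j | j)
    · fin_cases a
      · exact aα' _ hm
      · exact aα hm
      · exact aα hF
    · exact aα hm
    · exact aα' _ (hT j)
    · exact aα (hT j)
  have hB : ∀ a, SliceBounded (B a) := by
    rintro (a | j | j | j)
    · fin_cases a
      · exact b1
      · exact b2
      · exact b1
    · exact b3 j
    · exact b1
    · exact b1
  have hκ : ∀ a, Continuous (κ a) := by
    rintro (a | j | j | j)
    exacts [hk.continuous, continuous_partialDeriv hk j, hk.continuous, continuous_partialDeriv hk j]
  have hκc : ∀ a, HasCompactSupport (κ a) := by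
    rintro (a | j | j | j)
    exacts [hkc, hasCompactSupport_partialDeriv hkc j, hkc, hasCompactSupport_partialDeriv hkc j]
  have key := integral_pair_eq_zero hA hB hκ hκc fun n => by
    set θ := (timeBump n).normed volume with hθdef
    have hθ : ContDiff ℝ ∞ θ := (timeBump n).contDiff_normed
    have hθc : HasCompactSupport θ := (timeBump n).hasCompactSupport_normed
    have hV := contDiff_bumpConv b1.integrable hk hkc hθ hθc
    have hξ := hmom _ (isTestFunction_mul hα hV)
    rw [← hξ]
    congr 1
    ext z
    have e1 : timeDeriv (fun z => α z * bumpConv (fun z => β z * ϱ z) k θ z) z =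
        α z * timeDeriv (bumpConv (fun z => β z * ϱ z) k θ) z
          + timeDeriv α z * bumpConv (fun z => β z * ϱ z) k θ z := fderiv_mul_apply hα.1 hV z _
    have e2 : ∀ j, spaceDeriv j (fun z => α z * bumpConv (fun z => β z * ϱ z) k θ z) z =
        α z * spaceDeriv j (bumpConv (fun z => β z * ϱ z) k θ) z
          + spaceDeriv j α z * bumpConv (fun z => β z * ϱ z) k θ z :=
      fun j => fderiv_mul_apply hα.1 hV z _
    rw [e1]
    simp only [e2]
    rw [timeDeriv_bumpConv b1.integrable hk hkc hθ hθc,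
      bumpConv_deriv_eq hϱ.integrable (fun j => (hJ j).integrable) hmass hβ hk hkc hθ hθc]
    simp only [spaceDeriv_bumpConv b1.integrable hk hkc hθ hθc]
    simp only [A, B, κ, Fintype.sum_sum_type, Fin.sum_univ_three, Sum.elim_inl, Sum.elim_inr,
      Matrix.cons_val]
    ring
  have heq : twoPoint ϱ m F α β J T k = fun w => ∑ a, A a w.1 * (B a (other w) * κ a (displ w)) := by
    ext w
    simp only [twoPoint, A, B, κ, Fintype.sum_sum_type, Fin.sum_univ_three, Sum.elim_inl,
      Sum.elim_inr, Matrix.cons_val]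
    ring
  rw [heq]
  exact key

/-! ### The radial kernel and its gradient -/

/-- A smooth cutoff on the line, equal to `1` on `(-∞, 1/2]` and to `0` on `[1, ∞)`. -/
noncomputable def cutoff (q : ℝ) : ℝ := Real.smoothTransition (2 * (1 - q))

theorem contDiff_cutoff : ContDiff ℝ ∞ cutoff :=
  Real.smoothTransition.contDiff.comp (by fun_prop)

theorem cutoff_nonneg (q : ℝ) : 0 ≤ cutoff q := Real.smoothTransition.nonneg _

theorem cutoff_le_one (q : ℝ) : cutoff q ≤ 1 := Real.smoothTransition.le_one _

theorem cutoff_eq_one {q : ℝ} (h : q ≤ 1 / 2) : cutoff q = 1 :=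
  Real.smoothTransition.one_of_one_le (by linarith)

theorem cutoff_eq_zero {q : ℝ} (h : 1 ≤ q) : cutoff q = 0 :=
  Real.smoothTransition.zero_of_nonpos (by linarith)

theorem deriv_cutoff_eq_zero_of_lt {q : ℝ} (h : q < 1 / 2) : deriv cutoff q = 0 := by
  have : cutoff =ᶠ[𝓝 q] fun _ => 1 := by
    filter_upwards [Iio_mem_nhds h] with x hx using cutoff_eq_one (le_of_lt hx)
  rw [this.deriv_eq, deriv_const]

theorem continuous_deriv_cutoff : Continuous (deriv cutoff) :=
  contDiff_cutoff.continuous_deriv (by simp)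

theorem deriv_cutoff_eq_zero_of_le {q : ℝ} (h : 1 ≤ q) : deriv cutoff q = 0 := by
  have h1 : ∀ x ∈ Ioi (1 : ℝ), deriv cutoff x = 0 := fun x hx => by
    have : cutoff =ᶠ[𝓝 x] fun _ => 0 := by
      filter_upwards [Ioi_mem_nhds hx] with y hy using cutoff_eq_zero (le_of_lt hy)
    rw [this.deriv_eq, deriv_const]
  have h2 : closure (Ioi (1 : ℝ)) ⊆ {x | deriv cutoff x = 0} :=
    closure_minimal h1 (isClosed_eq continuous_deriv_cutoff continuous_const)
  rw [closure_Ioi] at h2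
  exact h2 h

theorem exists_deriv_cutoff_bound : ∃ M : ℝ, 0 ≤ M ∧ ∀ q, |deriv cutoff q| ≤ M := by
  obtain ⟨M, hM⟩ := (isCompact_Icc (a := (0 : ℝ)) (b := 1)).exists_bound_of_continuousOn
    continuous_deriv_cutoff.continuousOn
  have hM0 : 0 ≤ M := (norm_nonneg _).trans (hM 0 (by simp))
  refine ⟨M, hM0, fun q => ?_⟩
  by_cases h0 : q < 1 / 2
  · simpa [deriv_cutoff_eq_zero_of_lt h0]
  by_cases h1 : 1 ≤ q
  · simpa [deriv_cutoff_eq_zero_of_le h1]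
  · exact hM q ⟨by linarith, by linarith⟩

/-- The radial profile of the kernel, as a function of `q = |x|²`. -/
noncomputable def profile (r s q : ℝ) : ℝ := (√(q + r ^ 2))⁻¹ * cutoff (q / s ^ 2)

/-- The derivative of `profile`. -/
noncomputable def profileDeriv (r s q : ℝ) : ℝ :=
  -(1 / 2) * (√(q + r ^ 2))⁻¹ ^ 3 * cutoff (q / s ^ 2)
    + (√(q + r ^ 2))⁻¹ * (deriv cutoff (q / s ^ 2) / s ^ 2)

theorem hasDerivAt_profile {r s q : ℝ} (hr : 0 < r) (hq : 0 ≤ q) :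
    HasDerivAt (profile r s) (profileDeriv r s q) q := by
  have hpos : 0 < q + r ^ 2 := by positivity
  have hs : 0 < √(q + r ^ 2) := Real.sqrt_pos.2 hpos
  have h1 : HasDerivAt (fun q => √(q + r ^ 2)) (1 / (2 * √(q + r ^ 2))) q := by
    simpa using ((hasDerivAt_id q).add_const (r ^ 2)).sqrt hpos.ne'
  have h2 := h1.inv hs.ne'
  have h3 : HasDerivAt (fun q => cutoff (q / s ^ 2)) (deriv cutoff (q / s ^ 2) * (1 / s ^ 2)) q :=
    ((contDiff_cutoff.differentiable (by simp) _).hasDerivAt).comp q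
      ((hasDerivAt_id q).div_const _)
  refine (h2.mul h3).congr_deriv ?_
  simp only [profileDeriv, Pi.inv_apply]
  field_simp

/-- The `i`-th component of the kernel `x ↦ x φ(|x|²)`. -/
noncomputable def kern (r s : ℝ) (i : Fin 3) (x : E3) : ℝ := x i * profile r s (‖x‖ ^ 2)

theorem contDiff_kern {r : ℝ} (hr : 0 < r) (s : ℝ) (i : Fin 3) : ContDiff ℝ ∞ (kern r s i) := by
  have h0 : ContDiff ℝ ∞ fun x : E3 => ‖x‖ ^ 2 := contDiff_norm_sq ℝ
  have h1 : ContDiff ℝ ∞ fun x : E3 => √(‖x‖ ^ 2 + r ^ 2) :=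
    (h0.add contDiff_const).sqrt fun x => by positivity
  have h2 : ContDiff ℝ ∞ fun x : E3 => (√(‖x‖ ^ 2 + r ^ 2))⁻¹ := h1.inv fun x => by positivity
  have h3 : ContDiff ℝ ∞ fun x : E3 => cutoff (‖x‖ ^ 2 / s ^ 2) :=
    contDiff_cutoff.comp (h0.div_const _)
  have h4 : ContDiff ℝ ∞ fun x : E3 => x i := by fun_prop
  exact h4.mul (h2.mul h3)

theorem kern_eq_zero {r s : ℝ} (hs : 0 < s) {i : Fin 3} {x : E3} (hx : s ≤ ‖x‖) :
    kern r s i x = 0 := by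
  have : 1 ≤ ‖x‖ ^ 2 / s ^ 2 := by
    rw [le_div_iff₀ (by positivity)]
    nlinarith
  simp [kern, profile, cutoff_eq_zero this]

theorem hasCompactSupport_kern (r : ℝ) {s : ℝ} (hs : 0 < s) (i : Fin 3) :
    HasCompactSupport (kern r s i) := by
  refine HasCompactSupport.intro (isCompact_closedBall (0 : E3) s) fun x hx => ?_
  refine kern_eq_zero hs ?_
  simp only [Metric.mem_closedBall, dist_zero_right, not_le] at hx
  exact hx.le

theorem partialDeriv_kern {r : ℝ} (hr : 0 < r) (s : ℝ) (i j : Fin 3) (x : E3) :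
    partialDeriv j (kern r s i) x =
      (if i = j then profile r s (‖x‖ ^ 2) else 0)
        + 2 * profileDeriv r s (‖x‖ ^ 2) * (x i * x j) := by
  have h1 : HasFDerivAt (fun x : E3 => profile r s (‖x‖ ^ 2)) _ x :=
    (hasDerivAt_profile (s := s) hr (by positivity)).comp_hasFDerivAt x
      (hasStrictFDerivAt_norm_sq x).hasFDerivAt
  have h2 : HasFDerivAt (fun x : E3 => x i) (EuclideanSpace.proj i : E3 →L[ℝ] ℝ) x :=
    (EuclideanSpace.proj i : E3 →L[ℝ] ℝ).hasFDerivAt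
  have h3 : HasFDerivAt (kern r s i) _ x := h2.mul h1
  rw [partialDeriv, h3.fderiv]
  by_cases hij : i = j <;>
  simp [unitVec, EuclideanSpace.inner_single_right, hij] <;> ring

theorem norm_kern_le {r : ℝ} (hr : 0 < r) (s : ℝ) (i : Fin 3) (x : E3) : |kern r s i x| ≤ 1 := by
  have hR : 0 < √(‖x‖ ^ 2 + r ^ 2) := by positivity
  have h1 : |x i| ≤ √(‖x‖ ^ 2 + r ^ 2) := by
    refine (PiLp.norm_apply_le x i : |x i| ≤ ‖x‖).trans ?_
    refine Real.le_sqrt_of_sq_le ?_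
    nlinarith [sq_nonneg r]
  rw [kern, profile, abs_mul, abs_mul, abs_of_nonneg (cutoff_nonneg _), abs_of_pos (inv_pos.2 hR)]
  calc |x i| * ((√(‖x‖ ^ 2 + r ^ 2))⁻¹ * cutoff (‖x‖ ^ 2 / s ^ 2))
      ≤ √(‖x‖ ^ 2 + r ^ 2) * ((√(‖x‖ ^ 2 + r ^ 2))⁻¹ * 1) := by
        gcongr
        · exact mul_nonneg (by positivity) (cutoff_nonneg _)
        · exact cutoff_le_one _
    _ = 1 := by field_simp

theorem projPar_norm_sq_mul (x w : E3) : ‖x‖ ^ 2 * ‖projPar x w‖ ^ 2 = inner ℝ x w ^ 2 := by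
  by_cases hx : x = 0
  · simp [hx]
  have : ‖x‖ ≠ 0 := by simpa using hx
  rw [projPar, norm_smul, mul_pow, Real.norm_eq_abs, sq_abs]
  field_simp

theorem projPerp_norm_sq (x w : E3) : ‖projPerp x w‖ ^ 2 = ‖w‖ ^ 2 - ‖projPar x w‖ ^ 2 := by
  have h : inner ℝ w (projPar x w) = ‖projPar x w‖ ^ 2 := by
    by_cases hx : x = 0
    · simp [hx, projPar]
    have hx' : ‖x‖ ≠ 0 := by simpa using hx
    rw [← mul_right_inj' (pow_ne_zero 2 hx'), projPar_norm_sq_mul, projPar, inner_smul_right,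
      real_inner_comm]
    field_simp
  rw [projPerp, norm_sub_sq_real, h]
  ring

/-- The coefficient of the longitudinal part of the gradient of the kernel. -/
noncomputable def longCoeff (r s q : ℝ) : ℝ := profile r s q + 2 * q * profileDeriv r s q

/-- The gradient of x φ(|x|²) is φ I + 2φ' x⊗x. It therefore acts as φ on the plane orthogonal to x
and as φ + 2|x|²φ' on the line through x. -/
theorem sum_partialDeriv_kern_mul {r : ℝ} (hr : 0 < r) (s : ℝ) (x w : E3) :
    ∑ i, ∑ j, w i * w j * partialDeriv j (kern r s i) x =
      profile r s (‖x‖ ^ 2) * ‖projPerp x w‖ ^ 2 + longCoeff r s (‖x‖ ^ 2) * ‖projPar x w‖ ^ 2 := by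
  have h1 := projPar_norm_sq_mul x w
  have h2 : inner ℝ x w = ∑ i, x i * w i := by
    simp [PiLp.inner_apply, mul_comm]
  have h3 : ‖w‖ ^ 2 = ∑ i, w i ^ 2 := by
    rw [EuclideanSpace.norm_sq_eq]; simp
  have h4 : profile r s (‖x‖ ^ 2) * ‖projPerp x w‖ ^ 2 + longCoeff r s (‖x‖ ^ 2) * ‖projPar x w‖ ^ 2
      = profile r s (‖x‖ ^ 2) * ‖w‖ ^ 2 + 2 * profileDeriv r s (‖x‖ ^ 2) * (inner ℝ x w) ^ 2 := by
    rw [projPerp_norm_sq, longCoeff, ← h1]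
    ring
  rw [h4, h2, h3]
  simp only [partialDeriv_kern hr, Fin.sum_univ_three]
  simp
  ring

/-- The trace counts two transverse eigenvalues and one longitudinal one. This is the origin of the
weights 2 and 1 of the pressure in E^⊥ and E^∥. -/
theorem sum_partialDeriv_kern {r : ℝ} (hr : 0 < r) (s : ℝ) (x : E3) :
    ∑ i, partialDeriv i (kern r s i) x =
      2 * profile r s (‖x‖ ^ 2) + longCoeff r s (‖x‖ ^ 2) := by
  have h3 : ‖x‖ ^ 2 = ∑ i, x i ^ 2 := by
    rw [EuclideanSpace.norm_sq_eq]; simp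
  have h4 : ∑ i, partialDeriv i (kern r s i) x = 3 * profile r s (‖x‖ ^ 2) +
      2 * (∑ i, x i ^ 2) * profileDeriv r s (‖x‖ ^ 2) := by
    simp only [partialDeriv_kern hr, Fin.sum_univ_three]
    simp
    ring
  rw [h4, ← h3, longCoeff]
  ring

theorem partialDeriv_kern_neg {r : ℝ} (hr : 0 < r) (s : ℝ) (i j : Fin 3) (x : E3) :
    partialDeriv j (kern r s i) (-x) = partialDeriv j (kern r s i) x := by
  simp [partialDeriv_kern hr]

theorem profile_nonneg (r s q : ℝ) : 0 ≤ profile r s q :=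
  mul_nonneg (by positivity) (cutoff_nonneg _)

theorem profile_eq {r s : ℝ} (hs : 0 < s) {x : E3} (hx : ‖x‖ ≤ s / 2) :
    profile r s (‖x‖ ^ 2) = (√(‖x‖ ^ 2 + r ^ 2))⁻¹ := by
  rw [profile, cutoff_eq_one, mul_one]
  rw [div_le_iff₀ (by positivity)]
  nlinarith [norm_nonneg x]

/-- In φ + 2qφ' the singular parts cancel down to r²(q + r²)^{-3/2} ≥ 0. Only the derivative of the
cutoff can make the coefficient negative. -/
theorem longCoeff_eq {r s q : ℝ} (hr : 0 < r) (hq : 0 ≤ q) :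
    longCoeff r s q = (√(q + r ^ 2))⁻¹ ^ 3 * r ^ 2 * cutoff (q / s ^ 2)
      + (√(q + r ^ 2))⁻¹ * (2 * q / s ^ 2) * deriv cutoff (q / s ^ 2) := by
  have hpos : 0 < q + r ^ 2 := by positivity
  have h1 : (√(q + r ^ 2))⁻¹ = (√(q + r ^ 2))⁻¹ ^ 3 * (q + r ^ 2) := by
    have : 0 < √(q + r ^ 2) := Real.sqrt_pos.2 hpos
    field_simp
    rw [Real.sq_sqrt hpos.le]
  rw [longCoeff, profile, profileDeriv]
  linear_combination cutoff (q / s ^ 2) * h1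

theorem inv_sqrt_le (r : ℝ) (x : E3) (hx : x ≠ 0) :
    (√(‖x‖ ^ 2 + r ^ 2))⁻¹ ≤ ‖x‖⁻¹ := by
  have : 0 < ‖x‖ := norm_pos_iff.2 hx
  gcongr
  refine Real.le_sqrt_of_sq_le ?_
  nlinarith [sq_nonneg r]

/-- The derivative of the cutoff vanishes for |x| ≥ s, and below that |x|^{-1} · 2|x|²/s² ≤ 2/s. The
bound does not depend on r, so the loss is a multiple of Γ(s). -/
theorem longCoeff_ge {M : ℝ} (hM : ∀ q, |deriv cutoff q| ≤ M) {r s : ℝ} (hr : 0 < r)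
    (hs : 0 < s) (x : E3) :
    -(2 * M / s) ≤ longCoeff r s (‖x‖ ^ 2) := by
  have hM0 : 0 ≤ M := (abs_nonneg _).trans (hM 0)
  rw [longCoeff_eq hr (by positivity)]
  have h1 : 0 ≤ (√(‖x‖ ^ 2 + r ^ 2))⁻¹ ^ 3 * r ^ 2 * cutoff (‖x‖ ^ 2 / s ^ 2) :=
    mul_nonneg (by positivity) (cutoff_nonneg _)
  have h2 : |(√(‖x‖ ^ 2 + r ^ 2))⁻¹ * (2 * ‖x‖ ^ 2 / s ^ 2) * deriv cutoff (‖x‖ ^ 2 / s ^ 2)|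
      ≤ 2 * M / s := by
    by_cases hx : s ≤ ‖x‖
    · rw [deriv_cutoff_eq_zero_of_le]
      · simp; positivity
      · rw [le_div_iff₀ (by positivity)]; nlinarith
    push Not at hx
    by_cases hx0 : x = 0
    · simp [hx0]; positivity
    have hxp : 0 < ‖x‖ := norm_pos_iff.2 hx0
    rw [abs_mul, abs_of_nonneg (by positivity)]
    calc _ ≤ ‖x‖⁻¹ * (2 * ‖x‖ ^ 2 / s ^ 2) * M := by
          refine mul_le_mul (mul_le_mul_of_nonneg_right (inv_sqrt_le r x hx0) (by positivity))
            (hM _) (abs_nonneg _) (by positivity)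
      _ = 2 * M / s * (‖x‖ / s) := by field_simp
      _ ≤ 2 * M / s * 1 := by
          gcongr
          rw [div_le_one hs]
          exact hx.le
      _ = _ := mul_one _
  linarith [(abs_le.1 h2).1]

theorem longCoeff_ge_inner {r s : ℝ} (hr : 0 < r) (hrs : r ≤ s / 2) {x : E3} (hx : ‖x‖ < r) :
    1 / (3 * r) ≤ longCoeff r s (‖x‖ ^ 2) := by
  have hs : 0 < s := by linarith
  have h1 : ‖x‖ ^ 2 / s ^ 2 < 1 / 2 := by
    rw [div_lt_iff₀ (by positivity)]
    nlinarith [norm_nonneg x]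
  rw [longCoeff_eq hr (by positivity), deriv_cutoff_eq_zero_of_lt h1, cutoff_eq_one h1.le]
  have h2 : √(‖x‖ ^ 2 + r ^ 2) ^ 3 ≤ 3 * r ^ 3 := by
    -- For |x| < r the root is at most √2 r. The number 1.44 exceeds √2 and its cube is still below
    -- 3.
    have h3 : √(‖x‖ ^ 2 + r ^ 2) ≤ 1.44 * r := by
      rw [Real.sqrt_le_left (by positivity)]
      nlinarith [norm_nonneg x]
    calc _ ≤ (1.44 * r) ^ 3 := by gcongr
      _ ≤ _ := by
        rw [mul_pow]
        gcongr
        norm_num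
  have hR : 0 < √(‖x‖ ^ 2 + r ^ 2) := by positivity
  rw [mul_one, mul_zero, add_zero, inv_pow, inv_mul_eq_div, div_le_div_iff₀ (by positivity)
    (by positivity)]
  calc 1 * √(‖x‖ ^ 2 + r ^ 2) ^ 3 ≤ 3 * r ^ 3 := by linarith
    _ = _ := by ring

theorem longCoeff_eq_zero {r s : ℝ} (hr : 0 < r) (hs : 0 < s) {x : E3} (hx : s ≤ ‖x‖) :
    longCoeff r s (‖x‖ ^ 2) = 0 := by
  have h : 1 ≤ ‖x‖ ^ 2 / s ^ 2 := by
    rw [le_div_iff₀ (by positivity)]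
    nlinarith
  rw [longCoeff_eq hr (by positivity), cutoff_eq_zero h, deriv_cutoff_eq_zero_of_le h]
  simp

/-- The bound is uniform in r and s. The lower order terms can then be estimated independently of
the regularization. -/
theorem norm_partialDeriv_kern_le {M : ℝ} (hM : ∀ q, |deriv cutoff q| ≤ M) {r s : ℝ} (hr : 0 < r)
    (hs : 0 < s) (i j : Fin 3) {x : E3} (hx : x ≠ 0) :
    |partialDeriv j (kern r s i) x| ≤ (2 + 2 * M) / ‖x‖ := by
  have hM0 : 0 ≤ M := (abs_nonneg _).trans (hM 0)
  have hxp : 0 < ‖x‖ := norm_pos_iff.2 hx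
  have hR := inv_sqrt_le r x hx
  have hi : ∀ i, |x i| ≤ ‖x‖ := fun i => PiLp.norm_apply_le x i
  have h1 : |if i = j then profile r s (‖x‖ ^ 2) else 0| ≤ 1 / ‖x‖ := by
    split_ifs
    · rw [abs_of_nonneg (profile_nonneg _ _ _), profile, one_div]
      calc _ ≤ ‖x‖⁻¹ * 1 := by
            gcongr
            · exact cutoff_nonneg _
            · exact cutoff_le_one _
        _ = _ := mul_one _
    · simp
  have hq : ‖x‖ ^ 2 / s ^ 2 * |deriv cutoff (‖x‖ ^ 2 / s ^ 2)| ≤ M := by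
    by_cases h : 1 ≤ ‖x‖ ^ 2 / s ^ 2
    · simpa [deriv_cutoff_eq_zero_of_le h]
    · push Not at h
      calc _ ≤ 1 * M := by
            gcongr
            exact hM _
        _ = M := one_mul _
  have h2 : |2 * profileDeriv r s (‖x‖ ^ 2) * (x i * x j)| ≤ (1 + 2 * M) / ‖x‖ := by
    have h3 : |profileDeriv r s (‖x‖ ^ 2)| ≤ (1 / 2) * ‖x‖⁻¹ ^ 3 * 1
        + ‖x‖⁻¹ * (|deriv cutoff (‖x‖ ^ 2 / s ^ 2)| / s ^ 2) := by
      rw [profileDeriv]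
      refine (abs_add_le _ _).trans (add_le_add ?_ ?_)
      · rw [abs_mul, abs_mul, abs_of_nonneg (cutoff_nonneg _), abs_neg,
          abs_of_nonneg (by norm_num : (0 : ℝ) ≤ 1 / 2), abs_of_nonneg (by positivity)]
        gcongr
        · exact cutoff_nonneg _
        · exact cutoff_le_one _
      · rw [abs_mul, abs_div, abs_of_nonneg (by positivity : (0 : ℝ) ≤ s ^ 2),
          abs_of_nonneg (by positivity)]
        gcongr
    rw [abs_mul, abs_mul, abs_mul, abs_of_nonneg (by norm_num : (0 : ℝ) ≤ 2)]
    calc _ ≤ 2 * ((1 / 2) * ‖x‖⁻¹ ^ 3 * 1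
        + ‖x‖⁻¹ * (|deriv cutoff (‖x‖ ^ 2 / s ^ 2)| / s ^ 2)) * (‖x‖ * ‖x‖) := by
          gcongr
          · exact hi i
          · exact hi j
      _ = (1 + 2 * (‖x‖ ^ 2 / s ^ 2 * |deriv cutoff (‖x‖ ^ 2 / s ^ 2)|)) / ‖x‖ := by
          field_simp
      _ ≤ _ := by gcongr
  rw [partialDeriv_kern hr]
  refine (abs_add_le _ _).trans ?_
  calc _ ≤ 1 / ‖x‖ + (1 + 2 * M) / ‖x‖ := add_le_add h1 h2
    _ = _ := by ring

theorem partialDeriv_kern_eq_zero {r s : ℝ} (hr : 0 < r) (hs : 0 < s) (i j : Fin 3) {x : E3}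
    (hx : s ≤ ‖x‖) : partialDeriv j (kern r s i) x = 0 := by
  have h : 1 ≤ ‖x‖ ^ 2 / s ^ 2 := by
    rw [le_div_iff₀ (by positivity)]
    nlinarith
  simp [partialDeriv_kern hr, profile, profileDeriv, cutoff_eq_zero h, deriv_cutoff_eq_zero_of_le h]

/-! ### An averaged Sobolev inequality on balls -/

theorem measurable_lintegral_ball {P : Type*} [MeasurableSpace P] {c : P → E3} (hc : Measurable c)
    {F : P → E3 → ℝ≥0∞} (hF : Measurable (Function.uncurry F)) (R : ℝ) :
    Measurable fun p => ∫⁻ x in Metric.ball (c p) R, F p x := by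
  have : ∀ p, ∫⁻ x in Metric.ball (c p) R, F p x =
      ∫⁻ x, {q : P × E3 | dist q.2 (c q.1) < R}.indicator (Function.uncurry F) (p, x) := by
    intro p
    rw [← lintegral_indicator measurableSet_ball]
    rfl
  simp only [this]
  refine Measurable.lintegral_prod_right' (f := {q : P × E3 | dist q.2 (c q.1) < R}.indicator
    (Function.uncurry F)) (hF.indicator ?_)
  exact measurableSet_lt (by fun_prop) measurable_const

theorem lintegral_ball_swap {F : E3 → E3 → ℝ≥0∞} (hF : Measurable (Function.uncurry F)) (R : ℝ) :
    ∫⁻ z, ∫⁻ x in Metric.ball z R, F z x = ∫⁻ x, ∫⁻ z in Metric.ball x R, F z x := by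
  have h1 : ∀ z, ∫⁻ x in Metric.ball z R, F z x =
      ∫⁻ x, {q : E3 × E3 | dist q.2 q.1 < R}.indicator (Function.uncurry F) (z, x) := by
    intro p
    rw [← lintegral_indicator measurableSet_ball]
    rfl
  have h2 : ∀ x, ∫⁻ z in Metric.ball x R, F z x =
      ∫⁻ z, {q : E3 × E3 | dist q.2 q.1 < R}.indicator (Function.uncurry F) (z, x) := by
    intro x
    rw [← lintegral_indicator measurableSet_ball]
    congr 1
    ext z
    simp only [indicator, Metric.mem_ball, mem_ofPred_eq, dist_comm, Function.uncurry]
  simp only [h1, h2]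
  refine lintegral_lintegral_swap (Measurable.aemeasurable ?_)
  exact hF.indicator (measurableSet_lt (by fun_prop) measurable_const)

theorem volume_ball_eq (x : E3) {R : ℝ} (hR : 0 ≤ R) :
    volume (Metric.ball x R) = ENNReal.ofReal R ^ 3 * volume (Metric.ball (0 : E3) 1) := by
  rw [Measure.addHaar_ball _ _ hR]
  simp [ENNReal.ofReal_pow hR]

theorem lintegral_mul_sq_le {α : Type*} [MeasurableSpace α] {μ : Measure α} {f g : α → ℝ≥0∞}
    (hf : AEMeasurable f μ) (hg : AEMeasurable g μ) :
    (∫⁻ a, f a * g a ∂μ) ^ 2 ≤ (∫⁻ a, f a ^ 2 ∂μ) * ∫⁻ a, g a ^ 2 ∂μ := by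
  have h := ENNReal.lintegral_mul_norm_pow_le (hf.pow_const 2) (hg.pow_const 2)
    (p := 1 / 2) (q := 1 / 2) (by norm_num) (by norm_num) (by norm_num)
  have e : ∀ a : ℝ≥0∞, (a ^ 2) ^ (1 / 2 : ℝ) = a := fun a => by
    rw [← ENNReal.rpow_natCast, ← ENNReal.rpow_mul]
    norm_num
  have e' : ∀ a : ℝ≥0∞, (a ^ (1 / 2 : ℝ)) ^ 2 = a := fun a => by
    rw [← ENNReal.rpow_natCast, ← ENNReal.rpow_mul]
    norm_num
  simp only [e] at h
  calc _ ≤ _ := pow_le_pow_left' h 2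
    _ = _ := by rw [mul_pow, e', e']

/-- The increment is the integral of the derivative along the segment. Cauchy-Schwarz on the
segment, Tonelli and translation invariance conclude. -/
theorem lintegral_translate_sq_le {f : E3 → ℝ} (hf : ContDiff ℝ ∞ f) (h : E3) :
    ∫⁻ x, ‖f (x + h) - f x‖ₑ ^ 2 ≤ ‖h‖ₑ ^ 2 * ∫⁻ x, ‖fderiv ℝ f x‖ₑ ^ 2 := by
  have hc : Continuous (fderiv ℝ f) := hf.continuous_fderiv (by simp)
  have hpt : ∀ x, ‖f (x + h) - f x‖ₑ ^ 2 ≤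
      ‖h‖ₑ ^ 2 * ∫⁻ τ in Ioc (0 : ℝ) 1, ‖fderiv ℝ f (x + τ • h)‖ₑ ^ 2 := by
    intro x
    have hd : ∀ τ ∈ uIcc (0 : ℝ) 1, HasDerivAt (fun τ : ℝ => f (x + τ • h))
        (fderiv ℝ f (x + τ • h) h) τ := by
      intro τ _
      have h1 : HasDerivAt (fun τ : ℝ => x + τ • h) h τ := by
        simpa using ((hasDerivAt_id τ).smul_const h).const_add x
      exact (hf.differentiable (by simp) _).hasFDerivAt.comp_hasDerivAt τ h1
    have hint := intervalIntegral.integral_eq_sub_of_hasDerivAt hd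
      ((by fun_prop : Continuous fun τ : ℝ => fderiv ℝ f (x + τ • h) h).intervalIntegrable _ _)
    simp only [one_smul, zero_smul, add_zero] at hint
    rw [← hint, intervalIntegral.integral_of_le zero_le_one]
    calc _ ≤ (∫⁻ τ in Ioc (0 : ℝ) 1, ‖fderiv ℝ f (x + τ • h)‖ₑ * ‖h‖ₑ) ^ 2 := by
          gcongr
          refine (enorm_integral_le_lintegral_enorm _).trans (lintegral_mono fun τ => ?_)
          exact ContinuousLinearMap.le_opENorm _ _
      _ ≤ (∫⁻ τ in Ioc (0 : ℝ) 1, ‖fderiv ℝ f (x + τ • h)‖ₑ ^ 2) *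
          ∫⁻ τ in Ioc (0 : ℝ) 1, ‖h‖ₑ ^ 2 :=
          lintegral_mul_sq_le (Continuous.aemeasurable (by fun_prop)) aemeasurable_const
      _ = _ := by simp [mul_comm]
  calc _ ≤ ∫⁻ x, ‖h‖ₑ ^ 2 * ∫⁻ τ in Ioc (0 : ℝ) 1, ‖fderiv ℝ f (x + τ • h)‖ₑ ^ 2 :=
        lintegral_mono hpt
    _ = ‖h‖ₑ ^ 2 * ∫⁻ x, ∫⁻ τ in Ioc (0 : ℝ) 1, ‖fderiv ℝ f (x + τ • h)‖ₑ ^ 2 :=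
        lintegral_const_mul' _ _ (by simp)
    _ = ‖h‖ₑ ^ 2 * ∫⁻ τ in Ioc (0 : ℝ) 1, ∫⁻ x, ‖fderiv ℝ f (x + τ • h)‖ₑ ^ 2 := by
        rw [lintegral_lintegral_swap]
        exact Continuous.aemeasurable (by fun_prop)
    _ = _ := by
        have : ∀ τ : ℝ, ∫⁻ x, ‖fderiv ℝ f (x + τ • h)‖ₑ ^ 2 = ∫⁻ x, ‖fderiv ℝ f x‖ₑ ^ 2 :=
          fun τ => lintegral_add_right_eq_self (fun x => ‖fderiv ℝ f x‖ₑ ^ 2) (τ • h)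
        simp [this]

theorem enorm_add_sq_le {E : Type*} [NormedAddCommGroup E] (a b : E) :
    ‖a + b‖ₑ ^ 2 ≤ 2 * (‖a‖ₑ ^ 2 + ‖b‖ₑ ^ 2) := by
  have h : ‖a + b‖₊ ^ 2 ≤ 2 * (‖a‖₊ ^ 2 + ‖b‖₊ ^ 2) := by
    rw [← NNReal.coe_le_coe]
    push_cast
    nlinarith [norm_add_le a b, norm_nonneg a, norm_nonneg b, norm_nonneg (a + b),
      sq_nonneg (‖a‖ - ‖b‖)]
  simp only [enorm]
  exact_mod_cast h

theorem lintegral_ball_diff_sq_le {f : E3 → ℝ} (hf : ContDiff ℝ ∞ f) {R : ℝ} (hR : 0 ≤ R) :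
    ∫⁻ z, ∫⁻ x in Metric.ball z R, ‖f x - f z‖ₑ ^ 2 ≤
      ENNReal.ofReal R ^ 2 * (ENNReal.ofReal R ^ 3 * volume (Metric.ball (0 : E3) 1)) *
        ∫⁻ x, ‖fderiv ℝ f x‖ₑ ^ 2 := by
  have hc := hf.continuous
  have h1 : ∀ z, ∫⁻ x in Metric.ball z R, ‖f x - f z‖ₑ ^ 2 =
      ∫⁻ h in Metric.ball (0 : E3) R, ‖f (z + h) - f z‖ₑ ^ 2 := by
    intro z
    rw [← lintegral_indicator measurableSet_ball, ← lintegral_indicator measurableSet_ball,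
      ← lintegral_add_left_eq_self _ z]
    congr 1
    ext h
    simp [indicator, Metric.mem_ball]
  simp only [h1]
  rw [lintegral_lintegral_swap (Continuous.aemeasurable (by fun_prop))]
  calc _ ≤ ∫⁻ h in Metric.ball (0 : E3) R,
        ENNReal.ofReal R ^ 2 * ∫⁻ x, ‖fderiv ℝ f x‖ₑ ^ 2 := by
        refine setLIntegral_mono measurable_const fun h hh => ?_
        refine (lintegral_translate_sq_le hf h).trans ?_
        gcongr
        rw [← ofReal_norm]
        exact ENNReal.ofReal_le_ofReal (by simpa using (mem_ball_zero_iff.1 hh).le)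
    _ = _ := by
        rw [lintegral_const, Measure.restrict_apply_univ, volume_ball_eq _ hR]
        ring

/-- The Sobolev inequality in `ℝ³`, in squared form. -/
theorem exists_sobolev_const : ∃ K : ℝ≥0, ∀ g : E3 → ℝ, ContDiff ℝ 1 g → HasCompactSupport g →
    (∫⁻ x, ‖g x‖ₑ ^ 6) ^ (1 / 3 : ℝ) ≤ K * ∫⁻ x, ‖fderiv ℝ g x‖ₑ ^ 2 := by
  refine ⟨eLpNormLESNormFDerivOfEqInnerConst (volume : Measure E3) (2 : ℝ≥0) ^ 2,
    fun g hg hgc => ?_⟩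
  have h := eLpNorm_le_eLpNorm_fderiv_of_eq_inner (volume : Measure E3) (u := g) hg hgc
    (p := 2) (p' := 6) (by norm_num) (by simp) (by simp; norm_num)
  have h6 := eLpNorm_nnreal_pow_eq_lintegral (μ := (volume : Measure E3)) (f := g) (p := 6)
    (by norm_num)
  have h2 := eLpNorm_nnreal_pow_eq_lintegral (μ := (volume : Measure E3)) (f := fderiv ℝ g)
    (p := 2) (by norm_num)
  have e6 : ∫⁻ x, ‖g x‖ₑ ^ 6 = eLpNorm g (6 : ℝ≥0) volume ^ (6 : ℝ) := by
    have h6' : eLpNorm g (6 : ℝ≥0) volume ^ (6 : ℝ) = ∫⁻ x, ‖g x‖ₑ ^ (6 : ℝ) := h6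
    rw [h6']
    congr 1
    ext x
    exact_mod_cast (ENNReal.rpow_natCast _ 6).symm
  have e2 : ∫⁻ x, ‖fderiv ℝ g x‖ₑ ^ 2 = eLpNorm (fderiv ℝ g) (2 : ℝ≥0) volume ^ 2 := by
    have h2' : eLpNorm (fderiv ℝ g) (2 : ℝ≥0) volume ^ (2 : ℝ) =
      ∫⁻ x, ‖fderiv ℝ g x‖ₑ ^ (2 : ℝ) := h2
    have e : ∀ a : ℝ≥0∞, a ^ (2 : ℝ) = a ^ 2 := fun a => by
      exact_mod_cast ENNReal.rpow_natCast a 2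
    simp only [e] at h2'
    rw [h2']
  rw [e6, e2, ← ENNReal.rpow_mul]
  have e : (6 : ℝ) * (1 / 3) = (2 : ℕ) := by norm_num
  rw [e, ENNReal.rpow_natCast, ENNReal.coe_pow, ← mul_pow]
  exact pow_le_pow_left' h 2

/-- The Sobolev inequality is applied to a cutoff at scale s around z times f - f(z). The derivative
of the cutoff leaves (M/s)²|f - f(z)|², which is harmless only after integration in z, where it
becomes a translation estimate. Averaging in z thus replaces a Poincaré inequality. -/
theorem exists_averaged_sobolev_smooth : ∃ C : ℝ≥0, ∀ f : E3 → ℝ, ContDiff ℝ ∞ f →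
    ∀ s : ℝ, 0 < s →
      ∫⁻ z, (∫⁻ x in Metric.ball z (2 * s), ‖f x - f z‖ₑ ^ 6) ^ (1 / 3 : ℝ) ≤
        C * ENNReal.ofReal s ^ 3 * ∫⁻ x, ‖fderiv ℝ f x‖ₑ ^ 2 := by
  obtain ⟨K, hK⟩ := exists_sobolev_const
  let χ : ContDiffBump (0 : E3) := ⟨2, 3, by norm_num, by norm_num⟩
  have hχd : ContDiff ℝ ∞ χ := χ.contDiff
  obtain ⟨M, hM⟩ := (χ.hasCompactSupport.fderiv ℝ).exists_bound_of_continuous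
    (hχd.continuous_fderiv (by simp))
  have hM0 : 0 ≤ M := (norm_nonneg _).trans (hM 0)
  set κ := volume (Metric.ball (0 : E3) 1) with hκ
  have hκt : κ ≠ ⊤ := measure_ball_lt_top.ne
  -- Balls of radius 4s contribute (4s)³κ to the gradient term and (M/s)²(4s)²(4s)³κ to the zeroth
  -- order term, whence 64 = 4³ and 1024 = 4⁵. The factor 2 comes from squaring a sum.
  refine ⟨K * (2 * (64 + M.toNNReal ^ 2 * 1024)) * κ.toNNReal, fun f hf s hs => ?_⟩
  set I := ∫⁻ x, ‖fderiv ℝ f x‖ₑ ^ 2 with hI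
  have hfc : Continuous (fderiv ℝ f) := hf.continuous_fderiv (by simp)
  have hpt : ∀ z, (∫⁻ x in Metric.ball z (2 * s), ‖f x - f z‖ₑ ^ 6) ^ (1 / 3 : ℝ) ≤
      K * (2 * ((∫⁻ x in Metric.ball z (4 * s), ‖fderiv ℝ f x‖ₑ ^ 2) +
        ENNReal.ofReal (M / s) ^ 2 * ∫⁻ x in Metric.ball z (4 * s), ‖f x - f z‖ₑ ^ 2)) := by
    intro z
    let g : E3 → ℝ := fun x => χ (s⁻¹ • (x - z)) * (f x - f z)
    have hη : ContDiff ℝ ∞ fun x => χ (s⁻¹ • (x - z)) := hχd.comp (by fun_prop)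
    have hg : ContDiff ℝ ∞ g := hη.mul (hf.sub contDiff_const)
    have hsupp : ∀ x, 3 * s ≤ dist x z → χ (s⁻¹ • (x - z)) = 0 := fun x hx => by
      refine χ.zero_of_le_dist ?_
      rw [dist_zero_right, norm_smul, norm_inv, Real.norm_of_nonneg hs.le, ← dist_eq_norm,
        inv_mul_eq_div, le_div_iff₀ hs]
      exact hx
    have hgc : HasCompactSupport g := by
      refine HasCompactSupport.intro (isCompact_closedBall z (3 * s)) fun x hx => ?_
      simp only [Metric.mem_closedBall, not_le] at hx
      simp [g, hsupp x hx.le]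
    have hS := hK g (hg.of_le (by simp)) hgc
    have hlow : ∫⁻ x in Metric.ball z (2 * s), ‖f x - f z‖ₑ ^ 6 ≤ ∫⁻ x, ‖g x‖ₑ ^ 6 := by
      refine le_trans ?_ (setLIntegral_le_lintegral (Metric.ball z (2 * s)) _)
      refine setLIntegral_mono (Continuous.measurable (by fun_prop)) fun x hx => ?_
      have : χ (s⁻¹ • (x - z)) = 1 := by
        refine χ.one_of_mem_closedBall ?_
        rw [Metric.mem_closedBall, dist_zero_right, norm_smul, norm_inv,
          Real.norm_of_nonneg hs.le, ← dist_eq_norm, inv_mul_eq_div, div_le_iff₀ hs]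
        exact (Metric.mem_ball.1 hx).le
      simp [g, this]
    have hup : ∫⁻ x, ‖fderiv ℝ g x‖ₑ ^ 2 ≤
        ∫⁻ x in Metric.ball z (4 * s), 2 * (‖fderiv ℝ f x‖ₑ ^ 2 +
          ENNReal.ofReal (M / s) ^ 2 * ‖f x - f z‖ₑ ^ 2) := by
      rw [← lintegral_indicator measurableSet_ball]
      refine lintegral_mono fun x => ?_
      by_cases hx : x ∈ Metric.ball z (4 * s)
      · rw [indicator_of_mem hx]
        have hd : HasFDerivAt g _ x := ((hη.differentiable (by simp) x).hasFDerivAt).mul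
          ((hf.differentiable (by simp) x).hasFDerivAt.sub_const (f z))
        have hd' : HasFDerivAt (fun x => χ (s⁻¹ • (x - z)))
            ((fderiv ℝ χ (s⁻¹ • (x - z))).comp (s⁻¹ • ContinuousLinearMap.id ℝ E3)) x :=
          (hχd.differentiable (by simp) _).hasFDerivAt.comp x
            (((hasFDerivAt_id x).sub_const z).const_smul s⁻¹)
        rw [hd.fderiv]
        refine (enorm_add_sq_le _ _).trans ?_
        gcongr
        · rw [enorm_smul]
          refine mul_le_of_le_one_left (by positivity) ?_
          rw [← ofReal_norm, Real.norm_of_nonneg χ.nonneg]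
          exact ENNReal.ofReal_le_one.2 χ.le_one
        · rw [enorm_smul, mul_pow, mul_comm]
          gcongr
          rw [hd'.fderiv, ← ofReal_norm]
          refine ENNReal.ofReal_le_ofReal ?_
          refine (ContinuousLinearMap.opNorm_comp_le _ _).trans ?_
          rw [norm_smul, norm_inv, Real.norm_of_nonneg hs.le, div_eq_mul_inv]
          gcongr
          · exact hM _
          · exact mul_le_of_le_one_right (by positivity) ContinuousLinearMap.norm_id_le
      · have : fderiv ℝ g x = 0 := by
          have hz : g =ᶠ[𝓝 x] fun _ => 0 := by
            have ho : IsOpen {x | 3 * s < dist x z} := isOpen_lt continuous_const (by fun_prop)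
            filter_upwards [ho.mem_nhds (show 3 * s < dist x z by
              simp only [Metric.mem_ball, not_lt] at hx; linarith)] with y hy
            simp [g, hsupp y (le_of_lt hy)]
          rw [hz.fderiv_eq]
          simp
        rw [this, ← ofReal_norm, norm_zero]
        simp
    calc _ ≤ (∫⁻ x, ‖g x‖ₑ ^ 6) ^ (1 / 3 : ℝ) := by gcongr
      _ ≤ _ := hS
      _ ≤ _ := by
        gcongr
        refine hup.trans (le_of_eq ?_)
        have hc := hf.continuous
        rw [lintegral_const_mul' _ _ (by simp), lintegral_add_left (by fun_prop),
          lintegral_const_mul' _ _ (by simp)]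
  have hm1 : Measurable fun z => ∫⁻ x in Metric.ball z (4 * s), ‖fderiv ℝ f x‖ₑ ^ 2 :=
    measurable_lintegral_ball measurable_id (Continuous.measurable (by
      simp only [Function.uncurry_def]; fun_prop)) _
  calc _ ≤ ∫⁻ z, K * (2 * ((∫⁻ x in Metric.ball z (4 * s), ‖fderiv ℝ f x‖ₑ ^ 2) +
        ENNReal.ofReal (M / s) ^ 2 * ∫⁻ x in Metric.ball z (4 * s), ‖f x - f z‖ₑ ^ 2)) :=
        lintegral_mono hpt
    _ = K * (2 * ((∫⁻ z, ∫⁻ x in Metric.ball z (4 * s), ‖fderiv ℝ f x‖ₑ ^ 2) +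
        ENNReal.ofReal (M / s) ^ 2 * ∫⁻ z, ∫⁻ x in Metric.ball z (4 * s), ‖f x - f z‖ₑ ^ 2)) := by
        rw [lintegral_const_mul' _ _ (by simp), lintegral_const_mul' _ _ (by simp),
          lintegral_add_left hm1, lintegral_const_mul' _ _ (by simp)]
    _ ≤ K * (2 * (ENNReal.ofReal (4 * s) ^ 3 * κ * I + ENNReal.ofReal (M / s) ^ 2 *
        (ENNReal.ofReal (4 * s) ^ 2 * (ENNReal.ofReal (4 * s) ^ 3 * κ) * I))) := by
        gcongr
        · rw [lintegral_ball_swap (Continuous.measurable (by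
            simp only [Function.uncurry_def]; fun_prop))]
          simp only [lintegral_const, Measure.restrict_apply_univ]
          simp only [volume_ball_eq _ (by positivity : 0 ≤ 4 * s)]
          rw [lintegral_mul_const' _ _ (ENNReal.mul_ne_top (ENNReal.pow_ne_top ENNReal.ofReal_ne_top) hκt), mul_comm]
        · exact lintegral_ball_diff_sq_le hf (by positivity)
    _ = _ := by
        have h4 : ENNReal.ofReal (4 * s) = 4 * ENNReal.ofReal s := by
          rw [ENNReal.ofReal_mul (by norm_num), ENNReal.ofReal_ofNat]
        have hMs : ENNReal.ofReal (M / s) * ENNReal.ofReal s = M.toNNReal := by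
          rw [← ENNReal.ofReal_mul (by positivity), div_mul_cancel₀ _ hs.ne']; rfl
        have hκ' : ((κ.toNNReal : ℝ≥0) : ℝ≥0∞) = κ := ENNReal.coe_toNNReal hκt
        push_cast
        rw [h4, hκ', ← hMs]
        ring

/-- A sequence of bump functions in space that shrinks to a point. -/
noncomputable def spaceBump (n : ℕ) : ContDiffBump (0 : E3) where
  rIn := 1 / (n + 1)
  rOut := 2 * (1 / (n + 1))
  rIn_pos := by positivity
  rIn_lt_rOut := by
    have : (0 : ℝ) < 1 / (n + 1) := by positivity
    linarith

theorem tendsto_spaceBump : Tendsto (fun n => (spaceBump n).rOut) atTop (𝓝 0) := by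
  have := (tendsto_one_div_add_atTop_nhds_zero_nat (𝕜 := ℝ)).const_mul 2
  simpa [spaceBump] using this

/-- `g` is the weak gradient of the scalar function `w` on `ℝ³`. -/
structure IsWeakGrad (w : E3 → ℝ) (g : Fin 3 → E3 → ℝ) : Prop where
  fun_loc : LocallyIntegrable w
  grad_loc : ∀ j, LocallyIntegrable (g j)
  ibp : ∀ φ : E3 → ℝ, ContDiff ℝ ∞ φ → HasCompactSupport φ → ∀ j,
    ∫ x, w x * partialDeriv j φ x = -∫ x, g j x * φ x

/-- Convolution with a mollifier. -/
noncomputable def mollify (n : ℕ) (w : E3 → ℝ) : E3 → ℝ :=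
  convolution w ((spaceBump n).normed volume) (ContinuousLinearMap.mul ℝ ℝ) volume

theorem mollify_apply (n : ℕ) (w : E3 → ℝ) (x : E3) :
    mollify n w x = ∫ y, w y * (spaceBump n).normed volume (x - y) := rfl

theorem contDiff_mollify (n : ℕ) {w : E3 → ℝ} (hw : LocallyIntegrable w) :
    ContDiff ℝ ∞ (mollify n w) :=
  (spaceBump n).hasCompactSupport_normed.contDiff_convolution_right (n := ⊤) _ hw
    (spaceBump n).contDiff_normed

theorem ae_tendsto_mollify {w : E3 → ℝ} (hw : LocallyIntegrable w) :
    ∀ᵐ x, Tendsto (fun n => mollify n w x) atTop (𝓝 (w x)) := by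
  filter_upwards [ContDiffBump.ae_convolution_tendsto_right_of_locallyIntegrable
    tendsto_spaceBump (Eventually.of_forall fun n => (le_refl _ : (spaceBump n).rOut ≤
      2 * (spaceBump n).rIn)) hw] with x hx
  simpa [mollify_apply, convolution_eq_swap, mul_comm] using hx

/-- The weak gradient is tested with the reflected mollifier y ↦ φ(x - y). -/
theorem partialDeriv_mollify (n : ℕ) {w : E3 → ℝ} {g : Fin 3 → E3 → ℝ} (h : IsWeakGrad w g)
    (j : Fin 3) (x : E3) : partialDeriv j (mollify n w) x = mollify n (g j) x := by
  set φ := (spaceBump n).normed (volume : Measure E3) with hφ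
  have hφc : HasCompactSupport φ := (spaceBump n).hasCompactSupport_normed
  have hφd : ContDiff ℝ ∞ φ := (spaceBump n).contDiff_normed
  have h1 := hφc.hasFDerivAt_convolution_right (ContinuousLinearMap.mul ℝ ℝ) h.fun_loc
    (hφd.of_le (by simp)) x
  have hψd : ContDiff ℝ ∞ fun y => φ (x - y) := hφd.comp (contDiff_const.sub contDiff_id)
  have hψc : HasCompactSupport fun y => φ (x - y) := by
    have := hφc.comp_homeomorph (Homeomorph.subLeft x)
    exact this
  have h2 := h.ibp (fun y => φ (x - y)) hψd hψc j
  have h3 : ∀ y, partialDeriv j (fun y => φ (x - y)) y = -fderiv ℝ φ (x - y) (unitVec j) := by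
    intro y
    have hd : HasFDerivAt (fun y => φ (x - y)) _ y :=
      (hφd.differentiable (by simp) (x - y)).hasFDerivAt.comp y ((hasFDerivAt_id y).const_sub x)
    rw [partialDeriv, hd.fderiv]
    simp
  rw [partialDeriv, mollify, h1.fderiv, convolution_precompR_apply _ h.fun_loc
    (hφc.fderiv ℝ) (hφd.continuous_fderiv (by simp)), mollify_apply]
  simp only [h3, mul_neg, integral_neg, neg_inj] at h2
  exact h2

/-- The mollifier is a probability density. Splitting it into two square roots and applying
Cauchy-Schwarz gives Jensen's inequality pointwise, and Tonelli finishes. -/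
theorem lintegral_mollify_sq_le (n : ℕ) {g : E3 → ℝ} (hg : LocallyIntegrable g) :
    ∫⁻ x, ‖mollify n g x‖ₑ ^ 2 ≤ ∫⁻ x, ‖g x‖ₑ ^ 2 := by
  set φ := (spaceBump n).normed (volume : Measure E3) with hφ
  have hφm : Continuous φ := (spaceBump n).continuous_normed
  have hgm : AEMeasurable g := hg.aestronglyMeasurable.aemeasurable
  have hone : ∫⁻ y, ‖φ y‖ₑ = 1 := by
    have h := (spaceBump n).integral_normed (μ := (volume : Measure E3))
    have h2 := ofReal_integral_eq_lintegral_ofReal ((spaceBump n).integrable_normed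
      (μ := (volume : Measure E3))) (ae_of_all _ fun x => (spaceBump n).nonneg_normed x)
    rw [h, ENNReal.ofReal_one] at h2
    rw [h2]
    congr 1
    ext x
    exact Real.enorm_of_nonneg ((spaceBump n).nonneg_normed x)
  have hone' : ∀ x, ∫⁻ y, ‖φ (x - y)‖ₑ = 1 := fun x => by
    rw [lintegral_sub_left_eq_self (fun y => ‖φ y‖ₑ) x, hone]
  have hone'' : ∀ y, ∫⁻ x, ‖φ (x - y)‖ₑ = 1 := fun y => by
    rw [lintegral_sub_right_eq_self (fun x => ‖φ x‖ₑ) y, hone]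
  have e : ∀ a : ℝ≥0∞, (a ^ (1 / 2 : ℝ)) ^ 2 = a := fun a => by
    rw [← ENNReal.rpow_natCast, ← ENNReal.rpow_mul]
    norm_num
  have hpt : ∀ x, ‖mollify n g x‖ₑ ^ 2 ≤ ∫⁻ y, ‖g y‖ₑ ^ 2 * ‖φ (x - y)‖ₑ := by
    intro x
    calc ‖mollify n g x‖ₑ ^ 2 ≤ (∫⁻ y, (‖g y‖ₑ * ‖φ (x - y)‖ₑ ^ (1 / 2 : ℝ))
          * ‖φ (x - y)‖ₑ ^ (1 / 2 : ℝ)) ^ 2 := by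
          gcongr
          rw [mollify_apply]
          refine (enorm_integral_le_lintegral_enorm _).trans (le_of_eq ?_)
          congr 1
          ext y
          rw [enorm_mul, mul_assoc, ← sq, e]
      _ ≤ (∫⁻ y, (‖g y‖ₑ * ‖φ (x - y)‖ₑ ^ (1 / 2 : ℝ)) ^ 2) *
          ∫⁻ y, (‖φ (x - y)‖ₑ ^ (1 / 2 : ℝ)) ^ 2 :=
          lintegral_mul_sq_le (by fun_prop) (by fun_prop)
      _ = _ := by
          simp only [mul_pow, e, hone', mul_one]
  calc _ ≤ ∫⁻ x, ∫⁻ y, ‖g y‖ₑ ^ 2 * ‖φ (x - y)‖ₑ := lintegral_mono hpt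
    _ = ∫⁻ y, ∫⁻ x, ‖g y‖ₑ ^ 2 * ‖φ (x - y)‖ₑ := by
        refine lintegral_lintegral_swap ?_
        have h1 : AEMeasurable (fun p : E3 × E3 => g p.2) (volume.prod volume) :=
          hgm.comp_snd
        have h2 : AEMeasurable (fun p : E3 × E3 => ‖φ (p.1 - p.2)‖ₑ) (volume.prod volume) :=
          Continuous.aemeasurable (by fun_prop)
        exact (h1.enorm.pow_const 2).mul h2
    _ = _ := by
        congr 1
        ext y
        rw [lintegral_const_mul' _ _ (by simp), hone'', mul_one]

theorem enorm_fderiv_sq_le (f : E3 → ℝ) (x : E3) :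
    ‖fderiv ℝ f x‖ₑ ^ 2 ≤ 3 * ∑ j, ‖partialDeriv j f x‖ₑ ^ 2 := by
  have h : ‖fderiv ℝ f x‖ ≤ ∑ j, ‖partialDeriv j f x‖ := by
    refine ContinuousLinearMap.opNorm_le_bound _ (by positivity) fun v => ?_
    have hv : v = ∑ j, v j • unitVec j := by
      ext i
      simp [unitVec, Finset.sum_apply, Pi.single_apply]
    conv_lhs => rw [hv]
    rw [map_sum, Finset.sum_mul]
    refine norm_sum_le_of_le _ fun j _ => ?_
    rw [map_smul, norm_smul, mul_comm]
    gcongr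
    · exact le_rfl
    · exact PiLp.norm_apply_le v j
  have h2 : ‖fderiv ℝ f x‖₊ ^ 2 ≤ 3 * ∑ j, ‖partialDeriv j f x‖₊ ^ 2 := by
    rw [← NNReal.coe_le_coe]
    push_cast
    simp only [Fin.sum_univ_three] at h ⊢
    calc _ ≤ (‖partialDeriv 0 f x‖ + ‖partialDeriv 1 f x‖ + ‖partialDeriv 2 f x‖) ^ 2 := by
          gcongr
      _ ≤ _ := by
        nlinarith [sq_nonneg (‖partialDeriv 0 f x‖ - ‖partialDeriv 1 f x‖),
          sq_nonneg (‖partialDeriv 0 f x‖ - ‖partialDeriv 2 f x‖),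
          sq_nonneg (‖partialDeriv 1 f x‖ - ‖partialDeriv 2 f x‖)]
  simp only [enorm]
  exact_mod_cast h2

/-- Mollification reduces to the smooth case with a bound uniform in n. Fatou is used twice, for the
inner integral in x and for the outer one in z. The extra factor 3 comes from bounding the operator
norm of the derivative by the partial derivatives. -/
theorem exists_averaged_sobolev : ∃ C : ℝ≥0, ∀ (w : E3 → ℝ) (g : Fin 3 → E3 → ℝ),
    IsWeakGrad w g → ∀ s : ℝ, 0 < s →
      ∫⁻ z, (∫⁻ x in Metric.ball z (2 * s), ‖w x - w z‖ₑ ^ 6) ^ (1 / 3 : ℝ) ≤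
        C * ENNReal.ofReal s ^ 3 * ∑ j, ∫⁻ x, ‖g j x‖ₑ ^ 2 := by
  obtain ⟨C, hC⟩ := exists_averaged_sobolev_smooth
  refine ⟨C * 3, fun w g h s hs => ?_⟩
  have hsm := fun n => contDiff_mollify n h.fun_loc
  have hcont := fun n => (hsm n).continuous
  have hbound : ∀ n, ∫⁻ z, (∫⁻ x in Metric.ball z (2 * s),
      ‖mollify n w x - mollify n w z‖ₑ ^ 6) ^ (1 / 3 : ℝ) ≤
        C * 3 * ENNReal.ofReal s ^ 3 * ∑ j, ∫⁻ x, ‖g j x‖ₑ ^ 2 := by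
    intro n
    refine (hC _ (hsm n) s hs).trans ?_
    calc _ ≤ C * ENNReal.ofReal s ^ 3 * ∫⁻ x, 3 * ∑ j, ‖mollify n (g j) x‖ₑ ^ 2 := by
          gcongr with x
          refine (enorm_fderiv_sq_le _ _).trans (le_of_eq ?_)
          simp only [partialDeriv_mollify n h]
      _ = C * 3 * ENNReal.ofReal s ^ 3 * ∑ j, ∫⁻ x, ‖mollify n (g j) x‖ₑ ^ 2 := by
          rw [lintegral_const_mul' _ _ (by simp), lintegral_finsetSum]
          · ring
          · intro j _
            have := (contDiff_mollify n (h.grad_loc j)).continuous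
            exact Continuous.measurable (by fun_prop)
      _ ≤ _ := by
          exact mul_le_mul' le_rfl (Finset.sum_le_sum fun j _ =>
            lintegral_mollify_sq_le n (h.grad_loc j))
  have hmeas : ∀ n, Measurable fun z => (∫⁻ x in Metric.ball z (2 * s),
      ‖mollify n w x - mollify n w z‖ₑ ^ 6) ^ (1 / 3 : ℝ) := fun n => by
    have := hcont n
    refine Measurable.pow_const (measurable_lintegral_ball measurable_id
      (F := fun z x => ‖mollify n w x - mollify n w z‖ₑ ^ 6) (Continuous.measurable ?_) _) _
    simp only [Function.uncurry_def]
    fun_prop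
  have hlim := ae_tendsto_mollify h.fun_loc
  calc _ ≤ ∫⁻ z, liminf (fun n => (∫⁻ x in Metric.ball z (2 * s),
      ‖mollify n w x - mollify n w z‖ₑ ^ 6) ^ (1 / 3 : ℝ)) atTop := by
        refine lintegral_mono_ae ?_
        filter_upwards [hlim] with z hz
        have hin : ∫⁻ x in Metric.ball z (2 * s), ‖w x - w z‖ₑ ^ 6 ≤
            liminf (fun n => ∫⁻ x in Metric.ball z (2 * s),
              ‖mollify n w x - mollify n w z‖ₑ ^ 6) atTop := by
          refine le_trans (le_of_eq ?_) (lintegral_liminf_le fun n => Continuous.measurable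
            (by have := hcont n; fun_prop))
          refine lintegral_congr_ae ?_
          filter_upwards [ae_restrict_of_ae hlim] with x hx
          exact (((ENNReal.continuous_pow 6).tendsto _).comp (hx.sub hz).enorm).liminf_eq.symm
        refine (ENNReal.rpow_le_rpow hin (by norm_num)).trans (le_of_eq ?_)
        -- The cube root is monotone and continuous, so it commutes with the lower limit.
        exact (ENNReal.monotone_rpow_of_nonneg (by norm_num)).map_liminf_of_continuousAt _
          ENNReal.continuous_rpow_const.continuousAt
    _ ≤ liminf (fun n => ∫⁻ z, (∫⁻ x in Metric.ball z (2 * s),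
      ‖mollify n w x - mollify n w z‖ₑ ^ 6) ^ (1 / 3 : ℝ)) atTop := lintegral_liminf_le hmeas
    _ ≤ _ := by
        refine liminf_le_of_frequently_le' (Frequently.of_forall fun n => ?_)
        push_cast
        exact hbound n

/-! ### Velocity fluctuations of close pairs at a fixed time -/

/-- The mass of pairs at distance less than `ρ`, weighted by `p` and `R`. -/
noncomputable def pairMass (p R : E3 → ℝ≥0∞) (ρ : ℝ) : ℝ≥0∞ :=
  ∫⁻ x, p x * ∫⁻ y in Metric.ball x ρ, R y

/-- The velocity fluctuation of pairs at distance less than `s`. -/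
noncomputable def fluctuation (R : E3 → ℝ≥0∞) (w : E3 → ℝ) (s : ℝ) : ℝ≥0∞ :=
  ∫⁻ x, ∫⁻ y in Metric.ball x s, R x * R y * ‖w x - w y‖ₑ ^ 2

/-- Hölder with exponents 3/2 and 3. The density R enters through the pressure p, which dominates
R^{3/2}. -/
theorem lintegral_mul_le_three_halves {α : Type*} [MeasurableSpace α] {μ : Measure α}
    {R p f : α → ℝ≥0∞} (hR : Measurable R) (hRp : ∀ x, R x ^ (3 / 2 : ℝ) ≤ p x)
    (hf : Measurable f) :
    ∫⁻ x, R x * f x ∂μ ≤ (∫⁻ x, p x ∂μ) ^ (2 / 3 : ℝ) * (∫⁻ x, f x ^ 3 ∂μ) ^ (1 / 3 : ℝ) := by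
  have h := ENNReal.lintegral_mul_norm_pow_le (μ := μ) (hR.pow_const (3 / 2 : ℝ)).aemeasurable
    (hf.pow_const 3).aemeasurable (p := 2 / 3) (q := 1 / 3) (by norm_num) (by norm_num)
    (by norm_num)
  have e1 : ∀ a : ℝ≥0∞, (a ^ (3 / 2 : ℝ)) ^ (2 / 3 : ℝ) = a := fun a => by
    rw [← ENNReal.rpow_mul]; norm_num
  have e2 : ∀ a : ℝ≥0∞, (a ^ 3) ^ (1 / 3 : ℝ) = a := fun a => by
    rw [← ENNReal.rpow_natCast, ← ENNReal.rpow_mul]; norm_num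
  simp only [e1, e2] at h
  refine h.trans ?_
  gcongr with x
  exact hRp x

/-- Any two points of a ball of radius 2s are at distance less than 4s. -/
theorem mul_lintegral_ball_le_pairMass {R p : E3 → ℝ≥0∞} (hp : Measurable p) (s : ℝ) (z : E3) :
    (∫⁻ x in Metric.ball z (2 * s), p x) * (∫⁻ x in Metric.ball z (2 * s), R x) ≤
      pairMass p R (4 * s) := by
  calc _ = ∫⁻ x in Metric.ball z (2 * s), p x * ∫⁻ x in Metric.ball z (2 * s), R x :=
        (lintegral_mul_const _ hp).symm
    _ ≤ ∫⁻ x in Metric.ball z (2 * s), p x * ∫⁻ y in Metric.ball x (4 * s), R y := by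
        refine setLIntegral_mono' measurableSet_ball fun x hx => ?_
        gcongr
        refine Metric.ball_subset_ball' ?_
        rw [dist_comm]
        linarith [Metric.mem_ball.1 hx]
    _ ≤ _ := setLIntegral_le_lintegral _ _

/-- Let m and q be the integrals of R and p over the ball, and G the pair mass. Hölder gives m ≤ c s
q^{2/3}, hence m^{5/2} ≤ (cs)^{3/2} q m. Here q m ≤ G removes the uncontrolled local pressure q. -/
theorem lintegral_ball_le {R p : E3 → ℝ≥0∞} (hR : Measurable R) (hp : Measurable p)
    (hRp : ∀ x, R x ^ (3 / 2 : ℝ) ≤ p x) (s : ℝ) 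
    (hs : 0 < s) (z : E3) :
    ∫⁻ x in Metric.ball z (2 * s), R x ≤
      (2 * volume (Metric.ball (0 : E3) 1) ^ (1 / 3 : ℝ)) ^ (3 / 5 : ℝ) *
        (ENNReal.ofReal s ^ (3 / 5 : ℝ) * pairMass p R (4 * s) ^ (2 / 5 : ℝ)) := by
  have hq := mul_lintegral_ball_le_pairMass (R := R) hp s z
  set m := ∫⁻ x in Metric.ball z (2 * s), R x
  set q := ∫⁻ x in Metric.ball z (2 * s), p x
  set c := 2 * volume (Metric.ball (0 : E3) 1) ^ (1 / 3 : ℝ) with hc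
  have h1 : m ≤ q ^ (2 / 3 : ℝ) * (c * ENNReal.ofReal s) := by
    have h := lintegral_mul_le_three_halves (μ := volume.restrict (Metric.ball z (2 * s)))
      hR hRp (f := fun _ => 1) measurable_const
    simp only [mul_one, one_pow, lintegral_const, Measure.restrict_apply_univ, one_mul] at h
    refine h.trans (le_of_eq ?_)
    rw [volume_ball_eq _ (by positivity), ENNReal.mul_rpow_of_nonneg _ _ (by norm_num),
      ← ENNReal.rpow_natCast, ← ENNReal.rpow_mul, ENNReal.ofReal_mul (by norm_num),
      ENNReal.ofReal_ofNat]
    rw [show ((3 : ℕ) : ℝ) * (1 / 3) = 1 by norm_num, ENNReal.rpow_one, hc]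
    ring
  clear_value c
  set σ := ENNReal.ofReal s
  have h2 : m ^ (5 / 2 : ℝ) ≤ (c * σ) ^ (3 / 2 : ℝ) * pairMass p R (4 * s) := by
    calc m ^ (5 / 2 : ℝ) = m ^ (3 / 2 : ℝ) * m := by
          rw [show (5 / 2 : ℝ) = 3 / 2 + 1 by norm_num,
            ENNReal.rpow_add_of_nonneg _ _ (by norm_num) (by norm_num), ENNReal.rpow_one]
      _ ≤ (q ^ (2 / 3 : ℝ) * (c * σ)) ^ (3 / 2 : ℝ) * m := by gcongr
      _ = (c * σ) ^ (3 / 2 : ℝ) * (q * m) := by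
          rw [ENNReal.mul_rpow_of_nonneg _ _ (by norm_num), ← ENNReal.rpow_mul]
          norm_num
          ring
      _ ≤ _ := by gcongr
  have h3 := ENNReal.rpow_le_rpow h2 (by norm_num : (0 : ℝ) ≤ 2 / 5)
  rw [ENNReal.mul_rpow_of_nonneg _ _ (by norm_num), ← ENNReal.rpow_mul, ← ENNReal.rpow_mul,
    ENNReal.mul_rpow_of_nonneg _ _ (by norm_num)] at h3
  norm_num at h3
  rwa [mul_assoc] at h3

/-- With m, q and G the integrals of R, of p and the pair mass, m q^{2/3} = (qm)^{2/3} m^{1/3}. The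
product qm is at most G, and the bound for m gives the exponent 2/3 + 2/15 = 4/5. -/
theorem lintegral_ball_mul_le {R p : E3 → ℝ≥0∞} (hR : Measurable R) (hp : Measurable p)
    (hRp : ∀ x, R x ^ (3 / 2 : ℝ) ≤ p x) (s : ℝ) 
    (hs : 0 < s) (z : E3) :
    (∫⁻ x in Metric.ball z (2 * s), R x) *
        (∫⁻ x in Metric.ball z (2 * s), p x) ^ (2 / 3 : ℝ) ≤
      (2 * volume (Metric.ball (0 : E3) 1) ^ (1 / 3 : ℝ)) ^ (1 / 5 : ℝ) *
        (ENNReal.ofReal s ^ (1 / 5 : ℝ) * pairMass p R (4 * s) ^ (4 / 5 : ℝ)) := by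
  have hm := lintegral_ball_le hR hp hRp s hs z
  have hmq := mul_lintegral_ball_le_pairMass (R := R) hp s z
  set m := ∫⁻ x in Metric.ball z (2 * s), R x
  set q := ∫⁻ x in Metric.ball z (2 * s), p x
  set σ := ENNReal.ofReal s
  set c := 2 * volume (Metric.ball (0 : E3) 1) ^ (1 / 3 : ℝ)
  set G := pairMass p R (4 * s)
  clear_value c
  calc m * q ^ (2 / 3 : ℝ) = (q * m) ^ (2 / 3 : ℝ) * m ^ (1 / 3 : ℝ) := by
        rw [ENNReal.mul_rpow_of_nonneg _ _ (by norm_num), mul_assoc,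
          ← ENNReal.rpow_add_of_nonneg _ _ (by norm_num) (by norm_num)]
        norm_num
        ring
    _ ≤ G ^ (2 / 3 : ℝ) * (c ^ (3 / 5 : ℝ) * (σ ^ (3 / 5 : ℝ) * G ^ (2 / 5 : ℝ))) ^ (1 / 3 : ℝ) := by
        gcongr
    _ = _ := by
        rw [ENNReal.mul_rpow_of_nonneg (c ^ (3 / 5 : ℝ)) _ (by norm_num),
          ENNReal.mul_rpow_of_nonneg _ _ (by norm_num),
          ← ENNReal.rpow_mul, ← ENNReal.rpow_mul, ← ENNReal.rpow_mul]
        rw [show (4 / 5 : ℝ) = 2 / 3 + 2 / 5 * (1 / 3) by norm_num,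
          ENNReal.rpow_add_of_nonneg _ _ (by norm_num) (by norm_num)]
        norm_num
        ring

/-- The increment is discarded through |a - b|² ≤ 2(|a|² + |b|²). All smallness comes from the mass
of balls. -/
theorem fluctuation_le_energy {R p : E3 → ℝ≥0∞} (hR : Measurable R) (hp : Measurable p)
    (hRp : ∀ x, R x ^ (3 / 2 : ℝ) ≤ p x) (s : ℝ) 
    (hs : 0 < s) {w : E3 → ℝ} (hw : Measurable w) :
    fluctuation R w s ≤ 4 * (2 * volume (Metric.ball (0 : E3) 1) ^ (1 / 3 : ℝ)) ^ (3 / 5 : ℝ) *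
        (ENNReal.ofReal s ^ (3 / 5 : ℝ) * pairMass p R (4 * s) ^ (2 / 5 : ℝ)) *
          ∫⁻ x, R x * ‖w x‖ₑ ^ 2 := by
  have hball : ∀ x, ∫⁻ y in Metric.ball x s, R y ≤
      (2 * volume (Metric.ball (0 : E3) 1) ^ (1 / 3 : ℝ)) ^ (3 / 5 : ℝ) *
        (ENNReal.ofReal s ^ (3 / 5 : ℝ) * pairMass p R (4 * s) ^ (2 / 5 : ℝ)) := fun x =>
    (lintegral_mono_set (Metric.ball_subset_ball (by linarith))).trans
      (lintegral_ball_le hR hp hRp s hs x)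
  set X := (2 * volume (Metric.ball (0 : E3) 1) ^ (1 / 3 : ℝ)) ^ (3 / 5 : ℝ) *
        (ENNReal.ofReal s ^ (3 / 5 : ℝ) * pairMass p R (4 * s) ^ (2 / 5 : ℝ))
  have hA : ∫⁻ x, ∫⁻ y in Metric.ball x s, R x * R y * ‖w x‖ₑ ^ 2 ≤
      X * ∫⁻ x, R x * ‖w x‖ₑ ^ 2 := by
    rw [← lintegral_const_mul _ (by fun_prop)]
    refine lintegral_mono fun x => ?_
    calc _ = ∫⁻ y in Metric.ball x s, R x * ‖w x‖ₑ ^ 2 * R y := by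
          congr 1; ext y; ring
      _ = R x * ‖w x‖ₑ ^ 2 * ∫⁻ y in Metric.ball x s, R y := lintegral_const_mul _ hR
      _ ≤ R x * ‖w x‖ₑ ^ 2 * X := by gcongr; exact hball x
      _ = _ := mul_comm _ _
  have hB : ∫⁻ x, ∫⁻ y in Metric.ball x s, R x * R y * ‖w y‖ₑ ^ 2 ≤
      X * ∫⁻ x, R x * ‖w x‖ₑ ^ 2 := by
    rw [lintegral_ball_swap (by simp only [Function.uncurry_def]; fun_prop)]
    refine le_trans (le_of_eq ?_) hA
    congr 1; ext x; congr 1; ext y; ring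
  calc fluctuation R w s
      ≤ ∫⁻ x, ∫⁻ y in Metric.ball x s,
          2 * (R x * R y * ‖w x‖ₑ ^ 2 + R x * R y * ‖w y‖ₑ ^ 2) := by
        refine lintegral_mono fun x => lintegral_mono fun y => ?_
        have := enorm_add_sq_le (w x) (-w y)
        rw [← sub_eq_add_neg, enorm_neg] at this
        calc _ ≤ R x * R y * (2 * (‖w x‖ₑ ^ 2 + ‖w y‖ₑ ^ 2)) := by gcongr
          _ = _ := by ring
    _ = 2 * ((∫⁻ x, ∫⁻ y in Metric.ball x s, R x * R y * ‖w x‖ₑ ^ 2) +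
          ∫⁻ x, ∫⁻ y in Metric.ball x s, R x * R y * ‖w y‖ₑ ^ 2) := by
        rw [← lintegral_add_left, ← lintegral_const_mul' _ _ (by simp)]
        · congr 1
          ext x
          rw [lintegral_const_mul' _ _ (by simp), lintegral_add_left (by fun_prop)]
        · exact measurable_lintegral_ball measurable_id
            (by simp only [Function.uncurry_def]; fun_prop) _
    _ ≤ 2 * (X * (∫⁻ x, R x * ‖w x‖ₑ ^ 2) + X * ∫⁻ x, R x * ‖w x‖ₑ ^ 2) := by gcongr
    _ = _ := by simp only [X]; ring

/-- If |x - y| < s, every z in B(x, s) has both points in B(z, 2s), so averaging over z costs the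
volume of a ball of radius s. Inside B(z, 2s) both values are compared with w(z), and Hölder
separates the pressure from the sixth power of w - w(z). -/
theorem fluctuation_mul_volume_le {R p : E3 → ℝ≥0∞} (hR : Measurable R) (hp : Measurable p)
    (hRp : ∀ x, R x ^ (3 / 2 : ℝ) ≤ p x) (s : ℝ) 
    (hs : 0 < s) {w : E3 → ℝ} (hw : Measurable w) :
    ENNReal.ofReal s ^ 3 * volume (Metric.ball (0 : E3) 1) * fluctuation R w s ≤
      4 * (2 * volume (Metric.ball (0 : E3) 1) ^ (1 / 3 : ℝ)) ^ (1 / 5 : ℝ) *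
        (ENNReal.ofReal s ^ (1 / 5 : ℝ) * pairMass p R (4 * s) ^ (4 / 5 : ℝ)) *
        ∫⁻ z, (∫⁻ x in Metric.ball z (2 * s), ‖w x - w z‖ₑ ^ 6) ^ (1 / 3 : ℝ) := by
  have hmq := lintegral_ball_mul_le hR hp hRp s hs
  set X := (2 * volume (Metric.ball (0 : E3) 1) ^ (1 / 3 : ℝ)) ^ (1 / 5 : ℝ) *
        (ENNReal.ofReal s ^ (1 / 5 : ℝ) * pairMass p R (4 * s) ^ (4 / 5 : ℝ))
  let F : E3 → E3 → ℝ≥0∞ := fun x y => R x * R y * ‖w x - w y‖ₑ ^ 2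
  have hF : Measurable (Function.uncurry F) := by
    simp only [Function.uncurry_def, F]; fun_prop
  have hFx : ∀ x, Measurable (F x) := fun x => by simp only [F]; fun_prop
  -- covering by balls
  have h1 : ENNReal.ofReal s ^ 3 * volume (Metric.ball (0 : E3) 1) * fluctuation R w s ≤
      ∫⁻ z, ∫⁻ x in Metric.ball z (2 * s), ∫⁻ y in Metric.ball z (2 * s), F x y := by
    have hsw := lintegral_ball_swap (F := fun x z => ∫⁻ y in Metric.ball z (2 * s), F x y)
      (R := 2 * s) (measurable_lintegral_ball (P := E3 × E3) (c := fun q => q.2)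
        (F := fun q y => F q.1 y) measurable_snd (by
          simp only [Function.uncurry_def, F]; fun_prop) (2 * s))
    rw [← hsw, fluctuation, ← lintegral_const_mul']
    · refine lintegral_mono fun x => ?_
      rw [← volume_ball_eq x hs.le]
      calc _ = ∫⁻ z in Metric.ball x s, ∫⁻ y in Metric.ball x s, F x y := by
            rw [lintegral_const, Measure.restrict_apply_univ, mul_comm]
        _ ≤ ∫⁻ z in Metric.ball x s, ∫⁻ y in Metric.ball z (2 * s), F x y := by
            refine setLIntegral_mono' measurableSet_ball fun z hz => lintegral_mono_set ?_
            refine Metric.ball_subset_ball' ?_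
            rw [dist_comm]
            linarith [Metric.mem_ball.1 hz]
        _ ≤ _ := lintegral_mono_set (Metric.ball_subset_ball (by linarith))
    · exact ENNReal.mul_ne_top (by simp) measure_ball_lt_top.ne
  refine h1.trans ?_
  have hAm : Measurable fun z =>
      (∫⁻ x in Metric.ball z (2 * s), ‖w x - w z‖ₑ ^ 6) ^ (1 / 3 : ℝ) :=
    Measurable.pow_const (measurable_lintegral_ball
      measurable_id (F := fun z x => ‖w x - w z‖ₑ ^ 6) (by
        simp only [Function.uncurry_def]; fun_prop) _) _
  rw [mul_assoc 4, ← lintegral_const_mul _ hAm]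
  refine lintegral_mono fun z => ?_
  set μ := volume.restrict (Metric.ball z (2 * s))
  set D := ∫⁻ x, R x * ‖w x - w z‖ₑ ^ 2 ∂μ
  have hD : D ≤ (∫⁻ x, p x ∂μ) ^ (2 / 3 : ℝ) * (∫⁻ x, ‖w x - w z‖ₑ ^ 6 ∂μ) ^ (1 / 3 : ℝ) := by
    refine (lintegral_mul_le_three_halves hR hRp (by fun_prop)).trans (le_of_eq ?_)
    simp only [← pow_mul]
  calc _ ≤ ∫⁻ x, ∫⁻ y, 2 * (R x * ‖w x - w z‖ₑ ^ 2 * R y + R x * (R y * ‖w y - w z‖ₑ ^ 2)) ∂μ ∂μ := by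
        refine lintegral_mono fun x => lintegral_mono fun y => ?_
        have := enorm_add_sq_le (w x - w z) (-(w y - w z))
        rw [enorm_neg, ← sub_eq_add_neg, sub_sub_sub_cancel_right] at this
        calc F x y ≤ R x * R y * (2 * (‖w x - w z‖ₑ ^ 2 + ‖w y - w z‖ₑ ^ 2)) := by
              simp only [F]; gcongr
          _ = _ := by ring
    _ = 4 * ((∫⁻ x, R x ∂μ) * D) := by
        have : ∀ x, ∫⁻ y, 2 * (R x * ‖w x - w z‖ₑ ^ 2 * R y + R x * (R y * ‖w y - w z‖ₑ ^ 2)) ∂μ =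
            2 * (R x * ‖w x - w z‖ₑ ^ 2 * (∫⁻ x, R x ∂μ) + R x * D) := fun x => by
          rw [lintegral_const_mul' _ _ (by simp), lintegral_add_left (by fun_prop),
            lintegral_const_mul _ hR, lintegral_const_mul _ (by fun_prop)]
        simp only [this]
        rw [lintegral_const_mul' _ _ (by simp), lintegral_add_left (by fun_prop),
          lintegral_mul_const _ (by fun_prop), lintegral_mul_const _ hR]
        ring
    _ ≤ 4 * ((∫⁻ x, R x ∂μ) * ((∫⁻ x, p x ∂μ) ^ (2 / 3 : ℝ) *
          (∫⁻ x, ‖w x - w z‖ₑ ^ 6 ∂μ) ^ (1 / 3 : ℝ))) := by gcongr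
    _ = 4 * ((∫⁻ x, R x ∂μ) * (∫⁻ x, p x ∂μ) ^ (2 / 3 : ℝ)) *
          (∫⁻ x, ‖w x - w z‖ₑ ^ 6 ∂μ) ^ (1 / 3 : ℝ) := by ring
    _ ≤ _ := mul_le_mul' (mul_le_mul' le_rfl (hmq z)) le_rfl

/-- Geometric mean of the kinetic bound s^{3/5}G^{2/5}K and the Sobolev bound s^{1/5}G^{4/5}a. The
weights 4/7 and 3/7 are those for which the powers of G and a add up to 1, as Hölder in time
requires. -/
theorem exists_fluctuation_le : ∃ C : ℝ≥0, ∀ (R p : E3 → ℝ≥0∞), Measurable R → Measurable p →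
    (∀ x, R x ^ (3 / 2 : ℝ) ≤ p x) → ∀ (w : E3 → ℝ) (g : Fin 3 → E3 → ℝ), Measurable w →
    IsWeakGrad w g → ∀ s : ℝ, 0 < s →
      fluctuation R w s ≤ C * (ENNReal.ofReal s ^ (3 / 7 : ℝ) * pairMass p R (4 * s) ^ (4 / 7 : ℝ) *
        (∫⁻ x, R x * ‖w x‖ₑ ^ 2) ^ (4 / 7 : ℝ) * (∑ j, ∫⁻ x, ‖g j x‖ₑ ^ 2) ^ (3 / 7 : ℝ)) := by
  obtain ⟨C, hC⟩ := exists_averaged_sobolev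
  set κ := volume (Metric.ball (0 : E3) 1) with hκ
  have hκt : κ ≠ ⊤ := measure_ball_lt_top.ne
  have hκ0 : κ ≠ 0 := (Metric.measure_ball_pos _ _ one_pos).ne'
  set c := 2 * κ ^ (1 / 3 : ℝ) with hc
  have hct : c ≠ ⊤ := ENNReal.mul_ne_top (by simp) (ENNReal.rpow_ne_top_of_nonneg (by norm_num) hκt)
  set c1 := 4 * c ^ (3 / 5 : ℝ) with hc1
  set c2 := 4 * c ^ (1 / 5 : ℝ) * C * κ⁻¹ with hc2
  have hc1t : c1 ≠ ⊤ := ENNReal.mul_ne_top (by simp) (ENNReal.rpow_ne_top_of_nonneg (by norm_num) hct)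
  have hc2t : c2 ≠ ⊤ := ENNReal.mul_ne_top (ENNReal.mul_ne_top (ENNReal.mul_ne_top (by simp)
    (ENNReal.rpow_ne_top_of_nonneg (by norm_num) hct)) (by simp)) (ENNReal.inv_ne_top.2 hκ0)
  refine ⟨(c1 ^ (4 / 7 : ℝ) * c2 ^ (3 / 7 : ℝ)).toNNReal, fun R p hR hp hRp w g hw hg s hs => ?_⟩
  rw [ENNReal.coe_toNNReal (ENNReal.mul_ne_top (ENNReal.rpow_ne_top_of_nonneg (by norm_num) hc1t)
    (ENNReal.rpow_ne_top_of_nonneg (by norm_num) hc2t))]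
  have h1 := fluctuation_le_energy hR hp hRp s hs hw
  have h2 := (fluctuation_mul_volume_le hR hp hRp s hs hw).trans (mul_le_mul' le_rfl (hC w g hg s hs))
  rw [← hκ, ← hc] at h1 h2
  set b := fluctuation R w s
  set G := pairMass p R (4 * s)
  set σ := ENNReal.ofReal s with hσ
  have hσ0 : σ ≠ 0 := (ENNReal.ofReal_pos.2 hs).ne'
  have hσt : σ ≠ ⊤ := ENNReal.ofReal_ne_top
  set K := ∫⁻ x, R x * ‖w x‖ₑ ^ 2
  set a := ∑ j, ∫⁻ x, ‖g j x‖ₑ ^ 2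
  have h2' : b ≤ c2 * (σ ^ (1 / 5 : ℝ) * G ^ (4 / 5 : ℝ)) * a := by
    -- The factor s³ of the averaged Sobolev inequality cancels against the volume of the covering
    -- ball.
    have h3 : σ ^ 3 * κ ≠ 0 := mul_ne_zero (pow_ne_zero 3 hσ0) hκ0
    have h4 : σ ^ 3 * κ ≠ ⊤ := ENNReal.mul_ne_top (ENNReal.pow_ne_top hσt) hκt
    refine (ENNReal.mul_le_mul_iff_right h3 h4).1 (h2.trans (le_of_eq ?_))
    rw [hc2]
    calc _ = 4 * c ^ (1 / 5 : ℝ) * (σ ^ (1 / 5 : ℝ) * G ^ (4 / 5 : ℝ)) * (C * σ ^ 3 * a) * 1 := by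
          rw [mul_one]
      _ = 4 * c ^ (1 / 5 : ℝ) * (σ ^ (1 / 5 : ℝ) * G ^ (4 / 5 : ℝ)) * (C * σ ^ 3 * a) *
          (κ * κ⁻¹) := by rw [ENNReal.mul_inv_cancel hκ0 hκt]
      _ = _ := by ring
  rw [← hc1] at h1
  clear_value c1 c2 b G K a σ
  calc b = b ^ (4 / 7 : ℝ) * b ^ (3 / 7 : ℝ) := by
        rw [← ENNReal.rpow_add_of_nonneg _ _ (by norm_num) (by norm_num)]
        norm_num
    _ ≤ (c1 * (σ ^ (3 / 5 : ℝ) * G ^ (2 / 5 : ℝ)) * K) ^ (4 / 7 : ℝ) *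
        (c2 * (σ ^ (1 / 5 : ℝ) * G ^ (4 / 5 : ℝ)) * a) ^ (3 / 7 : ℝ) := by gcongr
    _ = _ := by
        have hσe : σ ^ (3 / 7 : ℝ) = σ ^ ((3 / 5 : ℝ) * (4 / 7)) * σ ^ ((1 / 5 : ℝ) * (3 / 7)) := by
          rw [← ENNReal.rpow_add_of_nonneg _ _ (by norm_num) (by norm_num)]; norm_num
        have hGe : G ^ (4 / 7 : ℝ) = G ^ ((2 / 5 : ℝ) * (4 / 7)) * G ^ ((4 / 5 : ℝ) * (3 / 7)) := by
          rw [← ENNReal.rpow_add_of_nonneg _ _ (by norm_num) (by norm_num)]; norm_num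
        rw [hσe, hGe]
        simp only [ENNReal.mul_rpow_of_nonneg _ _ (by norm_num : (0 : ℝ) ≤ 4 / 7),
          ENNReal.mul_rpow_of_nonneg _ _ (by norm_num : (0 : ℝ) ≤ 3 / 7), ENNReal.rpow_mul]
        ring

/-! ### Normalized solutions and the integrability of their fluxes -/

/-- A weak solution given by everywhere defined measurable functions that vanish outside the
cylinder and satisfy the energy bounds at every time. -/
structure IsNormalSolution (Ω : Set E3) (T ε m : ℝ) (E MS Mf : ℝ≥0)
    (S : SpaceTime → Matrix (Fin 3) (Fin 3) ℝ) (f : SpaceTime → E3)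
    (ϱ : SpaceTime → ℝ) (u : SpaceTime → E3) : Prop where
  density_meas : Measurable ϱ
  velocity_meas : Measurable u
  stress_meas : ∀ i j, Measurable fun z => S z i j
  force_meas : Measurable f
  density_nonneg : ∀ z, 0 ≤ ϱ z
  density_zero : ∀ z, z ∉ cylinder Ω T → ϱ z = 0
  stress_zero : ∀ z, z ∉ cylinder Ω T → S z = 0
  pressure_le : ∀ t, ∫⁻ x,
    ENNReal.ofReal (ϱ (x, t) ^ (3 / 2 : ℝ) * pressureFactor ε m (ϱ (x, t))) ≤ E
  kinetic_le : ∀ t, ∫⁻ x, ENNReal.ofReal (ϱ (x, t) * ‖u (x, t)‖ ^ 2) ≤ E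
  gradient : ∃ Du : SpaceTime → Matrix (Fin 3) (Fin 3) ℝ,
    (∀ i j, Measurable fun z => Du z i j) ∧
    (∀ᵐ t ∂(volume.restrict (Ioo 0 T)),
      HasWeakGradient Ω (fun x => u (x, t)) (fun x => Du (x, t))) ∧
    ∫⁻ z in cylinder Ω T, ENNReal.ofReal (‖u z‖ ^ 2 + ∑ i, ∑ j, Du z i j ^ 2) ≤ (E : ℝ≥0∞) ^ 2
  stress_le : ∫⁻ z, ENNReal.ofReal (∑ i, ∑ j, S z i j ^ 2) ≤ (MS : ℝ≥0∞) ^ 2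
  force_le : ∀ z, ‖f z‖ ≤ Mf
  momentum : MomentumBalance Ω T ε m S f ϱ u
  mass : MassBalance Ω T ϱ u

/-- The pressure. -/
noncomputable def pressure (ε m : ℝ) (ϱ : SpaceTime → ℝ) (z : SpaceTime) : ℝ :=
  ϱ z ^ (3 / 2 : ℝ) * pressureFactor ε m (ϱ z)

/-- A function in `L¹` that dominates the density, the momentum flux, the pressure and the
stress. -/
noncomputable def majorant (Ω : Set E3) (T ε m : ℝ) (S : SpaceTime → Matrix (Fin 3) (Fin 3) ℝ)
    (ϱ : SpaceTime → ℝ) (u : SpaceTime → E3) (z : SpaceTime) : ℝ :=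
  (cylinder Ω T).indicator 1 z + ϱ z * ‖u z‖ ^ 2 + pressure ε m ϱ z + ∑ i, ∑ j, S z i j ^ 2

theorem one_le_pressureFactor {ε m s : ℝ} (hε : 0 < ε) (hs : 0 ≤ s) :
    1 ≤ pressureFactor ε m s := by
  have := Real.rpow_nonneg hs m
  simp only [pressureFactor]
  nlinarith

theorem measurableSet_cylinder {Ω : Set E3} (hΩ : IsOpen Ω) (T : ℝ) :
    MeasurableSet (cylinder Ω T) := hΩ.measurableSet.prod measurableSet_Ioo

theorem volume_cylinder (Ω : Set E3) (T : ℝ) :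
    volume (cylinder Ω T) = volume Ω * ENNReal.ofReal T := by
  rw [cylinder, Measure.volume_eq_prod, Measure.prod_prod, Real.volume_Ioo, sub_zero]

/-- A bound for the integral of `majorant`. -/
noncomputable def majorantBound (Ω : Set E3) (T : ℝ) (E MS : ℝ≥0) : ℝ≥0∞ :=
  volume Ω * ENNReal.ofReal T + E * ENNReal.ofReal T + E * ENNReal.ofReal T + (MS : ℝ≥0∞) ^ 2

theorem lintegral_le_of_slices {F : SpaceTime → ℝ≥0∞} (hF : Measurable F) {T : ℝ} {C : ℝ≥0∞}
    (h0 : ∀ t, t ∉ Ioo 0 T → ∀ x, F (x, t) = 0) (hC : ∀ t, ∫⁻ x, F (x, t) ≤ C) :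
    ∫⁻ z, F z ≤ C * ENNReal.ofReal T := by
  rw [Measure.volume_eq_prod, lintegral_prod_symm' _ hF]
  calc _ ≤ ∫⁻ t, (Ioo 0 T).indicator (fun _ => C) t := by
        refine lintegral_mono fun t => ?_
        by_cases ht : t ∈ Ioo 0 T
        · rw [indicator_of_mem ht]; exact hC t
        · rw [indicator_of_notMem ht]
          simp [h0 t ht]
    _ = _ := by
        rw [lintegral_indicator measurableSet_Ioo, lintegral_const, Measure.restrict_apply_univ,
          Real.volume_Ioo, sub_zero]

theorem le_one_add_rpow {a : ℝ} (ha : 0 ≤ a) : a ≤ 1 + a ^ (3 / 2 : ℝ) := by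
  by_cases h : a ≤ 1
  · have := Real.rpow_nonneg ha (3 / 2 : ℝ); linarith
  · push Not at h
    have := Real.rpow_le_rpow_of_exponent_le h.le (by norm_num : (1 : ℝ) ≤ 3 / 2)
    rw [Real.rpow_one] at this
    linarith

section

variable {Ω : Set E3} {T ε m : ℝ} {E MS Mf : ℝ≥0}
  {S : SpaceTime → Matrix (Fin 3) (Fin 3) ℝ} {f : SpaceTime → E3}
  {ϱ : SpaceTime → ℝ} {u : SpaceTime → E3}

theorem IsNormalSolution.pressure_nonneg (h : IsNormalSolution Ω T ε m E MS Mf S f ϱ u)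
    (hε : 0 < ε) (z : SpaceTime) : 0 ≤ pressure ε m ϱ z :=
  mul_nonneg (Real.rpow_nonneg (h.density_nonneg z) _)
    (zero_le_one.trans (one_le_pressureFactor hε (h.density_nonneg z)))

theorem IsNormalSolution.rpow_le_pressure (h : IsNormalSolution Ω T ε m E MS Mf S f ϱ u)
    (hε : 0 < ε) (z : SpaceTime) : ϱ z ^ (3 / 2 : ℝ) ≤ pressure ε m ϱ z :=
  le_mul_of_one_le_right (Real.rpow_nonneg (h.density_nonneg z) _)
    (one_le_pressureFactor hε (h.density_nonneg z))

theorem IsNormalSolution.pressure_zero (h : IsNormalSolution Ω T ε m E MS Mf S f ϱ u)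
    {z : SpaceTime} (hz : z ∉ cylinder Ω T) : pressure ε m ϱ z = 0 := by
  rw [pressure, h.density_zero z hz, Real.zero_rpow (by norm_num), zero_mul]

theorem IsNormalSolution.measurable_pressure (h : IsNormalSolution Ω T ε m E MS Mf S f ϱ u) :
    Measurable (pressure ε m ϱ) := by
  have := h.density_meas
  unfold pressure pressureFactor
  fun_prop

theorem IsNormalSolution.measurable_majorant (h : IsNormalSolution Ω T ε m E MS Mf S f ϱ u)
    (hΩ : IsOpen Ω) : Measurable (majorant Ω T ε m S ϱ u) := by
  have h1 := h.density_meas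
  have h2 := h.velocity_meas
  have h3 := h.stress_meas
  have h4 := h.measurable_pressure
  have h5 : Measurable ((cylinder Ω T).indicator (1 : SpaceTime → ℝ)) :=
    measurable_one.indicator (measurableSet_cylinder hΩ T)
  unfold majorant
  fun_prop

theorem IsNormalSolution.le_majorant (h : IsNormalSolution Ω T ε m E MS Mf S f ϱ u)
    (hε : 0 < ε) (z : SpaceTime) :
    ϱ z ≤ majorant Ω T ε m S ϱ u z ∧ ϱ z * ‖u z‖ ^ 2 ≤ majorant Ω T ε m S ϱ u z ∧
      pressure ε m ϱ z ≤ majorant Ω T ε m S ϱ u z ∧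
      (∀ i j, S z i j ^ 2 ≤ majorant Ω T ε m S ϱ u z) ∧
      (∀ i j, |S z i j| ≤ majorant Ω T ε m S ϱ u z) ∧
      ϱ z * ‖u z‖ ^ 2 + pressure ε m ϱ z ≤ majorant Ω T ε m S ϱ u z := by
  have h1 := h.density_nonneg z
  have h2 : 0 ≤ ϱ z * ‖u z‖ ^ 2 := by positivity
  have h3 := h.pressure_nonneg hε z
  have h4 : ∀ i j, S z i j ^ 2 ≤ ∑ i, ∑ j, S z i j ^ 2 := fun i j =>
    (Finset.single_le_sum (f := fun j => S z i j ^ 2) (fun _ _ => sq_nonneg _)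
      (Finset.mem_univ j)).trans
    (Finset.single_le_sum (f := fun i => ∑ j, S z i j ^ 2)
      (fun _ _ => Finset.sum_nonneg fun _ _ => sq_nonneg _) (Finset.mem_univ i))
  have h4' : 0 ≤ ∑ i, ∑ j, S z i j ^ 2 := (sq_nonneg _).trans (h4 0 0)
  have h5 : 0 ≤ (cylinder Ω T).indicator (1 : SpaceTime → ℝ) z :=
    indicator_nonneg (fun _ _ => zero_le_one) _
  unfold majorant
  refine ⟨?_, by linarith, by linarith, fun i j => by linarith [h4 i j], fun i j => ?_,
    by linarith⟩
  · by_cases hz : z ∈ cylinder Ω T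
    · rw [indicator_of_mem hz, Pi.one_apply]
      have := le_one_add_rpow h1
      have := h.rpow_le_pressure hε z
      linarith
    · rw [h.density_zero z hz]
      rw [h.density_zero z hz] at h2
      linarith
  · by_cases hz : z ∈ cylinder Ω T
    · rw [indicator_of_mem hz, Pi.one_apply]
      have : |S z i j| ≤ 1 + S z i j ^ 2 := by
        nlinarith [sq_abs (S z i j), sq_nonneg (|S z i j| - 1), abs_nonneg (S z i j)]
      linarith [h4 i j]
    · have e : |S z i j| = 0 := by simp [h.stress_zero z hz]
      linarith

theorem IsNormalSolution.majorant_nonneg (h : IsNormalSolution Ω T ε m E MS Mf S f ϱ u)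
    (hε : 0 < ε) (z : SpaceTime) : 0 ≤ majorant Ω T ε m S ϱ u z :=
  (h.density_nonneg z).trans (h.le_majorant hε z).1

theorem IsNormalSolution.lintegral_majorant_le (h : IsNormalSolution Ω T ε m E MS Mf S f ϱ u)
    (hΩ : IsOpen Ω) (hε : 0 < ε) :
    ∫⁻ z, ENNReal.ofReal (majorant Ω T ε m S ϱ u z) ≤ majorantBound Ω T E MS := by
  have m1 := h.density_meas
  have m2 := h.velocity_meas
  have m3 := h.stress_meas
  have m4 := h.measurable_pressure
  have m5 : Measurable ((cylinder Ω T).indicator (1 : SpaceTime → ℝ)) :=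
    measurable_one.indicator (measurableSet_cylinder hΩ T)
  have n5 : ∀ z, 0 ≤ (cylinder Ω T).indicator (1 : SpaceTime → ℝ) z := fun z =>
    indicator_nonneg (fun _ _ => zero_le_one) _
  have n1 := h.density_nonneg
  have n2 := h.pressure_nonneg hε
  have hz : ∀ t, t ∉ Ioo 0 T → ∀ x, (x, t) ∉ cylinder Ω T := fun t ht x hx => ht hx.2
  have e : ∀ z, ENNReal.ofReal (majorant Ω T ε m S ϱ u z) =
      ENNReal.ofReal ((cylinder Ω T).indicator 1 z) + ENNReal.ofReal (ϱ z * ‖u z‖ ^ 2) +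
        ENNReal.ofReal (pressure ε m ϱ z) + ENNReal.ofReal (∑ i, ∑ j, S z i j ^ 2) := by
    intro z
    have a1 := n1 z
    have a2 := n2 z
    have a5 := n5 z
    rw [majorant, ENNReal.ofReal_add (by positivity) (by positivity),
      ENNReal.ofReal_add (by positivity) a2, ENNReal.ofReal_add a5 (by positivity)]
  simp only [e]
  rw [lintegral_add_left (by fun_prop), lintegral_add_left (by fun_prop),
    lintegral_add_left (by fun_prop), majorantBound]
  gcongr
  · rw [← volume_cylinder, ← lintegral_indicator_one (measurableSet_cylinder hΩ T)]
    refine lintegral_mono fun z => ?_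
    by_cases hz : z ∈ cylinder Ω T <;> simp [hz]
  · refine lintegral_le_of_slices (by fun_prop) (fun t ht x => ?_) h.kinetic_le
    simp [h.density_zero _ (hz t ht x)]
  · refine lintegral_le_of_slices (by fun_prop) (fun t ht x => ?_) h.pressure_le
    simp [h.pressure_zero (hz t ht x)]
  · exact h.stress_le

theorem majorantBound_lt_top (hΩb : Bornology.IsBounded Ω) : majorantBound Ω T E MS < ⊤ := by
  have := hΩb.measure_lt_top (μ := (volume : Measure E3))
  unfold majorantBound
  refine ENNReal.add_lt_top.2 ⟨ENNReal.add_lt_top.2 ⟨ENNReal.add_lt_top.2 ⟨?_, ?_⟩, ?_⟩, ?_⟩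
  · exact ENNReal.mul_lt_top this (by simp)
  · exact ENNReal.mul_lt_top (by simp) (by simp)
  · exact ENNReal.mul_lt_top (by simp) (by simp)
  · simp

theorem IsNormalSolution.integrable_of_le (h : IsNormalSolution Ω T ε m E MS Mf S f ϱ u)
    (hΩ : IsOpen Ω) (hΩb : Bornology.IsBounded Ω) (hε : 0 < ε) {g : SpaceTime → ℝ}
    (hg : Measurable g) {C : ℝ} (hC : ∀ z, |g z| ≤ C * majorant Ω T ε m S ϱ u z) :
    Integrable g := by
  have hm : Integrable (majorant Ω T ε m S ϱ u) := by
    refine ⟨(h.measurable_majorant hΩ).aestronglyMeasurable, ?_⟩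
    rw [hasFiniteIntegral_iff_ofReal (ae_of_all _ (h.majorant_nonneg hε))]
    exact (h.lintegral_majorant_le hΩ hε).trans_lt (majorantBound_lt_top hΩb)
  exact (hm.const_mul C).mono' hg.aestronglyMeasurable (ae_of_all _ hC)

/-- The bound holds at every time, because ϱ ≤ 1 + ϱ^{3/2} on Ω and the pressure is controlled on
each slice. This keeps spatial convolutions of the density bounded. -/
theorem IsNormalSolution.sliceBounded_density (h : IsNormalSolution Ω T ε m E MS Mf S f ϱ u)
    (hΩ : IsOpen Ω) (hΩb : Bornology.IsBounded Ω) (hε : 0 < ε) : SliceBounded ϱ := by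
  refine ⟨h.density_meas, h.integrable_of_le hΩ hΩb hε h.density_meas (C := 1) fun z => ?_, ?_⟩
  · rw [abs_of_nonneg (h.density_nonneg z), one_mul]
    exact (h.le_majorant hε z).1
  · have hv := (hΩb.measure_lt_top (μ := (volume : Measure E3))).ne
    refine ⟨(volume Ω).toNNReal + E, fun t => ?_⟩
    rw [ENNReal.coe_add, ENNReal.coe_toNNReal hv]
    have hm := h.measurable_pressure
    calc ∫⁻ y, ‖ϱ (y, t)‖ₑ ≤ ∫⁻ y, (Ω.indicator 1 y + ENNReal.ofReal (pressure ε m ϱ (y, t))) := by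
          refine lintegral_mono fun y => ?_
          rw [Real.enorm_of_nonneg (h.density_nonneg _)]
          by_cases hz : (y, t) ∈ cylinder Ω T
          · rw [indicator_of_mem hz.1, Pi.one_apply, ← ENNReal.ofReal_one,
              ← ENNReal.ofReal_add zero_le_one (h.pressure_nonneg hε _)]
            exact ENNReal.ofReal_le_ofReal ((le_one_add_rpow (h.density_nonneg _)).trans
              (by linarith [h.rpow_le_pressure hε (y, t)]))
          · simp [h.density_zero _ hz]
      _ = volume Ω + ∫⁻ y, ENNReal.ofReal (pressure ε m ϱ (y, t)) := by
          rw [lintegral_add_left (measurable_one.indicator hΩ.measurableSet),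
            lintegral_indicator_one hΩ.measurableSet]
      _ ≤ _ := by
          gcongr
          exact h.pressure_le t

theorem IsNormalSolution.sliceBounded_momentum (h : IsNormalSolution Ω T ε m E MS Mf S f ϱ u)
    (hΩ : IsOpen Ω) (hΩb : Bornology.IsBounded Ω) (hε : 0 < ε) (j : Fin 3) :
    SliceBounded (fun z => ϱ z * u z j) := by
  have hm : Measurable (fun z => ϱ z * u z j) := by
    have := h.density_meas
    have := h.velocity_meas
    fun_prop
  have hle : ∀ z, |ϱ z * u z j| ≤ ϱ z + ϱ z * ‖u z‖ ^ 2 := fun z => by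
    have h1 := h.density_nonneg z
    have h2 : |u z j| ≤ ‖u z‖ := PiLp.norm_apply_le (u z) j
    rw [abs_mul, abs_of_nonneg h1]
    nlinarith [sq_nonneg (‖u z‖ - 1), mul_nonneg h1 (norm_nonneg (u z)),
      mul_nonneg h1 (sq_nonneg (‖u z‖ - 1)), mul_le_mul_of_nonneg_left h2 h1]
  refine ⟨hm, h.integrable_of_le hΩ hΩb hε hm (C := 2) fun z => ?_, ?_⟩
  · linarith [hle z, (h.le_majorant hε z).1, (h.le_majorant hε z).2.1]
  · obtain ⟨C, hC⟩ := (h.sliceBounded_density hΩ hΩb hε).bound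
    refine ⟨C + E, fun t => ?_⟩
    have := h.density_meas
    calc _ ≤ ∫⁻ y, (‖ϱ (y, t)‖ₑ + ENNReal.ofReal (ϱ (y, t) * ‖u (y, t)‖ ^ 2)) := by
          refine lintegral_mono fun y => ?_
          have h1 := h.density_nonneg (y, t)
          rw [Real.enorm_of_nonneg h1, ← ENNReal.ofReal_add h1 (by positivity),
            ← ofReal_norm]
          exact ENNReal.ofReal_le_ofReal (hle _)
      _ ≤ _ := by
          rw [lintegral_add_left (by fun_prop), ENNReal.coe_add]
          gcongr
          · exact hC t
          · exact h.kinetic_le t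

/-- The `(i, j)` component of the momentum flux. -/
noncomputable def flux (ε m : ℝ) (S : SpaceTime → Matrix (Fin 3) (Fin 3) ℝ)
    (ϱ : SpaceTime → ℝ) (u : SpaceTime → E3) (i j : Fin 3) (z : SpaceTime) : ℝ :=
  ϱ z * u z i * u z j + (if i = j then pressure ε m ϱ z else 0) - S z i j

theorem IsNormalSolution.abs_flux_le (h : IsNormalSolution Ω T ε m E MS Mf S f ϱ u)
    (hε : 0 < ε) (i j : Fin 3) (z : SpaceTime) :
    |flux ε m S ϱ u i j z| ≤ 2 * majorant Ω T ε m S ϱ u z := by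
  have h1 := h.density_nonneg z
  have h2 := h.pressure_nonneg hε z
  obtain ⟨-, -, -, -, h5, h6⟩ := h.le_majorant hε z
  have h7 : |ϱ z * u z i * u z j| ≤ ϱ z * ‖u z‖ ^ 2 := by
    rw [mul_assoc, abs_mul, abs_mul, abs_of_nonneg h1, sq]
    gcongr
    · exact PiLp.norm_apply_le (u z) i
    · exact PiLp.norm_apply_le (u z) j
  have h8 : |if i = j then pressure ε m ϱ z else 0| ≤ pressure ε m ϱ z := by
    split_ifs
    · rw [abs_of_nonneg h2]
    · simpa
  unfold flux
  refine (abs_sub _ _).trans ?_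
  have := abs_add_le (ϱ z * u z i * u z j) (if i = j then pressure ε m ϱ z else 0)
  linarith [h5 i j]

theorem IsNormalSolution.measurable_flux (h : IsNormalSolution Ω T ε m E MS Mf S f ϱ u)
    (i j : Fin 3) : Measurable (flux ε m S ϱ u i j) := by
  have h1 := h.density_meas
  have h2 := h.velocity_meas
  have h3 := h.stress_meas i j
  have h4 := h.measurable_pressure
  unfold flux
  split_ifs <;> fun_prop

theorem IsNormalSolution.integrable_flux (h : IsNormalSolution Ω T ε m E MS Mf S f ϱ u)
    (hΩ : IsOpen Ω) (hΩb : Bornology.IsBounded Ω) (hε : 0 < ε) (i j : Fin 3) :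
    Integrable (flux ε m S ϱ u i j) :=
  h.integrable_of_le hΩ hΩb hε (h.measurable_flux i j) (h.abs_flux_le hε i j)

theorem IsNormalSolution.integrable_force (h : IsNormalSolution Ω T ε m E MS Mf S f ϱ u)
    (hΩ : IsOpen Ω) (hΩb : Bornology.IsBounded Ω) (hε : 0 < ε) (i : Fin 3) :
    Integrable (fun z => ϱ z * f z i) := by
  have h1 := h.density_meas
  have h2 := h.force_meas
  refine h.integrable_of_le hΩ hΩb hε (by fun_prop) (C := Mf) fun z => ?_
  rw [abs_mul, abs_of_nonneg (h.density_nonneg z), mul_comm]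
  gcongr
  · exact h.density_nonneg z
  · exact (PiLp.norm_apply_le (f z) i).trans (h.force_le z)
  · exact (h.le_majorant hε z).1

theorem IsNormalSolution.mass_eq (h : IsNormalSolution Ω T ε m E MS Mf S f ϱ u)
    {ψ : SpaceTime → ℝ} (hψ : IsTestFunction (cylinder Ω T) ψ) :
    ∫ z, (ϱ z * timeDeriv ψ z + ∑ j, (ϱ z * u z j) * spaceDeriv j ψ z) = 0 := by
  rw [← h.mass ψ hψ, ← setIntegral_eq_integral_of_forall_compl_eq_zero (s := cylinder Ω T)]
  · simp only [Finset.mul_sum, mul_assoc]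
  · intro z hz
    simp [h.density_zero z hz]

theorem IsNormalSolution.momentum_eq (h : IsNormalSolution Ω T ε m E MS Mf S f ϱ u)
    (hΩ : IsOpen Ω) (hΩb : Bornology.IsBounded Ω) (hε : 0 < ε) (i : Fin 3)
    {ξ : SpaceTime → ℝ} (hξ : IsTestFunction (cylinder Ω T) ξ) :
    ∫ z, ((ϱ z * u z i) * timeDeriv ξ z + ∑ j, flux ε m S ϱ u i j z * spaceDeriv j ξ z
      + (ϱ z * f z i) * ξ z) = 0 := by
  -- The vector equation is tested with ξ e_i, which selects the i-th row of the flux.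
  have hvec : IsTestFunction (cylinder Ω T) fun z => ξ z • unitVec i := by
    refine ⟨hξ.1.smul contDiff_const, hξ.2.1.smul_right, ?_⟩
    exact (closure_mono (Function.support_smul_subset_left ξ fun _ => unitVec i)).trans hξ.2.2
  have hd : ∀ z v, fderiv ℝ (fun z => ξ z • unitVec i) z v = fderiv ℝ ξ z v • unitVec i := by
    intro z v
    rw [fderiv_smul_const (hξ.1.differentiable (by simp) z)]
    rfl
  have hmom := h.momentum _ hvec
  have hb : ∀ v, ∃ C, ∀ z, ‖fderiv ℝ ξ z v‖ ≤ C := fun v =>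
    (hξ.2.1.fderiv_apply ℝ v).exists_bound_of_continuous
      ((hξ.1.continuous_fderiv (by simp)).clm_apply continuous_const)
  have hbm : ∀ v, AEStronglyMeasurable fun z => fderiv ℝ ξ z v := fun v =>
    ((hξ.1.continuous_fderiv (by simp)).clm_apply continuous_const).aestronglyMeasurable
  obtain ⟨Cξ, hCξ⟩ := hξ.2.1.exists_bound_of_continuous hξ.1.continuous
  have i1 : Integrable fun z => (ϱ z * u z i) * timeDeriv ξ z := by
    obtain ⟨C, hC⟩ := hb (0, 1)
    exact (h.sliceBounded_momentum hΩ hΩb hε i).integrable.mul_bdd (hbm _) (ae_of_all _ hC)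
  have i2 : Integrable fun z => ∑ j, flux ε m S ϱ u i j z * spaceDeriv j ξ z := by
    refine integrable_finsetSum _ fun j _ => ?_
    obtain ⟨C, hC⟩ := hb (unitVec j, 0)
    exact (h.integrable_flux hΩ hΩb hε i j).mul_bdd (hbm _) (ae_of_all _ hC)
  have i3 : Integrable fun z => (ϱ z * f z i) * ξ z :=
    (h.integrable_force hΩ hΩb hε i).mul_bdd hξ.1.continuous.aestronglyMeasurable
      (ae_of_all _ hCξ)
  rw [integral_add (i1.fun_add i2) i3, integral_add i1 i2, ← hmom]
  have hu : ∀ k, unitVec i k = if k = i then 1 else 0 := fun k => by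
    simp [unitVec]
  congr 1
  · congr 1
    · rw [← setIntegral_eq_integral_of_forall_compl_eq_zero (s := cylinder Ω T)
        (fun z hz => by simp [h.density_zero z hz])]
      simp [timeDeriv, hd, hu, mul_assoc]
    · rw [← setIntegral_eq_integral_of_forall_compl_eq_zero (s := cylinder Ω T)
        (fun z hz => by
          simp [flux, h.density_zero z hz, h.stress_zero z hz, h.pressure_zero hz])]
      simp only [spaceDeriv, hd, PiLp.smul_apply, hu, smul_eq_mul, mul_ite, mul_one, mul_zero]
      congr 1
      ext z
      rw [Finset.sum_comm]
      simp [flux, pressure]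
  · rw [← setIntegral_eq_integral_of_forall_compl_eq_zero (s := cylinder Ω T)
      (fun z hz => by simp [h.density_zero z hz])]
    simp [hu, mul_assoc]

end

/-! ### The lower order terms of the two-point identity -/

/-- `L` bounds the cutoffs `lam⁶`, `lam⁴`, their first derivatives, and the increments of `lam`. -/
structure CutoffBound (lam : SpaceTime → ℝ) (L : ℝ) : Prop where
  one_le : 1 ≤ L
  six : ∀ z, |lam z ^ 6| ≤ L
  four : ∀ z, |lam z ^ 4| ≤ L
  time_six : ∀ z, |timeDeriv (fun z => lam z ^ 6) z| ≤ L
  time_four : ∀ z, |timeDeriv (fun z => lam z ^ 4) z| ≤ L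
  space_six : ∀ j z, |spaceDeriv j (fun z => lam z ^ 6) z| ≤ L
  space_four : ∀ j z, |spaceDeriv j (fun z => lam z ^ 4) z| ≤ L
  incr : ∀ x y t, |lam (x, t) ^ 6 * lam (y, t) ^ 4 - lam (x, t) ^ 5 * lam (y, t) ^ 5| ≤ L * ‖x - y‖

theorem isTestFunction_pow {U : Set SpaceTime} {lam : SpaceTime → ℝ} (h : IsTestFunction U lam)
    (n : ℕ) : IsTestFunction U (fun z => lam z ^ (n + 1)) := by
  have := isTestFunction_mul h (h.1.pow n)
  simpa only [pow_succ'] using this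

theorem CutoffBound.mono {lam : SpaceTime → ℝ} {L L' : ℝ} (h : CutoffBound lam L) (hL : L ≤ L') :
    CutoffBound lam L' :=
  ⟨h.1.trans hL, fun z => (h.2 z).trans hL, fun z => (h.3 z).trans hL, fun z => (h.4 z).trans hL,
    fun z => (h.5 z).trans hL, fun j z => (h.6 j z).trans hL, fun j z => (h.7 j z).trans hL,
    fun x y t => (h.8 x y t).trans (by gcongr)⟩

theorem exists_cutoffBound {U : Set SpaceTime} {lam : SpaceTime → ℝ} (h : IsTestFunction U lam) :
    ∃ L, CutoffBound lam L := by
  have h6 := isTestFunction_pow h 5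
  have h4 := isTestFunction_pow h 3
  have hb : ∀ {γ : SpaceTime → ℝ}, IsTestFunction U γ → ∀ v, ∃ C, ∀ z, |fderiv ℝ γ z v| ≤ C :=
    fun hγ v => (hγ.2.1.fderiv_apply ℝ v).exists_bound_of_continuous
      ((hγ.1.continuous_fderiv (by simp)).clm_apply continuous_const)
  obtain ⟨C0, hC0⟩ := h.2.1.exists_bound_of_continuous h.1.continuous
  obtain ⟨C1, hC1⟩ := h6.2.1.exists_bound_of_continuous h6.1.continuous
  obtain ⟨C2, hC2⟩ := h4.2.1.exists_bound_of_continuous h4.1.continuous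
  obtain ⟨C3, hC3⟩ := hb h6 (0, 1)
  obtain ⟨C4, hC4⟩ := hb h4 (0, 1)
  choose C5 hC5 using fun j => hb h6 (unitVec j, 0)
  choose C6 hC6 using fun j => hb h4 (unitVec j, 0)
  obtain ⟨K, hK⟩ := h.1.lipschitzWith_of_hasCompactSupport h.2.1 (by simp)
  have p0 := (norm_nonneg _).trans (hC0 0)
  have p1 := (norm_nonneg _).trans (hC1 0)
  have p2 := (norm_nonneg _).trans (hC2 0)
  have p3 := (abs_nonneg _).trans (hC3 0)
  have p4 := (abs_nonneg _).trans (hC4 0)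
  have p5 := fun j => (abs_nonneg _).trans (hC5 j 0)
  have p6 := fun j => (abs_nonneg _).trans (hC6 j 0)
  have s5 : ∀ j, C5 j ≤ ∑ j, C5 j := fun j =>
    Finset.single_le_sum (fun j _ => p5 j) (Finset.mem_univ j)
  have s6 : ∀ j, C6 j ≤ ∑ j, C6 j := fun j =>
    Finset.single_le_sum (fun j _ => p6 j) (Finset.mem_univ j)
  have t5 := (p5 0).trans (s5 0)
  have t6 := (p6 0).trans (s6 0)
  have p7 : 0 ≤ C0 ^ 9 * K := by positivity
  refine ⟨1 + C1 + C2 + C3 + C4 + (∑ j, C5 j) + (∑ j, C6 j) + C0 ^ 9 * K, by linarith,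
    fun z => ?_, fun z => ?_, fun z => ?_, fun z => ?_, fun j z => ?_, fun j z => ?_,
    fun x y t => ?_⟩
  · have := hC1 z; rw [Real.norm_eq_abs] at this; linarith
  · have := hC2 z; rw [Real.norm_eq_abs] at this; linarith
  · have := hC3 z; simp only [timeDeriv]; linarith
  · have := hC4 z; simp only [timeDeriv]; linarith
  · have := hC5 j z; simp only [spaceDeriv]; linarith [s5 j]
  · have := hC6 j z; simp only [spaceDeriv]; linarith [s6 j]
  · have hl : |lam (x, t) - lam (y, t)| ≤ K * ‖x - y‖ := by
      have := hK.dist_le_mul (x, t) (y, t)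
      simpa [Real.dist_eq, dist_eq_norm, Prod.norm_def] using this
    -- The two products differ by a multiple of λ(x) - λ(y), which is Lipschitz in x - y. This
    -- compensates the singularity 1/|x - y| of the kernel gradient.
    have e : lam (x, t) ^ 6 * lam (y, t) ^ 4 - lam (x, t) ^ 5 * lam (y, t) ^ 5 =
      lam (x, t) ^ 5 * lam (y, t) ^ 4 * (lam (x, t) - lam (y, t)) := by ring
    rw [e, abs_mul, abs_mul, abs_pow, abs_pow]
    calc _ ≤ C0 ^ 5 * C0 ^ 4 * (K * ‖x - y‖) := by
          gcongr
          · exact hC0 _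
          · exact hC0 _
      _ = C0 ^ 9 * K * ‖x - y‖ := by ring
      _ ≤ _ := by
          gcongr
          linarith

/-- Scalar form of the estimate, with d for |x - y| and γ for λ⁵(x)λ⁵(y). Three single terms cost
L³X each, and each of the three directions costs 5L³X, so the total is 18. -/
theorem abs_lower_order_le {L X b d α β γ A0 B0 mi F k : ℝ} {A B J T S D : Fin 3 → ℝ}
    (hL : 1 ≤ L) (hb : 0 ≤ b) (hd : 0 < d) (hX : 0 ≤ X)
    (hα : |α| ≤ L) (hβ : |β| ≤ L) (hA0 : |A0| ≤ L) (hB0 : |B0| ≤ L) (hA : ∀ j, |A j| ≤ L)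
    (hB : ∀ j, |B j| ≤ L) (hk : |k| ≤ 1) (hD : ∀ j, |D j| ≤ L / d) (hγ : |α * β - γ| ≤ L * d)
    (hmi : |mi| * b ≤ X) (hJ : ∀ j, |mi| * |J j| ≤ X) (hT : ∀ j, |T j| * b ≤ 2 * X)
    (hS : ∀ j, |S j| * b / d ≤ X) (hF : |F| * b ≤ L * X) :
    |mi * (A0 * (β * b * k) + α * ((B0 * b + ∑ j, B j * J j) * k - ∑ j, β * J j * D j))
      + (∑ j, T j * (A j * (β * b * k) + α * (β * b * D j))) + F * (α * (β * b * k))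
      - ∑ j, (α * β * b * (T j + S j) - γ * mi * J j) * D j| ≤ 18 * L ^ 3 * X := by
  have hL0 : 0 ≤ L := by linarith
  have e : mi * (A0 * (β * b * k) + α * ((B0 * b + ∑ j, B j * J j) * k - ∑ j, β * J j * D j))
      + (∑ j, T j * (A j * (β * b * k) + α * (β * b * D j))) + F * (α * (β * b * k))
      - ∑ j, (α * β * b * (T j + S j) - γ * mi * J j) * D j =
      mi * b * (A0 * β * k) + mi * b * (α * B0 * k) + F * b * (α * β * k) +
      ∑ j, (mi * J j * (α * B j * k) - mi * J j * ((α * β - γ) * D j) + T j * b * (A j * β * k)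
        - S j * b * (α * β * D j)) := by
    simp only [Fin.sum_univ_three]
    ring
  have hL23 : L ^ 2 ≤ L ^ 3 := by nlinarith [sq_nonneg L]
  have t1 : |mi * b * (A0 * β * k)| ≤ L ^ 3 * X := by
    rw [abs_mul, abs_mul mi, abs_of_nonneg hb, abs_mul, abs_mul]
    calc _ ≤ X * (L * L * 1) := by gcongr
      _ = L ^ 2 * X := by ring
      _ ≤ _ := by gcongr
  have t2 : |mi * b * (α * B0 * k)| ≤ L ^ 3 * X := by
    rw [abs_mul, abs_mul mi, abs_of_nonneg hb, abs_mul, abs_mul]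
    calc _ ≤ X * (L * L * 1) := by gcongr
      _ = L ^ 2 * X := by ring
      _ ≤ _ := by gcongr
  have t3 : |F * b * (α * β * k)| ≤ L ^ 3 * X := by
    rw [abs_mul, abs_mul F, abs_of_nonneg hb, abs_mul, abs_mul]
    calc _ ≤ (L * X) * (L * L * 1) := by gcongr
      _ = L ^ 3 * X := by ring
  have t4 : ∀ j, |mi * J j * (α * B j * k)| ≤ L ^ 3 * X := fun j => by
    rw [abs_mul, abs_mul mi, abs_mul, abs_mul]
    calc _ ≤ X * (L * L * 1) := by
          gcongr
          · exact hJ j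
          · exact hB j
      _ = L ^ 2 * X := by ring
      _ ≤ _ := by gcongr
  have t5 : ∀ j, |mi * J j * ((α * β - γ) * D j)| ≤ L ^ 3 * X := fun j => by
    rw [abs_mul, abs_mul mi, abs_mul]
    calc _ ≤ X * (L * d * (L / d)) := by
          gcongr
          · exact hJ j
          · exact hD j
      _ = L ^ 2 * X := by field_simp
      _ ≤ _ := by gcongr
  have t6 : ∀ j, |T j * b * (A j * β * k)| ≤ 2 * (L ^ 3 * X) := fun j => by
    rw [abs_mul, abs_mul (T j), abs_of_nonneg hb, abs_mul, abs_mul]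
    calc _ ≤ (2 * X) * (L * L * 1) := by
          refine mul_le_mul (hT j) ?_ (by positivity) (by positivity)
          gcongr
          exact hA j
      _ = 2 * (L ^ 2 * X) := by ring
      _ ≤ _ := by gcongr
  have t7 : ∀ j, |S j * b * (α * β * D j)| ≤ L ^ 3 * X := fun j => by
    rw [abs_mul, abs_mul (S j), abs_of_nonneg hb, abs_mul, abs_mul]
    calc _ ≤ |S j| * b * (L * L * (L / d)) := by
          gcongr
          exact hD j
      _ = L ^ 3 * (|S j| * b / d) := by ring
      _ ≤ _ := by
          gcongr
          exact hS j
  have t8 : ∀ j, |mi * J j * (α * B j * k) - mi * J j * ((α * β - γ) * D j)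
      + T j * b * (A j * β * k) - S j * b * (α * β * D j)| ≤ 5 * (L ^ 3 * X) := fun j => by
    refine (abs_sub _ _).trans ?_
    have h1 := abs_add_le (mi * J j * (α * B j * k) - mi * J j * ((α * β - γ) * D j))
      (T j * b * (A j * β * k))
    have h2 := abs_sub (mi * J j * (α * B j * k)) (mi * J j * ((α * β - γ) * D j))
    linarith [t4 j, t5 j, t6 j, t7 j]
  rw [e]
  refine (abs_add_le _ _).trans ?_
  have h1 := abs_add_three (mi * b * (A0 * β * k)) (mi * b * (α * B0 * k)) (F * b * (α * β * k))
  have h2 := Finset.abs_sum_le_sum_abs (fun j => mi * J j * (α * B j * k)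
    - mi * J j * ((α * β - γ) * D j) + T j * b * (A j * β * k) - S j * b * (α * β * D j))
    Finset.univ
  have h3 := Finset.sum_le_sum (s := Finset.univ) fun j _ => t8 j
  simp only [Finset.sum_const, Finset.card_univ, Fintype.card_fin, nsmul_eq_mul] at h3
  push_cast at h3
  linarith

section

variable {Ω : Set E3} {T ε m : ℝ} {E MS Mf : ℝ≥0}
  {S : SpaceTime → Matrix (Fin 3) (Fin 3) ℝ} {f : SpaceTime → E3}
  {ϱ : SpaceTime → ℝ} {u : SpaceTime → E3}

/-- The principal part of `twoPoint` for the `i`-th momentum equation. -/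
noncomputable def principal (lam : SpaceTime → ℝ) (ε m r s : ℝ) (ϱ : SpaceTime → ℝ)
    (u : SpaceTime → E3) (i : Fin 3) (w : SpaceTime × E3) : ℝ :=
  ∑ j, (lam w.1 ^ 6 * lam (other w) ^ 4 * ϱ (other w) *
      (ϱ w.1 * u w.1 i * u w.1 j + if i = j then pressure ε m ϱ w.1 else 0)
    - lam w.1 ^ 5 * lam (other w) ^ 5 * (ϱ w.1 * u w.1 i) * (ϱ (other w) * u (other w) j)) *
      partialDeriv j (kern r s i) (displ w)

/-- The integrand of the two-point identity for the `i`-th momentum equation. -/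
noncomputable def tested (lam : SpaceTime → ℝ) (ε m r s : ℝ)
    (S : SpaceTime → Matrix (Fin 3) (Fin 3) ℝ) (f : SpaceTime → E3)
    (ϱ : SpaceTime → ℝ) (u : SpaceTime → E3) (i : Fin 3) : SpaceTime × E3 → ℝ :=
  twoPoint ϱ (fun z => ϱ z * u z i) (fun z => ϱ z * f z i) (fun z => lam z ^ 6)
    (fun z => lam z ^ 4) (fun j z => ϱ z * u z j) (fun j => flux ε m S ϱ u i j) (kern r s i)

/-- A dominating function for the lower order terms. -/
noncomputable def remainder (Ω : Set E3) (T ε m s : ℝ)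
    (S : SpaceTime → Matrix (Fin 3) (Fin 3) ℝ) (ϱ : SpaceTime → ℝ) (u : SpaceTime → E3)
    (w : SpaceTime × E3) : ℝ :=
  if ‖displ w‖ < s then
    majorant Ω T ε m S ϱ u w.1 * ϱ (other w) + ϱ w.1 * majorant Ω T ε m S ϱ u (other w)
      + ϱ (other w) / ‖displ w‖ ^ 2
  else 0

/-- The difference consists of the terms with a derivative on a cutoff, the force, the stress, and
the error of replacing λ⁶(x)λ⁴(y) by λ⁵(x)λ⁵(y) in the cross term. In each of these except the
stress, the kernel enters as a bounded factor or with its singularity compensated. -/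
theorem IsNormalSolution.abs_tested_sub_principal_le {lam : SpaceTime → ℝ} {L M : ℝ}
    (h : IsNormalSolution Ω T ε m E MS Mf S f ϱ u) (hε : 0 < ε) (hL : CutoffBound lam L)
    (hLf : Mf ≤ L) (hM : ∀ q, |deriv cutoff q| ≤ M) (hLM : 2 + 2 * M ≤ L)
    {r s : ℝ} (hr : 0 < r) (hs : 0 < s) (i : Fin 3) {w : SpaceTime × E3} (hw : displ w ≠ 0) :
    |tested lam ε m r s S f ϱ u i w - principal lam ε m r s ϱ u i w| ≤
      18 * L ^ 3 * remainder Ω T ε m s S ϱ u w := by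
  by_cases hds : ‖displ w‖ < s
  swap
  · push Not at hds
    have h1 : ∀ j, partialDeriv j (kern r s i) (displ w) = 0 := fun j =>
      partialDeriv_kern_eq_zero hr hs i j hds
    rw [remainder, if_neg (not_lt.2 hds)]
    simp [tested, twoPoint, principal, h1, kern_eq_zero hs hds]
  have hd : 0 < ‖displ w‖ := norm_pos_iff.2 hw
  have a0 := h.density_nonneg w.1
  have b0 := h.density_nonneg (other w)
  have n0 := h.majorant_nonneg hε w.1
  have n0' := h.majorant_nonneg hε (other w)
  obtain ⟨a1, a2, -, a4, a5, a6⟩ := h.le_majorant hε w.1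
  obtain ⟨b1, b2, -, b4, b5, b6⟩ := h.le_majorant hε (other w)
  have aT := fun j => h.abs_flux_le hε i j w.1
  rw [remainder, if_pos hds]
  set a := ϱ w.1
  set b := ϱ (other w)
  set n := majorant Ω T ε m S ϱ u w.1
  set n' := majorant Ω T ε m S ϱ u (other w)
  set d := ‖displ w‖
  set U := ‖u w.1‖ with hU
  set V := ‖u (other w)‖ with hV
  have U0 : 0 ≤ U := norm_nonneg _
  have V0 : 0 ≤ V := norm_nonneg _
  have hUi : ∀ j, |u w.1 j| ≤ U := fun j => PiLp.norm_apply_le (u w.1) j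
  have hVi : ∀ j, |u (other w) j| ≤ V := fun j => PiLp.norm_apply_le (u (other w)) j
  have hnb : 0 ≤ n * b := by positivity
  have han : 0 ≤ a * n' := by positivity
  have hbd : 0 ≤ b / d ^ 2 := by positivity
  have hmi : |a * u w.1 i| ≤ n := by
    rw [abs_mul, abs_of_nonneg a0]
    have : a * |u w.1 i| ≤ a * U := by gcongr; exact hUi i
    nlinarith [mul_nonneg a0 (sq_nonneg (U - 1))]
  have hXdef : tested lam ε m r s S f ϱ u i w - principal lam ε m r s ϱ u i w =
    (a * u w.1 i) * (timeDeriv (fun z => lam z ^ 6) w.1 * (lam (other w) ^ 4 * b *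
        kern r s i (displ w)) + lam w.1 ^ 6 * ((timeDeriv (fun z => lam z ^ 4) (other w) * b +
        ∑ j, spaceDeriv j (fun z => lam z ^ 4) (other w) * (b * u (other w) j)) *
          kern r s i (displ w) - ∑ j, lam (other w) ^ 4 * (b * u (other w) j) *
            partialDeriv j (kern r s i) (displ w)))
      + (∑ j, flux ε m S ϱ u i j w.1 * (spaceDeriv j (fun z => lam z ^ 6) w.1 *
        (lam (other w) ^ 4 * b * kern r s i (displ w)) + lam w.1 ^ 6 * (lam (other w) ^ 4 * b *
          partialDeriv j (kern r s i) (displ w))))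
      + (a * f w.1 i) * (lam w.1 ^ 6 * (lam (other w) ^ 4 * b * kern r s i (displ w)))
      - ∑ j, (lam w.1 ^ 6 * lam (other w) ^ 4 * b * (flux ε m S ϱ u i j w.1 + S w.1 i j)
        - (lam w.1 ^ 5 * lam (other w) ^ 5) * (a * u w.1 i) * (b * u (other w) j)) *
          partialDeriv j (kern r s i) (displ w) := by
    simp only [tested, twoPoint, principal, flux, sub_add_cancel, a, b]
  rw [hXdef]
  refine abs_lower_order_le hL.one_le b0 hd (by positivity) (hL.six _) (hL.four _)
    (hL.time_six _) (hL.time_four _) (fun j => hL.space_six j _) (fun j => hL.space_four j _)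
    (norm_kern_le hr s i _) (fun j => ?_) (hL.incr w.1.1 w.2 w.1.2) ?_ (fun j => ?_) (fun j => ?_)
    (fun j => ?_) ?_
  · refine (norm_partialDeriv_kern_le hM hr hs i j hw).trans ?_
    gcongr
  · calc _ ≤ n * b := by gcongr
      _ ≤ _ := by linarith
  · rw [abs_mul, abs_mul, abs_of_nonneg a0, abs_of_nonneg b0]
    calc a * |u w.1 i| * (b * |u (other w) j|) ≤ a * U * (b * V) := by
          gcongr
          · exact hUi i
          · exact hVi j
      _ ≤ (a * U ^ 2) * b + a * (b * V ^ 2) := by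
          nlinarith [mul_nonneg (mul_nonneg a0 b0) (sq_nonneg (U - V)),
            mul_nonneg (mul_nonneg a0 b0) (sq_nonneg (U + V))]
      _ ≤ n * b + a * n' := by gcongr
      _ ≤ _ := by linarith
  · calc _ ≤ (2 * n) * b := by gcongr; exact aT j
      _ ≤ _ := by linarith
  -- The stress is only in L² and meets the full singularity 1/d. Young's inequality separates S²,
  -- which the majorant contains, from d^{-2}, which is integrable in three dimensions.
  · calc |S w.1 i j| * b / d ≤ S w.1 i j ^ 2 * b + b / d ^ 2 := by
          have e : S w.1 i j ^ 2 * b + b / d ^ 2 - |S w.1 i j| * b / d =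
              b * ((|S w.1 i j| - 1 / (2 * d)) ^ 2 + 3 / (4 * d ^ 2)) := by
            rw [← sq_abs (S w.1 i j)]
            field_simp
            ring
          have : 0 ≤ b * ((|S w.1 i j| - 1 / (2 * d)) ^ 2 + 3 / (4 * d ^ 2)) := by positivity
          linarith
      _ ≤ n * b + b / d ^ 2 := by gcongr; exact a4 i j
      _ ≤ _ := by linarith
  · have hf : |f w.1 i| ≤ L := ((PiLp.norm_apply_le (f w.1) i).trans (h.force_le _)).trans hLf
    rw [abs_mul, abs_of_nonneg a0]
    calc a * |f w.1 i| * b ≤ n * L * b := by gcongr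
      _ = L * (n * b) := by ring
      _ ≤ _ := by
        have := hL.one_le
        gcongr
        linarith

end

/-! ### The lower order terms integrate to O(s) -/

/-- In polar coordinates the weight |x - y|^{-2} cancels the Jacobian, leaving the length s of the
radial interval. -/
theorem lintegral_ball_inv_sq_le {s : ℝ} (hs : 0 < s) (x : E3) :
    ∫⁻ y in Metric.ball x s, ENNReal.ofReal (1 / ‖x - y‖ ^ 2) ≤
      3 * volume (Metric.ball (0 : E3) 1) * ENNReal.ofReal s := by
  let g : ℝ → ℝ := (Iio s).indicator fun y => 1 / y ^ 2
  have hg0 : ∀ y, 0 ≤ g y := fun y => indicator_nonneg (fun _ _ => by positivity) _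
  have hcongr : ∀ y ∈ Ioi (0 : ℝ), y ^ 2 • g y = (Ioo 0 s).indicator (fun _ => (1 : ℝ)) y := by
    intro y hy
    have hy' : y ≠ 0 := ne_of_gt hy
    have hy'' : 0 < y := hy
    by_cases h : y < s
    · simp [g, h, hy'', hy']
    · simp [g, h]
  have hio : IntegrableOn ((Ioo 0 s).indicator (fun _ => (1 : ℝ))) (Ioi 0) :=
    ((integrable_indicator_iff measurableSet_Ioo).2 (by simp)).integrableOn
  have hint : Integrable (fun h : E3 => g ‖h‖) := by
    rw [integrable_fun_norm_addHaar]
    simp only [finrank_euclideanSpace, Fintype.card_fin, Nat.reduceSub]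
    exact (integrableOn_congr_fun hcongr measurableSet_Ioi).2 hio
  have hval : ∫ h : E3, g ‖h‖ = 3 * (volume.real (Metric.ball (0 : E3) 1) * s) := by
    rw [integral_fun_norm_addHaar]
    simp only [finrank_euclideanSpace, Fintype.card_fin, Nat.reduceSub]
    rw [setIntegral_congr_fun measurableSet_Ioi hcongr, setIntegral_indicator measurableSet_Ioo,
      inter_eq_right.2 Ioo_subset_Ioi_self]
    simp [hs.le]
  have h1 : ∫⁻ y in Metric.ball x s, ENNReal.ofReal (1 / ‖x - y‖ ^ 2) =
      ∫⁻ y, ENNReal.ofReal (g ‖x - y‖) := by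
    rw [← lintegral_indicator measurableSet_ball]
    congr 1
    ext y
    by_cases h : y ∈ Metric.ball x s
    · have h' : ‖x - y‖ < s := by rwa [Metric.mem_ball, dist_comm, dist_eq_norm] at h
      simp [h, h', g]
    · have h' : ¬‖x - y‖ < s := by rwa [Metric.mem_ball, dist_comm, dist_eq_norm] at h
      simp only [indicator_of_notMem h, g]
      rw [indicator_of_notMem (by exact h')]
      simp
  rw [h1, lintegral_sub_left_eq_self (fun h => ENNReal.ofReal (g ‖h‖)) x,
    ← ofReal_integral_eq_lintegral_ofReal hint (ae_of_all _ fun h => hg0 _), hval,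
    ENNReal.ofReal_mul (by norm_num), ENNReal.ofReal_mul (by positivity),
    ofReal_measureReal measure_ball_lt_top.ne, ENNReal.ofReal_ofNat, mul_assoc]

/-- Exchange of the two points of a pair. -/
def swapPair (w : SpaceTime × E3) : SpaceTime × E3 := (other w, w.1.1)

theorem other_swapPair (w : SpaceTime × E3) : other (swapPair w) = w.1 := rfl

theorem displ_swapPair (w : SpaceTime × E3) : displ (swapPair w) = -displ w := by
  simp [displ, swapPair, other]

theorem measurePreserving_swapPair : MeasurePreserving swapPair := by
  have h1 : MeasurePreserving (fun w : SpaceTime × E3 => (w.1.1, (w.1.2, w.2))) :=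
    measurePreserving_prodAssoc volume volume volume
  have h2 : MeasurePreserving (fun w : E3 × (ℝ × E3) => (w.2, w.1)) :=
    Measure.measurePreserving_swap
  have h3 : MeasurePreserving (fun w : (ℝ × E3) => (w.2, w.1)) :=
    Measure.measurePreserving_swap
  have h4 : MeasurePreserving (fun w : (ℝ × E3) × E3 => ((w.1.2, w.1.1), w.2)) :=
    h3.prod (MeasurePreserving.id volume)
  exact h4.comp (h2.comp h1)

theorem lintegral_swapPair (F : SpaceTime × E3 → ℝ≥0∞) (hF : Measurable F) :
    ∫⁻ w, F (swapPair w) = ∫⁻ w, F w :=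
  measurePreserving_swapPair.lintegral_comp hF

theorem swapPair_swapPair (w : SpaceTime × E3) : swapPair (swapPair w) = w := rfl

theorem measurableEmbedding_swapPair : MeasurableEmbedding swapPair :=
  (MeasurableEquiv.mk ⟨swapPair, swapPair, swapPair_swapPair, swapPair_swapPair⟩
    measurePreserving_swapPair.measurable measurePreserving_swapPair.measurable).measurableEmbedding

theorem lintegral_pair_ball {F : SpaceTime × E3 → ℝ≥0∞} (hF : Measurable F) (s : ℝ) :
    ∫⁻ w, (if ‖displ w‖ < s then F w else 0) =
      ∫⁻ z : SpaceTime, ∫⁻ y in Metric.ball z.1 s, F (z, y) := by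
  have hm : Measurable fun w : SpaceTime × E3 => if ‖displ w‖ < s then F w else 0 :=
    Measurable.ite (measurableSet_lt measurable_displ.norm measurable_const) hF measurable_const
  rw [Measure.volume_eq_prod, lintegral_prod _ hm.aemeasurable]
  congr 1
  ext z
  rw [← lintegral_indicator measurableSet_ball]
  congr 1
  ext y
  by_cases h : ‖z.1 - y‖ < s
  · simp [displ, indicator, Metric.mem_ball, dist_comm y, dist_eq_norm, h]
  · simp [displ, indicator, Metric.mem_ball, dist_comm y, dist_eq_norm, h]

theorem ae_displ_ne_zero : ∀ᵐ w : SpaceTime × E3, displ w ≠ 0 := by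
  have hs : MeasurableSet {w : SpaceTime × E3 | displ w ≠ 0} :=
    (measurableSet_eq_fun measurable_displ measurable_const).compl
  rw [Measure.volume_eq_prod, Measure.ae_prod_iff_ae_ae hs]
  refine ae_of_all _ fun z => ?_
  have h : ∀ᵐ y : E3, y ∈ ({z.1} : Set E3)ᶜ := compl_mem_ae_iff.2 (by simp)
  filter_upwards [h] with y hy
  simp only [displ, ne_eq, sub_eq_zero]
  exact fun h => hy (by simp [h])

section

variable {Ω : Set E3} {T ε m : ℝ} {E MS Mf : ℝ≥0}
  {S : SpaceTime → Matrix (Fin 3) (Fin 3) ℝ} {f : SpaceTime → E3}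
  {ϱ : SpaceTime → ℝ} {u : SpaceTime → E3}

/-- The constant in the bound for the mass of a ball. -/
noncomputable def ballConst (E : ℝ≥0) : ℝ≥0∞ :=
  (E : ℝ≥0∞) ^ (2 / 3 : ℝ) * volume (Metric.ball (0 : E3) 1) ^ (1 / 3 : ℝ)

theorem ballConst_lt_top (E : ℝ≥0) : ballConst E < ⊤ :=
  ENNReal.mul_lt_top (ENNReal.rpow_lt_top_of_nonneg (by norm_num) (by simp))
    (ENNReal.rpow_lt_top_of_nonneg (by norm_num) measure_ball_lt_top.ne)

theorem IsNormalSolution.ofReal_rpow_le_pressure (h : IsNormalSolution Ω T ε m E MS Mf S f ϱ u)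
    (hε : 0 < ε) (z : SpaceTime) :
    ENNReal.ofReal (ϱ z) ^ (3 / 2 : ℝ) ≤ ENNReal.ofReal (pressure ε m ϱ z) := by
  rw [ENNReal.ofReal_rpow_of_nonneg (h.density_nonneg z) (by norm_num)]
  exact ENNReal.ofReal_le_ofReal (h.rpow_le_pressure hε z)

/-- By Hölder, the L^{3/2} bound of the density against a ball of volume of order s³ gives s^{3·1/3}
= s. This linear bound makes Γ bounded and the remainder O(s). -/
theorem IsNormalSolution.lintegral_ball_le (h : IsNormalSolution Ω T ε m E MS Mf S f ϱ u)
    (hε : 0 < ε) {s : ℝ} (hs : 0 < s) (x : E3) (t : ℝ) :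
    ∫⁻ y in Metric.ball x s, ENNReal.ofReal (ϱ (y, t)) ≤ ballConst E * ENNReal.ofReal s := by
  have hϱ := h.density_meas
  have h1 := lintegral_mul_le_three_halves (μ := volume.restrict (Metric.ball x s))
    (R := fun y => ENNReal.ofReal (ϱ (y, t))) (p := fun y => ENNReal.ofReal (pressure ε m ϱ (y, t)))
    (by fun_prop) (fun y => h.ofReal_rpow_le_pressure hε (y, t)) (f := fun _ => 1) measurable_const
  simp only [mul_one, one_pow, lintegral_const, Measure.restrict_apply_univ, one_mul] at h1
  refine h1.trans ?_
  rw [volume_ball_eq _ hs.le, ENNReal.mul_rpow_of_nonneg _ _ (by norm_num),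
    ← ENNReal.rpow_natCast, ← ENNReal.rpow_mul, show ((3 : ℕ) : ℝ) * (1 / 3) = 1 by norm_num,
    ENNReal.rpow_one, ballConst]
  calc _ ≤ (E : ℝ≥0∞) ^ (2 / 3 : ℝ) * (ENNReal.ofReal s *
      volume (Metric.ball (0 : E3) 1) ^ (1 / 3 : ℝ)) := by
        gcongr
        exact (setLIntegral_le_lintegral _ _).trans (h.pressure_le t)
    _ = _ := by ring

/-- The constant in the bound for the lower order terms. -/
noncomputable def remainderConst (Ω : Set E3) (T : ℝ) (E MS : ℝ≥0) : ℝ≥0∞ :=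
  majorantBound Ω T E MS * (2 * ballConst E + 3 * volume (Metric.ball (0 : E3) 1))

theorem remainderConst_lt_top (hΩb : Bornology.IsBounded Ω) : remainderConst Ω T E MS < ⊤ := by
  refine ENNReal.mul_lt_top (majorantBound_lt_top hΩb) (ENNReal.add_lt_top.2 ⟨?_, ?_⟩)
  · exact ENNReal.mul_lt_top (by simp) (ballConst_lt_top E)
  · exact ENNReal.mul_lt_top (by simp) measure_ball_lt_top

theorem IsNormalSolution.lintegral_majorant_pair_le
    (h : IsNormalSolution Ω T ε m E MS Mf S f ϱ u) (hΩ : IsOpen Ω) (hε : 0 < ε) {s : ℝ}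
    (hs : 0 < s) :
    ∫⁻ w, (if ‖displ w‖ < s then ENNReal.ofReal (majorant Ω T ε m S ϱ u w.1) *
        ENNReal.ofReal (ϱ (other w)) else 0) ≤
      majorantBound Ω T E MS * (ballConst E * ENNReal.ofReal s) := by
  have m1 := h.density_meas
  have m2 := h.measurable_majorant hΩ
  have m3 := measurable_other
  rw [lintegral_pair_ball (F := fun w => ENNReal.ofReal (majorant Ω T ε m S ϱ u w.1) *
        ENNReal.ofReal (ϱ (other w))) (by fun_prop)]
  calc _ ≤ ∫⁻ z, ENNReal.ofReal (majorant Ω T ε m S ϱ u z) * (ballConst E * ENNReal.ofReal s) := by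
        refine lintegral_mono fun z => ?_
        simp only [other]
        rw [lintegral_const_mul _ (by fun_prop)]
        gcongr
        exact h.lintegral_ball_le hε hs z.1 z.2
    _ ≤ _ := by
        rw [lintegral_mul_const _ (by fun_prop)]
        gcongr
        exact h.lintegral_majorant_le hΩ hε

theorem IsNormalSolution.lintegral_majorant_pair_swap_le
    (h : IsNormalSolution Ω T ε m E MS Mf S f ϱ u) (hΩ : IsOpen Ω) (hε : 0 < ε) {s : ℝ}
    (hs : 0 < s) :
    ∫⁻ w, (if ‖displ w‖ < s then ENNReal.ofReal (ϱ w.1) *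
        ENNReal.ofReal (majorant Ω T ε m S ϱ u (other w)) else 0) ≤
      majorantBound Ω T E MS * (ballConst E * ENNReal.ofReal s) := by
  have m1 := h.density_meas
  have m2 := h.measurable_majorant hΩ
  have m3 := measurable_other
  refine le_trans (le_of_eq ?_) (h.lintegral_majorant_pair_le hΩ hε hs)
  rw [← lintegral_swapPair]
  · simp only [displ_swapPair, norm_neg, other_swapPair, mul_comm]
    rfl
  · exact Measurable.ite (measurableSet_lt measurable_displ.norm measurable_const)
      (by fun_prop) measurable_const

/-- The integral over the point that carries the bare density, or the singular weight, is O(s) by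
the ball estimates. The other point carries a function whose integral is at most that of the
majorant. Exchanging the points reduces the terms to these cases. -/
theorem IsNormalSolution.lintegral_remainder_le
    (h : IsNormalSolution Ω T ε m E MS Mf S f ϱ u) (hΩ : IsOpen Ω) (hε : 0 < ε) {s : ℝ}
    (hs : 0 < s) :
    ∫⁻ w, ENNReal.ofReal (remainder Ω T ε m s S ϱ u w) ≤
      remainderConst Ω T E MS * ENNReal.ofReal s := by
  have m1 := h.density_meas
  have m2 := h.measurable_majorant hΩ
  have m3 := measurable_other
  have m4 := measurable_displ
  have ms : MeasurableSet {w : SpaceTime × E3 | ‖displ w‖ < s} :=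
    measurableSet_lt measurable_displ.norm measurable_const
  have e : ∀ w, ENNReal.ofReal (remainder Ω T ε m s S ϱ u w) =
      (if ‖displ w‖ < s then ENNReal.ofReal (majorant Ω T ε m S ϱ u w.1) *
        ENNReal.ofReal (ϱ (other w)) else 0) +
      (if ‖displ w‖ < s then ENNReal.ofReal (ϱ w.1) *
        ENNReal.ofReal (majorant Ω T ε m S ϱ u (other w)) else 0) +
      (if ‖displ w‖ < s then ENNReal.ofReal (ϱ (other w)) *
        ENNReal.ofReal (1 / ‖displ w‖ ^ 2) else 0) := by
    intro w
    have a0 := h.density_nonneg w.1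
    have b0 := h.density_nonneg (other w)
    have n0 := h.majorant_nonneg hε w.1
    have n0' := h.majorant_nonneg hε (other w)
    unfold remainder
    split_ifs
    · rw [ENNReal.ofReal_add (by positivity) (by positivity),
        ENNReal.ofReal_add (by positivity) (by positivity), ENNReal.ofReal_mul n0,
        ENNReal.ofReal_mul a0, div_eq_mul_one_div, ENNReal.ofReal_mul b0]
    · simp
  simp only [e]
  have mm1 : Measurable fun w : SpaceTime × E3 => (if ‖displ w‖ < s then
      ENNReal.ofReal (majorant Ω T ε m S ϱ u w.1) * ENNReal.ofReal (ϱ (other w)) else 0) :=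
    Measurable.ite ms (by fun_prop) measurable_const
  have mm2 : Measurable fun w : SpaceTime × E3 => (if ‖displ w‖ < s then ENNReal.ofReal (ϱ w.1) *
        ENNReal.ofReal (majorant Ω T ε m S ϱ u (other w)) else 0) :=
    Measurable.ite ms (by fun_prop) measurable_const
  have mm3 : Measurable fun w : SpaceTime × E3 => (if ‖displ w‖ < s then
      ENNReal.ofReal (ϱ (other w)) * ENNReal.ofReal (1 / ‖displ w‖ ^ 2) else 0) :=
    Measurable.ite ms (by fun_prop) measurable_const
  have h3 : ∫⁻ w, (if ‖displ w‖ < s then ENNReal.ofReal (ϱ (other w)) *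
        ENNReal.ofReal (1 / ‖displ w‖ ^ 2) else 0) ≤
      majorantBound Ω T E MS * (3 * volume (Metric.ball (0 : E3) 1) * ENNReal.ofReal s) := by
    rw [← lintegral_swapPair _ mm3]
    simp only [displ_swapPair, norm_neg, other_swapPair]
    rw [lintegral_pair_ball (F := fun w => ENNReal.ofReal (ϱ w.1) *
      ENNReal.ofReal (1 / ‖displ w‖ ^ 2)) (by fun_prop)]
    calc _ ≤ ∫⁻ z, ENNReal.ofReal (majorant Ω T ε m S ϱ u z) *
          (3 * volume (Metric.ball (0 : E3) 1) * ENNReal.ofReal s) := by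
          refine lintegral_mono fun z => ?_
          simp only [displ]
          rw [lintegral_const_mul _ (by fun_prop)]
          gcongr
          · exact (h.le_majorant hε z).1
          · exact lintegral_ball_inv_sq_le hs z.1
      _ ≤ _ := by
          rw [lintegral_mul_const _ (by fun_prop)]
          gcongr
          exact h.lintegral_majorant_le hΩ hε
  rw [lintegral_add_left (mm1.fun_add mm2), lintegral_add_left mm1]
  calc _ ≤ majorantBound Ω T E MS * (ballConst E * ENNReal.ofReal s) +
        majorantBound Ω T E MS * (ballConst E * ENNReal.ofReal s) +
        majorantBound Ω T E MS * (3 * volume (Metric.ball (0 : E3) 1) * ENNReal.ofReal s) := by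
        gcongr
        · exact h.lintegral_majorant_pair_le hΩ hε hs
        · exact h.lintegral_majorant_pair_swap_le hΩ hε hs
    _ = _ := by rw [remainderConst]; ring

theorem IsNormalSolution.measurable_remainder
    (h : IsNormalSolution Ω T ε m E MS Mf S f ϱ u) (hΩ : IsOpen Ω) (s : ℝ) :
    Measurable (remainder Ω T ε m s S ϱ u) := by
  have m1 := h.density_meas
  have m2 := h.measurable_majorant hΩ
  have m3 := measurable_other
  have m4 := measurable_displ
  exact Measurable.ite (measurableSet_lt measurable_displ.norm measurable_const)
    (by fun_prop) measurable_const

theorem IsNormalSolution.remainder_nonneg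
    (h : IsNormalSolution Ω T ε m E MS Mf S f ϱ u) (hε : 0 < ε) (s : ℝ) (w : SpaceTime × E3) :
    0 ≤ remainder Ω T ε m s S ϱ u w := by
  have a0 := h.density_nonneg w.1
  have b0 := h.density_nonneg (other w)
  have n0 := h.majorant_nonneg hε w.1
  have n0' := h.majorant_nonneg hε (other w)
  unfold remainder
  split_ifs <;> positivity

theorem IsNormalSolution.integrable_remainder
    (h : IsNormalSolution Ω T ε m E MS Mf S f ϱ u) (hΩ : IsOpen Ω)
    (hΩb : Bornology.IsBounded Ω) (hε : 0 < ε) {s : ℝ} (hs : 0 < s) :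
    Integrable (remainder Ω T ε m s S ϱ u) := by
  refine ⟨(h.measurable_remainder hΩ s).aestronglyMeasurable, ?_⟩
  rw [hasFiniteIntegral_iff_ofReal (ae_of_all _ (h.remainder_nonneg hε s))]
  exact (h.lintegral_remainder_le hΩ hε hs).trans_lt
    (ENNReal.mul_lt_top (remainderConst_lt_top hΩb) (by simp))

end

/-! ### The symmetrized principal part -/

section

variable {Ω : Set E3} {T ε m : ℝ} {E MS Mf : ℝ≥0}
  {S : SpaceTime → Matrix (Fin 3) (Fin 3) ℝ} {f : SpaceTime → E3}
  {ϱ : SpaceTime → ℝ} {u : SpaceTime → E3} {lam : SpaceTime → ℝ}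

/-- The density `ρ(x,t) ρ(y,t)` of a pair of points. -/
def pairDensity (lam ϱ : SpaceTime → ℝ) (w : SpaceTime × E3) : ℝ :=
  locDensity lam ϱ w.1 * locDensity lam ϱ (other w)

/-- `ρ(x,t) ρ(y,t) E^∥(x,y,t)` -/
noncomputable def longEnergy (lam : SpaceTime → ℝ) (ε m : ℝ) (ϱ : SpaceTime → ℝ)
    (u : SpaceTime → E3) (w : SpaceTime × E3) : ℝ :=
  pairDensity lam ϱ w * energyPar lam ε m ϱ u w.1.1 w.2 w.1.2

/-- `ρ(x,t) ρ(y,t) E^⊥(x,y,t)` -/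
noncomputable def perpEnergy (lam : SpaceTime → ℝ) (ε m : ℝ) (ϱ : SpaceTime → ℝ)
    (u : SpaceTime → E3) (w : SpaceTime × E3) : ℝ :=
  pairDensity lam ϱ w * energyPerp lam ε m ϱ u w.1.1 w.2 w.1.2

/-- The symmetrized principal part of the two-point identity. -/
noncomputable def mainPart (lam : SpaceTime → ℝ) (ε m r s : ℝ) (ϱ : SpaceTime → ℝ)
    (u : SpaceTime → E3) (w : SpaceTime × E3) : ℝ :=
  profile r s (‖displ w‖ ^ 2) * perpEnergy lam ε m ϱ u w +
    longCoeff r s (‖displ w‖ ^ 2) * longEnergy lam ε m ϱ u w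

/-- The pressure contribution to the principal part. -/
noncomputable def pressurePart (lam : SpaceTime → ℝ) (ε m r s : ℝ) (ϱ : SpaceTime → ℝ)
    (w : SpaceTime × E3) : ℝ :=
  lam w.1 ^ 6 * pressure ε m ϱ w.1 *
    (locDensity lam ϱ (other w) * ∑ i, partialDeriv i (kern r s i) (displ w))

/-- Since ρ = λ⁴ϱ, the power ρ^{3/2} carries λ⁶. This dictates the cutoffs λ⁶ at x and λ⁴ at y in
the test function. -/
theorem locDensity_mul_rpow (z : SpaceTime) (h : 0 ≤ ϱ z) :
    locDensity lam ϱ z * (locDensity lam ϱ z ^ (1 / 2 : ℝ) * pressureFactor ε m (ϱ z)) =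
      lam z ^ 6 * pressure ε m ϱ z := by
  have e : (lam z ^ 4) ^ (1 / 2 : ℝ) = lam z ^ 2 := by
    rw [show lam z ^ 4 = (lam z ^ 2) ^ 2 by ring, ← Real.sqrt_eq_rpow, Real.sqrt_sq (sq_nonneg _)]
  have e2 : ϱ z ^ (3 / 2 : ℝ) = ϱ z * ϱ z ^ (1 / 2 : ℝ) := by
    rw [show (3 / 2 : ℝ) = 1 + 1 / 2 by norm_num, Real.rpow_add_of_nonneg h (by norm_num)
      (by norm_num), Real.rpow_one]
  rw [locDensity, Real.mul_rpow (by positivity) h, e, pressure, e2]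
  ring

/-- The cutoffs factor through the localized fields because λ⁶ϱ u⊗u = ρ v⊗v and λ⁵ϱu = ρv. The
replacement of λ⁶λ⁴ by λ⁵λ⁵ in the cross term was made for this. -/
theorem principal_sub_pressurePart (r s : ℝ) (w : SpaceTime × E3) :
    ∑ i, principal lam ε m r s ϱ u i w - pressurePart lam ε m r s ϱ w =
      pairDensity lam ϱ w * ∑ i, ∑ j, (locVelocity lam u w.1 i * locVelocity lam u w.1 j -
        locVelocity lam u w.1 i * locVelocity lam u (other w) j) *
          partialDeriv j (kern r s i) (displ w) := by
  simp only [principal, pressurePart, pairDensity, locDensity, locVelocity, PiLp.smul_apply,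
    smul_eq_mul, Fin.sum_univ_three]
  simp
  ring

/-- The kernel gradient is even, so adding the version with x and y exchanged turns v_i(x)v_j(x) -
v_i(x)v_j(y) into (v_i(x) - v_i(y))(v_j(x) - v_j(y)). The pressure is left unsymmetrized, which is
why E^∥ and E^⊥ contain the density at x only. -/
theorem mainPart_eq {r : ℝ} (hr : 0 < r) (s : ℝ) (h0 : ∀ z, 0 ≤ ϱ z) (w : SpaceTime × E3) :
    mainPart lam ε m r s ϱ u w =
      1 / 2 * (∑ i, principal lam ε m r s ϱ u i w - pressurePart lam ε m r s ϱ w)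
      + 1 / 2 * (∑ i, principal lam ε m r s ϱ u i (swapPair w)
          - pressurePart lam ε m r s ϱ (swapPair w))
      + pressurePart lam ε m r s ϱ w := by
  have h1 := sum_partialDeriv_kern_mul hr s (displ w)
    (locVelocity lam u w.1 - locVelocity lam u (other w))
  have h2 := sum_partialDeriv_kern hr s (displ w)
  have h3 := locDensity_mul_rpow (lam := lam) (ε := ε) (m := m) w.1 (h0 w.1)
  have e1 : pairDensity lam ϱ (swapPair w) = pairDensity lam ϱ w := mul_comm _ _
  have e2 : (swapPair w).1 = other w := rfl
  have e3 : other (swapPair w) = w.1 := rfl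
  rw [principal_sub_pressurePart, principal_sub_pressurePart, e1, e2, e3, displ_swapPair]
  simp only [partialDeriv_kern_neg hr]
  have h4 : ∑ i, ∑ j, (locVelocity lam u w.1 i * locVelocity lam u w.1 j -
        locVelocity lam u w.1 i * locVelocity lam u (other w) j) *
          partialDeriv j (kern r s i) (displ w) +
      ∑ i, ∑ j, (locVelocity lam u (other w) i * locVelocity lam u (other w) j -
        locVelocity lam u (other w) i * locVelocity lam u w.1 j) *
          partialDeriv j (kern r s i) (displ w) =
      ∑ i, ∑ j, (locVelocity lam u w.1 - locVelocity lam u (other w)) i *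
        (locVelocity lam u w.1 - locVelocity lam u (other w)) j *
          partialDeriv j (kern r s i) (displ w) := by
    simp only [← Finset.sum_add_distrib, PiLp.sub_apply]
    refine Finset.sum_congr rfl fun i _ => Finset.sum_congr rfl fun j _ => ?_
    ring
  have h5 : 1 / 2 * (pairDensity lam ϱ w * ∑ i, ∑ j,
        (locVelocity lam u w.1 i * locVelocity lam u w.1 j -
        locVelocity lam u w.1 i * locVelocity lam u (other w) j) *
          partialDeriv j (kern r s i) (displ w)) +
      1 / 2 * (pairDensity lam ϱ w * ∑ i, ∑ j,
        (locVelocity lam u (other w) i * locVelocity lam u (other w) j -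
        locVelocity lam u (other w) i * locVelocity lam u w.1 j) *
          partialDeriv j (kern r s i) (displ w)) =
      1 / 2 * pairDensity lam ϱ w * (profile r s (‖displ w‖ ^ 2) *
        ‖projPerp (displ w) (locVelocity lam u w.1 - locVelocity lam u (other w))‖ ^ 2 +
        longCoeff r s (‖displ w‖ ^ 2) *
        ‖projPar (displ w) (locVelocity lam u w.1 - locVelocity lam u (other w))‖ ^ 2) := by
    rw [← h1, ← h4]
    ring
  rw [h5, pressurePart, ← h3, h2]
  simp only [mainPart, perpEnergy, longEnergy, energyPar, energyPerp, pairDensity, displ, other]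
  ring

theorem IsNormalSolution.measurable_locDensity (h : IsNormalSolution Ω T ε m E MS Mf S f ϱ u)
    (hlam : IsTestFunction (cylinder Ω T) lam) : Measurable (locDensity lam ϱ) := by
  have h1 := h.density_meas
  have h2 := hlam.1.continuous.measurable
  unfold locDensity
  fun_prop

theorem IsNormalSolution.measurable_locVelocity (h : IsNormalSolution Ω T ε m E MS Mf S f ϱ u)
    (hlam : IsTestFunction (cylinder Ω T) lam) : Measurable (locVelocity lam u) := by
  have h1 := h.velocity_meas
  have h2 := hlam.1.continuous.measurable
  unfold locVelocity
  fun_prop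

theorem IsNormalSolution.locDensity_nonneg (h : IsNormalSolution Ω T ε m E MS Mf S f ϱ u)
    (z : SpaceTime) : 0 ≤ locDensity lam ϱ z :=
  mul_nonneg (by positivity) (h.density_nonneg z)

theorem IsNormalSolution.measurable_principal (h : IsNormalSolution Ω T ε m E MS Mf S f ϱ u)
    (hlam : IsTestFunction (cylinder Ω T) lam) {r : ℝ} (hr : 0 < r) (s : ℝ) (i : Fin 3) :
    Measurable (principal lam ε m r s ϱ u i) := by
  have h1 := h.density_meas
  have h2 := h.velocity_meas
  have h3 := hlam.1.continuous.measurable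
  have h4 := h.measurable_pressure
  have h5 := measurable_other
  have h6 := measurable_displ
  have h7 : ∀ j, Measurable (partialDeriv j (kern r s i)) := fun j =>
    (continuous_partialDeriv (contDiff_kern hr s i) j).measurable
  unfold principal
  refine Finset.measurable_sum _ fun j _ => ?_
  split_ifs <;> fun_prop

/-- The tested integrand has integral zero, so the principal part integrates to minus the integral
of the difference, which the remainder dominates. -/
theorem IsNormalSolution.integrable_principal (h : IsNormalSolution Ω T ε m E MS Mf S f ϱ u)
    (hΩ : IsOpen Ω) (hΩb : Bornology.IsBounded Ω) (hε : 0 < ε)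
    (hlam : IsTestFunction (cylinder Ω T) lam) {L M : ℝ} (hL : CutoffBound lam L)
    (hLf : Mf ≤ L) (hM : ∀ q, |deriv cutoff q| ≤ M) (hLM : 2 + 2 * M ≤ L)
    {r s : ℝ} (hr : 0 < r) (hs : 0 < s) (i : Fin 3) :
    Integrable (principal lam ε m r s ϱ u i) ∧
      |∫ w, principal lam ε m r s ϱ u i w| ≤ 18 * L ^ 3 * ∫ w, remainder Ω T ε m s S ϱ u w := by
  obtain ⟨hti, ht0⟩ := integral_twoPoint (h.sliceBounded_density hΩ hΩb hε)
    (fun j => h.sliceBounded_momentum hΩ hΩb hε j) (h.sliceBounded_momentum hΩ hΩb hε i).integrable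
    (fun j => h.integrable_flux hΩ hΩb hε i j) (h.integrable_force hΩ hΩb hε i)
    (fun ψ hψ => h.mass_eq hψ) (fun ξ hξ => h.momentum_eq hΩ hΩb hε i hξ)
    (isTestFunction_pow hlam 5) (isTestFunction_pow hlam 3)
    (contDiff_kern hr s i) (hasCompactSupport_kern r hs i)
  have hrem := (h.integrable_remainder hΩ hΩb hε hs).const_mul (18 * L ^ 3)
  have hbd : ∀ᵐ w, |tested lam ε m r s S f ϱ u i w - principal lam ε m r s ϱ u i w| ≤
      18 * L ^ 3 * remainder Ω T ε m s S ϱ u w := by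
    filter_upwards [ae_displ_ne_zero] with w hw
    exact h.abs_tested_sub_principal_le hε hL hLf hM hLM hr hs i hw
  have hti' : Integrable (tested lam ε m r s S f ϱ u i) := hti
  have ht0' : ∫ w, tested lam ε m r s S f ϱ u i w = 0 := ht0
  have hd : Integrable fun w => tested lam ε m r s S f ϱ u i w - principal lam ε m r s ϱ u i w :=
    hrem.mono' (hti'.aestronglyMeasurable.sub
      (h.measurable_principal hlam hr s i).aestronglyMeasurable) hbd
  have hp : Integrable (principal lam ε m r s ϱ u i) :=
    (hti'.sub hd).congr (ae_of_all _ fun w => by simp)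
  refine ⟨hp, ?_⟩
  have e : ∫ w, principal lam ε m r s ϱ u i w =
      -∫ w, (tested lam ε m r s S f ϱ u i w - principal lam ε m r s ϱ u i w) := by
    rw [integral_sub hti' hp, ht0']
    ring
  rw [e, abs_neg, ← integral_const_mul]
  exact (abs_integral_le_integral_abs).trans (integral_mono_ae hd.abs hrem hbd)

theorem IsNormalSolution.integrable_pressurePart (h : IsNormalSolution Ω T ε m E MS Mf S f ϱ u)
    (hΩ : IsOpen Ω) (hΩb : Bornology.IsBounded Ω) (hε : 0 < ε)
    (hlam : IsTestFunction (cylinder Ω T) lam) {L : ℝ} (hL : CutoffBound lam L)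
    {r s : ℝ} (hr : 0 < r) (hs : 0 < s) :
    Integrable (pressurePart lam ε m r s ϱ) := by
  have h3 := hlam.1.continuous.measurable
  have h4 := h.measurable_pressure
  have hA : Integrable fun z => lam z ^ 6 * pressure ε m ϱ z :=
    h.integrable_of_le hΩ hΩb hε (by fun_prop) (C := L) fun z => by
      rw [abs_mul, abs_of_nonneg (h.pressure_nonneg hε z)]
      gcongr
      · exact h.pressure_nonneg hε z
      · exact zero_le_one.trans hL.one_le
      · exact hL.six z
      · exact (h.le_majorant hε z).2.2.1
  have hB : SliceBounded (locDensity lam ϱ) :=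
    (h.sliceBounded_density hΩ hΩb hε).bdd_mul (g := fun z => lam z ^ 4) (by fun_prop) hL.four
  obtain ⟨C, hC⟩ := hB.bound
  have hkc : Continuous fun x => ∑ i, partialDeriv i (kern r s i) x :=
    continuous_finsetSum _ fun i _ => continuous_partialDeriv (contDiff_kern hr s i) i
  have hks : HasCompactSupport fun x => ∑ i, partialDeriv i (kern r s i) x := by
    refine HasCompactSupport.intro (isCompact_closedBall (0 : E3) s) fun x hx => ?_
    simp only [Metric.mem_closedBall, dist_zero_right, not_le] at hx
    exact Finset.sum_eq_zero fun i _ => partialDeriv_kern_eq_zero hr hs i i hx.le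
  obtain ⟨M, hM⟩ := hks.exists_bound_of_continuous hkc
  exact (integral_pair_eq (M := M.toNNReal) hA hB.meas hC hkc.measurable
    fun x => (hM x).trans (Real.le_coe_toNNReal M)).1

/-- The exchange of points preserves the measure. The pressure parts then cancel in the integral,
and the sum of the three principal parts remains, whence 54 = 3 · 18. -/
theorem IsNormalSolution.integral_mainPart_le (h : IsNormalSolution Ω T ε m E MS Mf S f ϱ u)
    (hΩ : IsOpen Ω) (hΩb : Bornology.IsBounded Ω) (hε : 0 < ε)
    (hlam : IsTestFunction (cylinder Ω T) lam) {L M : ℝ} (hL : CutoffBound lam L)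
    (hLf : Mf ≤ L) (hM : ∀ q, |deriv cutoff q| ≤ M) (hLM : 2 + 2 * M ≤ L)
    {r s : ℝ} (hr : 0 < r) (hs : 0 < s) :
    Integrable (mainPart lam ε m r s ϱ u) ∧
      ∫ w, mainPart lam ε m r s ϱ u w ≤ 54 * L ^ 3 * ∫ w, remainder Ω T ε m s S ϱ u w := by
  have hp := fun i => h.integrable_principal hΩ hΩb hε hlam hL hLf hM hLM hr hs i
  have hP := h.integrable_pressurePart hΩ hΩb hε hlam hL hr hs
  have hsum : Integrable fun w => ∑ i, principal lam ε m r s ϱ u i w :=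
    integrable_finsetSum _ fun i _ => (hp i).1
  have hF : Integrable fun w => ∑ i, principal lam ε m r s ϱ u i w -
      pressurePart lam ε m r s ϱ w := hsum.sub hP
  have hFs : Integrable fun w => ∑ i, principal lam ε m r s ϱ u i (swapPair w) -
      pressurePart lam ε m r s ϱ (swapPair w) :=
    (measurePreserving_swapPair.integrable_comp_emb measurableEmbedding_swapPair).2 hF
  have hFe : ∫ w, (∑ i, principal lam ε m r s ϱ u i (swapPair w) -
      pressurePart lam ε m r s ϱ (swapPair w)) =
      ∫ w, (∑ i, principal lam ε m r s ϱ u i w - pressurePart lam ε m r s ϱ w) :=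
    measurePreserving_swapPair.integral_comp measurableEmbedding_swapPair
      (fun w => ∑ i, principal lam ε m r s ϱ u i w - pressurePart lam ε m r s ϱ w)
  have e : mainPart lam ε m r s ϱ u = fun w => _ := funext (mainPart_eq hr s h.density_nonneg)
  have i1 := hF.const_mul (1 / 2)
  have i2 := hFs.const_mul (1 / 2)
  rw [e]
  refine ⟨(i1.fun_add i2).fun_add hP, ?_⟩
  rw [integral_add (i1.fun_add i2) hP, integral_add i1 i2, integral_const_mul, integral_const_mul,
    hFe, integral_sub hsum hP, integral_finsetSum _ fun i _ => (hp i).1]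
  have h1 := Finset.sum_le_sum (s := Finset.univ) fun i _ => (le_abs_self _).trans (hp i).2
  simp only [Finset.sum_const, Finset.card_univ, Fintype.card_fin, nsmul_eq_mul] at h1
  push_cast at h1
  linarith

end

/-! ### The energy inequality and the comparison of scales -/

/-- Only σ > max(a, d) contributes, so the integral is at most 1/max(a, d). Truncating W at a thus
produces the kernel profile regularized at a. -/
theorem lintegral_Ioo_inv_sq_le {a d b : ℝ} (ha : 0 < a) (hd : 0 ≤ d) :
    ∫⁻ σ in Ioo a b, (if d < σ then ENNReal.ofReal (1 / σ ^ 2) else 0) ≤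
      ENNReal.ofReal (2 * (√(d ^ 2 + a ^ 2))⁻¹) := by
  set c := max a d with hc
  have hc0 : 0 < c := lt_max_of_lt_left ha
  calc _ ≤ ∫⁻ σ, (Ioi c).indicator (fun σ => ENNReal.ofReal (σ ^ (-2 : ℝ))) σ := by
        rw [← lintegral_indicator measurableSet_Ioo]
        refine lintegral_mono fun σ => ?_
        by_cases h : σ ∈ Ioo a b
        · rw [indicator_of_mem h]
          by_cases h' : d < σ
          · rw [if_pos h', indicator_of_mem (show σ ∈ Ioi c from max_lt h.1 h')]
            rw [Real.rpow_neg (ha.trans h.1).le, one_div]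
            norm_num
          · simp [h']
        · simp [h]
    _ = ENNReal.ofReal (1 / c) := by
        rw [lintegral_indicator measurableSet_Ioi, ← ofReal_integral_eq_lintegral_ofReal
          (integrableOn_Ioi_rpow_of_lt (by norm_num) hc0), integral_Ioi_rpow_of_lt (by norm_num) hc0]
        · congr 1
          norm_num
          rw [Real.rpow_neg_one]
        · filter_upwards [ae_restrict_mem measurableSet_Ioi] with σ hσ
          exact Real.rpow_nonneg (hc0.trans hσ).le _
    _ ≤ _ := by
        refine ENNReal.ofReal_le_ofReal ?_
        have h1 : √(d ^ 2 + a ^ 2) ≤ 2 * c := by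
          refine Real.sqrt_le_iff.2 ⟨by positivity, ?_⟩
          have := le_max_left a d
          have := le_max_right a d
          nlinarith
        have h2 : 0 < √(d ^ 2 + a ^ 2) := by positivity
        rw [← div_eq_mul_inv, div_le_div_iff₀ hc0 h2]
        linarith

section

variable {Ω : Set E3} {T ε m : ℝ} {E MS Mf : ℝ≥0}
  {S : SpaceTime → Matrix (Fin 3) (Fin 3) ℝ} {f : SpaceTime → E3}
  {ϱ : SpaceTime → ℝ} {u : SpaceTime → E3} {lam : SpaceTime → ℝ}

theorem IsNormalSolution.measurable_longEnergy (h : IsNormalSolution Ω T ε m E MS Mf S f ϱ u)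
    (hlam : IsTestFunction (cylinder Ω T) lam) : Measurable (longEnergy lam ε m ϱ u) := by
  have h1 := h.density_meas
  have h2 := h.measurable_locDensity hlam
  have h3 := h.measurable_locVelocity hlam
  have h4 := measurable_other
  unfold longEnergy energyPar pairDensity projPar pressureFactor
  fun_prop

theorem IsNormalSolution.measurable_perpEnergy (h : IsNormalSolution Ω T ε m E MS Mf S f ϱ u)
    (hlam : IsTestFunction (cylinder Ω T) lam) : Measurable (perpEnergy lam ε m ϱ u) := by
  have h1 := h.density_meas
  have h2 := h.measurable_locDensity hlam
  have h3 := h.measurable_locVelocity hlam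
  have h4 := measurable_other
  unfold perpEnergy energyPerp pairDensity projPerp projPar pressureFactor
  fun_prop

theorem IsNormalSolution.pairDensity_nonneg (h : IsNormalSolution Ω T ε m E MS Mf S f ϱ u)
    (w : SpaceTime × E3) : 0 ≤ pairDensity lam ϱ w :=
  mul_nonneg (h.locDensity_nonneg _) (h.locDensity_nonneg _)

theorem IsNormalSolution.internal_nonneg (h : IsNormalSolution Ω T ε m E MS Mf S f ϱ u)
    (hε : 0 < ε) (z : SpaceTime) :
    0 ≤ locDensity lam ϱ z ^ (1 / 2 : ℝ) * pressureFactor ε m (ϱ z) :=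
  mul_nonneg (Real.rpow_nonneg (h.locDensity_nonneg z) _)
    (zero_le_one.trans (one_le_pressureFactor hε (h.density_nonneg z)))

theorem IsNormalSolution.longEnergy_nonneg (h : IsNormalSolution Ω T ε m E MS Mf S f ϱ u)
    (hε : 0 < ε) (w : SpaceTime × E3) : 0 ≤ longEnergy lam ε m ϱ u w :=
  mul_nonneg (h.pairDensity_nonneg w) (add_nonneg (by positivity) (h.internal_nonneg hε _))

theorem IsNormalSolution.perpEnergy_nonneg (h : IsNormalSolution Ω T ε m E MS Mf S f ϱ u)
    (hε : 0 < ε) (w : SpaceTime × E3) : 0 ≤ perpEnergy lam ε m ϱ u w :=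
  mul_nonneg (h.pairDensity_nonneg w)
    (add_nonneg (by positivity) (mul_nonneg zero_le_two (h.internal_nonneg hε _)))

theorem pairEnergy_eq {ρ : SpaceTime → ℝ} {e : E3 → E3 → ℝ → ℝ} (h0 : ∀ z, 0 ≤ ρ z)
    (hm : Measurable fun w : SpaceTime × E3 => ρ w.1 * ρ (other w) * e w.1.1 w.2 w.1.2) (s : ℝ) :
    pairEnergy ρ e s = ∫⁻ w : SpaceTime × E3, if ‖displ w‖ < s then
      ENNReal.ofReal (ρ w.1 * ρ (other w) * e w.1.1 w.2 w.1.2) else 0 := by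
  rw [lintegral_pair_ball hm.ennreal_ofReal, pairEnergy]
  refine lintegral_congr fun z => ?_
  rw [← lintegral_const_mul' _ _ ENNReal.ofReal_ne_top]
  refine lintegral_congr fun y => ?_
  rw [← ENNReal.ofReal_mul (h0 z), ← mul_assoc]
  rfl

theorem IsNormalSolution.pairEnergy_par (h : IsNormalSolution Ω T ε m E MS Mf S f ϱ u)
    (hlam : IsTestFunction (cylinder Ω T) lam) (s : ℝ) :
    pairEnergy (locDensity lam ϱ) (energyPar lam ε m ϱ u) s =
      ∫⁻ w, if ‖displ w‖ < s then ENNReal.ofReal (longEnergy lam ε m ϱ u w) else 0 :=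
  pairEnergy_eq h.locDensity_nonneg (h.measurable_longEnergy hlam) s

theorem IsNormalSolution.pairEnergy_perp (h : IsNormalSolution Ω T ε m E MS Mf S f ϱ u)
    (hlam : IsTestFunction (cylinder Ω T) lam) (s : ℝ) :
    pairEnergy (locDensity lam ϱ) (energyPerp lam ε m ϱ u) s =
      ∫⁻ w, if ‖displ w‖ < s then ENNReal.ofReal (perpEnergy lam ε m ϱ u w) else 0 :=
  pairEnergy_eq h.locDensity_nonneg (h.measurable_perpEnergy hlam) s

/-- The upper bound for the integral of the main part, with the coefficients estimated from below:
1/(3r) for |x - y| < r, and -2M/s up to distance s. The negative part moves to the right as a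
multiple of the longitudinal energy at scale s. The transverse term is kept where the cutoff equals
1. -/
theorem IsNormalSolution.energy_inequality (h : IsNormalSolution Ω T ε m E MS Mf S f ϱ u)
    (hΩ : IsOpen Ω) (hΩb : Bornology.IsBounded Ω) (hε : 0 < ε)
    (hlam : IsTestFunction (cylinder Ω T) lam) {L M : ℝ} (hL : CutoffBound lam L)
    (hLf : Mf ≤ L) (hM : ∀ q, |deriv cutoff q| ≤ M) (hLM : 2 + 2 * M ≤ L)
    {r s : ℝ} (hr : 0 < r) (hrs : r ≤ s / 2) :
    ENNReal.ofReal (1 / (3 * r)) * pairEnergy (locDensity lam ϱ) (energyPar lam ε m ϱ u) r +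
      ∫⁻ w, (if ‖displ w‖ ≤ s / 2 then
        ENNReal.ofReal ((√(‖displ w‖ ^ 2 + r ^ 2))⁻¹ * perpEnergy lam ε m ϱ u w) else 0) ≤
      ENNReal.ofReal (2 * M / s) * pairEnergy (locDensity lam ϱ) (energyPar lam ε m ϱ u) s +
        ENNReal.ofReal (54 * L ^ 3) * (remainderConst Ω T E MS * ENNReal.ofReal s) := by
  have hs : 0 < s := by linarith
  have hM0 : 0 ≤ M := (abs_nonneg _).trans (hM 0)
  have hL0 := hL.one_le
  have ml := h.measurable_longEnergy hlam
  have mp := h.measurable_perpEnergy hlam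
  have md := measurable_displ
  have nl := h.longEnergy_nonneg (lam := lam) hε
  have np := h.perpEnergy_nonneg (lam := lam) hε
  have msl : ∀ a : ℝ, MeasurableSet {w : SpaceTime × E3 | ‖displ w‖ < a} := fun a =>
    measurableSet_lt measurable_displ.norm measurable_const
  have msc : MeasurableSet {w : SpaceTime × E3 | ‖displ w‖ ≤ s / 2} :=
    measurableSet_le measurable_displ.norm measurable_const
  set N : SpaceTime × E3 → ℝ := fun w =>
    if ‖displ w‖ < s then 2 * M / s * longEnergy lam ε m ϱ u w else 0 with hN
  set G1 : SpaceTime × E3 → ℝ := fun w =>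
    if ‖displ w‖ < r then 1 / (3 * r) * longEnergy lam ε m ϱ u w else 0 with hG1
  set G2 : SpaceTime × E3 → ℝ := fun w => if ‖displ w‖ ≤ s / 2 then
        (√(‖displ w‖ ^ 2 + r ^ 2))⁻¹ * perpEnergy lam ε m ϱ u w else 0 with hG2
  have mN : Measurable N := Measurable.ite (msl s) (by fun_prop) measurable_const
  have mG1 : Measurable G1 := Measurable.ite (msl r) (by fun_prop) measurable_const
  have mG2 : Measurable G2 := Measurable.ite msc (by fun_prop) measurable_const
  have nN : ∀ w, 0 ≤ N w := fun w => by
    have := nl w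
    simp only [hN]; split_ifs <;> positivity
  have nG1 : ∀ w, 0 ≤ G1 w := fun w => by
    have := nl w
    simp only [hG1]; split_ifs <;> positivity
  have nG2 : ∀ w, 0 ≤ G2 w := fun w => by
    have := np w
    simp only [hG2]; split_ifs <;> positivity
  have scale : ∀ a c : ℝ, 0 ≤ c →
      ENNReal.ofReal c * pairEnergy (locDensity lam ϱ) (energyPar lam ε m ϱ u) a =
      ∫⁻ w, ENNReal.ofReal (if ‖displ w‖ < a then c * longEnergy lam ε m ϱ u w else 0) := by
    intro a c hc
    rw [h.pairEnergy_par hlam, ← lintegral_const_mul' _ _ ENNReal.ofReal_ne_top]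
    refine lintegral_congr fun w => ?_
    split_ifs
    · rw [ENNReal.ofReal_mul hc]
    · simp
  have hpt : ∀ w, G1 w + G2 w ≤ mainPart lam ε m r s ϱ u w + N w := by
    intro w
    have h1 : G2 w ≤ profile r s (‖displ w‖ ^ 2) * perpEnergy lam ε m ϱ u w := by
      simp only [hG2]
      split_ifs with hd
      · rw [profile_eq hs hd]
      · exact mul_nonneg (profile_nonneg _ _ _) (np w)
    have h2 : G1 w ≤ longCoeff r s (‖displ w‖ ^ 2) * longEnergy lam ε m ϱ u w + N w := by
      simp only [hG1, hN]
      by_cases hd : ‖displ w‖ < r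
      · rw [if_pos hd, if_pos (by linarith)]
        have := mul_le_mul_of_nonneg_right (longCoeff_ge_inner hr hrs hd) (nl w)
        have : 0 ≤ 2 * M / s * longEnergy lam ε m ϱ u w := mul_nonneg (by positivity) (nl w)
        linarith
      · rw [if_neg hd]
        by_cases hd' : ‖displ w‖ < s
        · rw [if_pos hd']
          have := mul_le_mul_of_nonneg_right (longCoeff_ge hM hr hs (displ w)) (nl w)
          linarith
        · rw [if_neg hd', longCoeff_eq_zero hr hs (not_lt.1 hd')]
          simp
    rw [mainPart]
    linarith
  obtain ⟨hmi, hml⟩ := h.integral_mainPart_le hΩ hΩb hε hlam hL hLf hM hLM hr hs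
  have eG1 : ENNReal.ofReal (1 / (3 * r)) *
      pairEnergy (locDensity lam ϱ) (energyPar lam ε m ϱ u) r = ∫⁻ w, ENNReal.ofReal (G1 w) :=
    scale r _ (by positivity)
  have eN : ENNReal.ofReal (2 * M / s) *
      pairEnergy (locDensity lam ϱ) (energyPar lam ε m ϱ u) s = ∫⁻ w, ENNReal.ofReal (N w) :=
    scale s _ (by positivity)
  rw [eG1, eN]
  have eG2 : ∫⁻ w, (if ‖displ w‖ ≤ s / 2 then
        ENNReal.ofReal ((√(‖displ w‖ ^ 2 + r ^ 2))⁻¹ * perpEnergy lam ε m ϱ u w) else 0) =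
      ∫⁻ w, ENNReal.ofReal (G2 w) := by
    refine lintegral_congr fun w => ?_
    simp only [hG2]
    split_ifs <;> simp
  rw [eG2]
  -- If N is not integrable, the right-hand side is infinite. Otherwise the main part plus N
  -- dominates the left-hand side, and real integrals can be compared.
  by_cases hNi : Integrable N
  swap
  · have : ∫⁻ w, ENNReal.ofReal (N w) = ⊤ := by
      by_contra hne
      refine hNi ⟨mN.aestronglyMeasurable, ?_⟩
      rw [hasFiniteIntegral_iff_ofReal (ae_of_all _ nN)]
      exact lt_top_iff_ne_top.2 hne
    rw [this]
    simp
  have hGi : Integrable fun w => G1 w + G2 w :=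
    (hmi.add hNi).mono' (mG1.add mG2).aestronglyMeasurable (ae_of_all _ fun w => by
      rw [Real.norm_of_nonneg (add_nonneg (nG1 w) (nG2 w))]
      exact hpt w)
  have hle : ∫ w, (G1 w + G2 w) ≤ 54 * L ^ 3 * (∫ w, remainder Ω T ε m s S ϱ u w) + ∫ w, N w := by
    calc _ ≤ ∫ w, (mainPart lam ε m r s ϱ u w + N w) :=
          integral_mono hGi (hmi.add hNi) hpt
      _ = _ := integral_add hmi hNi
      _ ≤ _ := by linarith
  calc (∫⁻ w, ENNReal.ofReal (G1 w)) + ∫⁻ w, ENNReal.ofReal (G2 w)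
      = ∫⁻ w, ENNReal.ofReal (G1 w + G2 w) := by
        rw [← lintegral_add_left mG1.ennreal_ofReal]
        exact lintegral_congr fun w => (ENNReal.ofReal_add (nG1 w) (nG2 w)).symm
    _ = ENNReal.ofReal (∫ w, (G1 w + G2 w)) := by
        rw [ofReal_integral_eq_lintegral_ofReal hGi
          (ae_of_all _ fun w => add_nonneg (nG1 w) (nG2 w))]
    _ ≤ ENNReal.ofReal (54 * L ^ 3 * (∫ w, remainder Ω T ε m s S ϱ u w) + ∫ w, N w) :=
        ENNReal.ofReal_le_ofReal hle
    _ ≤ ENNReal.ofReal (54 * L ^ 3) * ENNReal.ofReal (∫ w, remainder Ω T ε m s S ϱ u w) +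
        ENNReal.ofReal (∫ w, N w) := by
        rw [← ENNReal.ofReal_mul (by positivity)]
        exact ENNReal.ofReal_add_le
    _ ≤ _ := by
        rw [add_comm, ofReal_integral_eq_lintegral_ofReal hNi (ae_of_all _ nN),
          ofReal_integral_eq_lintegral_ofReal (h.integrable_remainder hΩ hΩb hε hs)
          (ae_of_all _ (h.remainder_nonneg hε s))]
        gcongr
        exact h.lintegral_remainder_le hΩ hε hs

/-- Tonelli moves the scale integral inside. A pair at distance more than s/2 ≥ r does not
contribute. -/
theorem IsNormalSolution.W_truncated_le (h : IsNormalSolution Ω T ε m E MS Mf S f ϱ u)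
    (hε : 0 < ε) (hlam : IsTestFunction (cylinder Ω T) lam) {a r s : ℝ} (ha : 0 < a)
    (hrs : r ≤ s / 2) :
    ∫⁻ σ in Ioo a r, pairEnergy (locDensity lam ϱ) (energyPerp lam ε m ϱ u) σ *
        ENNReal.ofReal (1 / σ ^ 2) ≤
      2 * ∫⁻ w, (if ‖displ w‖ ≤ s / 2 then
        ENNReal.ofReal ((√(‖displ w‖ ^ 2 + a ^ 2))⁻¹ * perpEnergy lam ε m ϱ u w) else 0) := by
  have mp := h.measurable_perpEnergy hlam
  have md := measurable_displ
  have np := h.perpEnergy_nonneg (lam := lam) hε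
  have hm : Measurable fun p : ℝ × (SpaceTime × E3) =>
      ENNReal.ofReal (perpEnergy lam ε m ϱ u p.2) *
        (if ‖displ p.2‖ < p.1 then ENNReal.ofReal (1 / p.1 ^ 2) else 0) :=
    Measurable.mul (by fun_prop) (Measurable.ite
      (measurableSet_lt (measurable_displ.norm.comp measurable_snd) measurable_fst)
      (by fun_prop) measurable_const)
  calc _ = ∫⁻ σ in Ioo a r, ∫⁻ w, ENNReal.ofReal (perpEnergy lam ε m ϱ u w) *
        (if ‖displ w‖ < σ then ENNReal.ofReal (1 / σ ^ 2) else 0) := by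
        refine lintegral_congr fun σ => ?_
        rw [h.pairEnergy_perp hlam, ← lintegral_mul_const' _ _ ENNReal.ofReal_ne_top]
        refine lintegral_congr fun w => ?_
        split_ifs <;> simp
    _ = ∫⁻ w, ∫⁻ σ in Ioo a r, ENNReal.ofReal (perpEnergy lam ε m ϱ u w) *
        (if ‖displ w‖ < σ then ENNReal.ofReal (1 / σ ^ 2) else 0) :=
        lintegral_lintegral_swap hm.aemeasurable
    _ ≤ ∫⁻ w, 2 * (if ‖displ w‖ ≤ s / 2 then
        ENNReal.ofReal ((√(‖displ w‖ ^ 2 + a ^ 2))⁻¹ * perpEnergy lam ε m ϱ u w) else 0) := by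
        refine lintegral_mono fun w => ?_
        rw [lintegral_const_mul' _ _ ENNReal.ofReal_ne_top]
        split_ifs with hd
        · calc _ ≤ ENNReal.ofReal (perpEnergy lam ε m ϱ u w) *
                ENNReal.ofReal (2 * (√(‖displ w‖ ^ 2 + a ^ 2))⁻¹) := by
                gcongr
                exact lintegral_Ioo_inv_sq_le ha (norm_nonneg _)
            _ = _ := by
                rw [← ENNReal.ofReal_mul (np w), mul_left_comm, ENNReal.ofReal_mul zero_le_two,
                  ENNReal.ofReal_ofNat, mul_comm (perpEnergy lam ε m ϱ u w)]
        · have : ∫⁻ σ in Ioo a r, (if ‖displ w‖ < σ then ENNReal.ofReal (1 / σ ^ 2) else 0) = 0 := by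
            rw [setLIntegral_congr_fun measurableSet_Ioo (g := fun _ => 0)]
            · simp
            · intro σ hσ
              exact if_neg (by have := hσ.2; linarith)
          rw [this]
          simp
    _ = _ := lintegral_const_mul' _ _ (by simp)

/-- The energy inequality with regularization r bounds Γ(r). The one with regularization a → 0, at
the same s, bounds W(r). -/
theorem exists_Gam_add_W_le (hΩ : IsOpen Ω) (hΩb : Bornology.IsBounded Ω)
    (hlam : IsTestFunction (cylinder Ω T) lam) (E MS Mf : ℝ≥0) :
    ∃ C : ℝ≥0, ∀ (m ε : ℝ) (S : SpaceTime → Matrix (Fin 3) (Fin 3) ℝ) (f : SpaceTime → E3)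
      (ϱ : SpaceTime → ℝ) (u : SpaceTime → E3), 0 < ε →
      IsNormalSolution Ω T ε m E MS Mf S f ϱ u → ∀ r s, 0 < r → r ≤ s / 2 →
      Gam lam ε m ϱ u r + W lam ε m ϱ u r ≤ C * (Gam lam ε m ϱ u s + ENNReal.ofReal s) := by
  obtain ⟨L0, hL0⟩ := exists_cutoffBound hlam
  obtain ⟨M, hM0, hM⟩ := exists_deriv_cutoff_bound
  have hL := hL0.mono (show L0 ≤ max L0 (max Mf (2 + 2 * M)) from le_max_left _ _)
  have hLf : (Mf : ℝ) ≤ max L0 (max Mf (2 + 2 * M)) := (le_max_left _ _).trans (le_max_right _ _)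
  have hLM : 2 + 2 * M ≤ max L0 (max Mf (2 + 2 * M)) := (le_max_right _ _).trans (le_max_right _ _)
  set L := max L0 (max Mf (2 + 2 * M))
  set K := ENNReal.ofReal (54 * L ^ 3) * remainderConst Ω T E MS
  have hK : K < ⊤ := ENNReal.mul_lt_top ENNReal.ofReal_lt_top (remainderConst_lt_top hΩb)
  refine ⟨5 * ((2 * M).toNNReal + K.toNNReal), fun m ε S f ϱ u hε h r s hr hrs => ?_⟩
  have hs : 0 < s := by linarith
  set R := ENNReal.ofReal (2 * M) * Gam lam ε m ϱ u s + K * ENNReal.ofReal s with hR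
  have hmain : ∀ a, 0 < a → a ≤ s / 2 →
      ENNReal.ofReal (1 / (3 * a)) * pairEnergy (locDensity lam ϱ) (energyPar lam ε m ϱ u) a +
      ∫⁻ w, (if ‖displ w‖ ≤ s / 2 then
        ENNReal.ofReal ((√(‖displ w‖ ^ 2 + a ^ 2))⁻¹ * perpEnergy lam ε m ϱ u w) else 0) ≤ R := by
    intro a ha has
    refine (h.energy_inequality hΩ hΩb hε hlam hL hLf hM hLM ha has).trans (le_of_eq ?_)
    rw [hR, Gam, ← mul_assoc, ← mul_assoc, ← ENNReal.ofReal_mul (by positivity), mul_one_div]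
  have h1 : Gam lam ε m ϱ u r ≤ 3 * R := by
    have : Gam lam ε m ϱ u r = 3 * (ENNReal.ofReal (1 / (3 * r)) *
        pairEnergy (locDensity lam ϱ) (energyPar lam ε m ϱ u) r) := by
      rw [Gam, ← mul_assoc, ← ENNReal.ofReal_ofNat 3, ← ENNReal.ofReal_mul (by norm_num)]
      congr 2
      field_simp
    rw [this]
    gcongr
    exact le_self_add.trans (hmain r hr hrs)
  have h2 : W lam ε m ϱ u r ≤ 2 * R := by
    -- The interval is exhausted from inside. On each piece the regularization is 1/(n + 1), and the
    -- bound R does not depend on it.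
    have hU : Ioo 0 r = ⋃ n : ℕ, Ioo (1 / ((n : ℝ) + 1)) r := by
      ext σ
      simp only [mem_Ioo, mem_iUnion]
      constructor
      · rintro ⟨h1, h2⟩
        obtain ⟨n, hn⟩ := exists_nat_one_div_lt h1
        exact ⟨n, hn, h2⟩
      · rintro ⟨n, h1, h2⟩
        exact ⟨lt_trans (by positivity) h1, h2⟩
    have hmono : Monotone fun n : ℕ => Ioo (1 / ((n : ℝ) + 1)) r := by
      intro n k hnk
      refine Ioo_subset_Ioo_left ?_
      gcongr
    rw [W, hU, setLIntegral_iUnion_of_directed _ hmono.directed_le]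
    refine iSup_le fun n => ?_
    by_cases hn : 1 / ((n : ℝ) + 1) < r
    · refine (h.W_truncated_le hε hlam (by positivity) hrs).trans ?_
      gcongr
      exact le_add_self.trans (hmain _ (by positivity) (by linarith))
    · rw [Ioo_eq_empty hn]
      simp
  calc _ ≤ 3 * R + 2 * R := add_le_add h1 h2
    _ = 5 * R := by ring
    _ ≤ 5 * (((2 * M).toNNReal + K.toNNReal : ℝ≥0∞) * (Gam lam ε m ϱ u s + ENNReal.ofReal s)) := by
        gcongr
        rw [hR, ENNReal.coe_toNNReal hK.ne, mul_add]
        gcongr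
        · exact le_self_add
        · exact le_add_self
    _ = _ := by
        push_cast
        ring

/-- No equation is needed here: the longitudinal energy is at most 2L² times the remainder, whose
integral is O(s). This is the starting point of the bootstrap. -/
theorem exists_Gam_le (hΩ : IsOpen Ω) (hΩb : Bornology.IsBounded Ω)
    (hlam : IsTestFunction (cylinder Ω T) lam) (E MS Mf : ℝ≥0) :
    ∃ C : ℝ≥0, ∀ (m ε : ℝ) (S : SpaceTime → Matrix (Fin 3) (Fin 3) ℝ) (f : SpaceTime → E3)
      (ϱ : SpaceTime → ℝ) (u : SpaceTime → E3), 0 < ε →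
      IsNormalSolution Ω T ε m E MS Mf S f ϱ u → ∀ s, 0 < s → Gam lam ε m ϱ u s ≤ C := by
  obtain ⟨L, hL⟩ := exists_cutoffBound hlam
  have hL1 := hL.one_le
  set K := ENNReal.ofReal (2 * L ^ 2) * remainderConst Ω T E MS
  have hK : K < ⊤ := ENNReal.mul_lt_top ENNReal.ofReal_lt_top (remainderConst_lt_top hΩb)
  refine ⟨K.toNNReal, fun m ε S f ϱ u hε h s hs => ?_⟩
  rw [ENNReal.coe_toNNReal hK.ne, Gam, h.pairEnergy_par hlam]
  have hpt : ∀ w, (if ‖displ w‖ < s then ENNReal.ofReal (longEnergy lam ε m ϱ u w) else 0) ≤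
      ENNReal.ofReal (2 * L ^ 2) * ENNReal.ofReal (remainder Ω T ε m s S ϱ u w) := by
    intro w
    rw [remainder]
    split_ifs with hd
    swap
    · simp
    rw [← ENNReal.ofReal_mul (by positivity)]
    refine ENNReal.ofReal_le_ofReal ?_
    have a0 := h.density_nonneg w.1
    have b0 := h.density_nonneg (other w)
    have hp0 := h.pressure_nonneg hε w.1
    obtain ⟨-, a2, a3, -⟩ := h.le_majorant hε w.1
    obtain ⟨-, b2, -⟩ := h.le_majorant hε (other w)
    have e1 : longEnergy lam ε m ϱ u w = pairDensity lam ϱ w * (1 / 2 * ‖projPar (displ w)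
        (locVelocity lam u w.1 - locVelocity lam u (other w))‖ ^ 2) +
        locDensity lam ϱ (other w) * (lam w.1 ^ 6 * pressure ε m ϱ w.1) := by
      rw [← locDensity_mul_rpow w.1 a0]
      simp only [longEnergy, energyPar, pairDensity, displ, other]
      ring
    have e2 : ‖projPar (displ w) (locVelocity lam u w.1 - locVelocity lam u (other w))‖ ^ 2 ≤
        2 * (‖locVelocity lam u w.1‖ ^ 2 + ‖locVelocity lam u (other w)‖ ^ 2) := by
      have h1 := projPerp_norm_sq (displ w) (locVelocity lam u w.1 - locVelocity lam u (other w))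
      have h2 := sq_nonneg ‖projPerp (displ w)
        (locVelocity lam u w.1 - locVelocity lam u (other w))‖
      have h3 := norm_sub_le (locVelocity lam u w.1) (locVelocity lam u (other w))
      have h4 := norm_nonneg (locVelocity lam u w.1 - locVelocity lam u (other w))
      nlinarith [sq_nonneg (‖locVelocity lam u w.1‖ - ‖locVelocity lam u (other w)‖),
        pow_le_pow_left₀ h4 h3 2]
    have kin : ∀ z, locDensity lam ϱ z * ‖locVelocity lam u z‖ ^ 2 =
        lam z ^ 6 * (ϱ z * ‖u z‖ ^ 2) := fun z => by
      rw [locDensity, locVelocity, norm_smul, mul_pow, Real.norm_eq_abs, sq_abs]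
      ring
    have l6 : ∀ z, lam z ^ 6 ≤ L := fun z => (le_abs_self _).trans (hL.six z)
    have l4 : ∀ z, lam z ^ 4 ≤ L := fun z => (le_abs_self _).trans (hL.four z)
    have p6 : ∀ z, 0 ≤ lam z ^ 6 := fun z => by positivity
    have p4 : ∀ z, 0 ≤ lam z ^ 4 := fun z => by positivity
    have n0 := h.majorant_nonneg hε w.1
    have n0' := h.majorant_nonneg hε (other w)
    have hpd := h.pairDensity_nonneg (lam := lam) w
    have t1 : pairDensity lam ϱ w * (1 / 2 * ‖projPar (displ w)
        (locVelocity lam u w.1 - locVelocity lam u (other w))‖ ^ 2) ≤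
        L ^ 2 * (majorant Ω T ε m S ϱ u w.1 * ϱ (other w)) +
        L ^ 2 * (ϱ w.1 * majorant Ω T ε m S ϱ u (other w)) := by
      calc _ ≤ pairDensity lam ϱ w *
            (‖locVelocity lam u w.1‖ ^ 2 + ‖locVelocity lam u (other w)‖ ^ 2) := by
            gcongr
            linarith
        _ = (lam w.1 ^ 6 * (ϱ w.1 * ‖u w.1‖ ^ 2)) * (lam (other w) ^ 4 * ϱ (other w)) +
            (lam w.1 ^ 4 * ϱ w.1) * (lam (other w) ^ 6 * (ϱ (other w) * ‖u (other w)‖ ^ 2)) := by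
            rw [← kin, ← kin, pairDensity, locDensity, locDensity]
            ring
        _ ≤ (L * majorant Ω T ε m S ϱ u w.1) * (L * ϱ (other w)) +
            (L * ϱ w.1) * (L * majorant Ω T ε m S ϱ u (other w)) := by
            gcongr
            · exact l6 _
            · exact l4 _
            · exact l4 _
            · exact l6 _
        _ = _ := by ring
    have t2 : locDensity lam ϱ (other w) * (lam w.1 ^ 6 * pressure ε m ϱ w.1) ≤
        L ^ 2 * (majorant Ω T ε m S ϱ u w.1 * ϱ (other w)) := by
      calc _ ≤ (L * ϱ (other w)) * (L * majorant Ω T ε m S ϱ u w.1) := by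
            rw [locDensity]
            gcongr
            · exact l4 _
            · exact l6 _
        _ = _ := by ring
    have t3 : 0 ≤ L ^ 2 * (ϱ w.1 * majorant Ω T ε m S ϱ u (other w)) := by positivity
    have t4 : 0 ≤ L ^ 2 * (ϱ (other w) / ‖displ w‖ ^ 2) := by positivity
    rw [e1]
    linarith
  calc _ ≤ ENNReal.ofReal (1 / s) * (ENNReal.ofReal (2 * L ^ 2) *
        (remainderConst Ω T E MS * ENNReal.ofReal s)) := by
        gcongr
        refine (lintegral_mono hpt).trans ?_
        rw [lintegral_const_mul' _ _ ENNReal.ofReal_ne_top]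
        gcongr
        exact h.lintegral_remainder_le hΩ hε hs
    _ = K * (ENNReal.ofReal (1 / s) * ENNReal.ofReal s) := by ring
    _ = K := by
        rw [← ENNReal.ofReal_mul (by positivity), one_div_mul_cancel hs.ne', ENNReal.ofReal_one,
          mul_one]

end

/-! ### The weak gradient of the localized velocity -/

theorem integrable_mul_of_tsupport_subset {Ω : Set E3} {w χ : E3 → ℝ}
    (hw : LocallyIntegrableOn w Ω) (hχ : Continuous χ) (hc : HasCompactSupport χ)
    (hs : tsupport χ ⊆ Ω) : Integrable fun x => χ x * w x := by
  obtain ⟨C, hC⟩ := hc.exists_bound_of_continuous hχ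
  have h1 : IntegrableOn (fun x => χ x * w x) (tsupport χ) :=
    (hw.integrableOn_compact_subset hs hc).bdd_mul hχ.aestronglyMeasurable (ae_of_all _ hC)
  refine (integrableOn_iff_integrable_of_support_subset ?_).1 h1
  exact (Function.support_mul_subset_left _ _).trans (subset_tsupport χ)

theorem locallyIntegrableOn_apply {Ω : Set E3} {w : E3 → E3} (hw : LocallyIntegrableOn w Ω)
    (i : Fin 3) : LocallyIntegrableOn (fun x => w x i) Ω := fun x hx => by
  obtain ⟨t, ht, hi⟩ := hw x hx
  exact ⟨t, ht, (EuclideanSpace.proj i : E3 →L[ℝ] ℝ).integrable_comp hi⟩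

/-- Multiplication by a test function turns a weak gradient in `Ω` into one in `ℝ³`. -/
theorem HasWeakGradient.isWeakGrad_mul {Ω : Set E3} {w : E3 → E3}
    {G : E3 → Matrix (Fin 3) (Fin 3) ℝ} (h : HasWeakGradient Ω w G) {χ : E3 → ℝ}
    (hχ : IsTestFunction Ω χ) (i : Fin 3) :
    IsWeakGrad (fun x => χ x * w x i)
      (fun j x => χ x * G x i j + partialDeriv j χ x * w x i) := by
  obtain ⟨h1, h2, h3⟩ := h
  have hw := locallyIntegrableOn_apply h1 i
  have dc := fun j => continuous_partialDeriv hχ.1 j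
  have ds := fun j => hasCompactSupport_partialDeriv hχ.2.1 j
  have dt : ∀ j, tsupport (partialDeriv j χ) ⊆ Ω := fun j =>
    (tsupport_fderiv_apply_subset ℝ (unitVec j)).trans hχ.2.2
  have i1 := integrable_mul_of_tsupport_subset hw hχ.1.continuous hχ.2.1 hχ.2.2
  have i2 := fun j => integrable_mul_of_tsupport_subset (h2 i j) hχ.1.continuous hχ.2.1 hχ.2.2
  have i3 := fun j => integrable_mul_of_tsupport_subset hw (dc j) (ds j) (dt j)
  refine ⟨i1.locallyIntegrable, fun j => ((i2 j).add (i3 j)).locallyIntegrable, ?_⟩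
  intro φ hφ hφc j
  -- Testing with χφ and expanding its derivative gives the product rule. The integrals over Ω
  -- become integrals over the whole space since χ vanishes outside Ω.
  have key := h3 (fun x => χ x * φ x) (isTestFunction_mul hχ hφ) i j
  simp only [fderiv_mul_apply hχ.1 hφ] at key
  have χ0 : ∀ x, x ∉ Ω → χ x = 0 := fun x hx =>
    image_eq_zero_of_notMem_tsupport fun hx' => hx (hχ.2.2 hx')
  have d0 : ∀ x, x ∉ Ω → fderiv ℝ χ x (unitVec j) = 0 := fun x hx =>
    image_eq_zero_of_notMem_tsupport (f := partialDeriv j χ) fun hx' => hx (dt j hx')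
  rw [setIntegral_eq_integral_of_forall_compl_eq_zero (fun x hx => by simp [χ0 x hx, d0 x hx]),
    setIntegral_eq_integral_of_forall_compl_eq_zero (fun x hx => by simp [χ0 x hx])] at key
  obtain ⟨Cφ, hCφ⟩ := hφc.exists_bound_of_continuous hφ.continuous
  obtain ⟨Cd, hCd⟩ := (hasCompactSupport_partialDeriv hφc j).exists_bound_of_continuous
    (continuous_partialDeriv hφ j)
  have j1 := i1.mul_bdd (continuous_partialDeriv hφ j).aestronglyMeasurable (ae_of_all _ hCd)
  have j2 := (i2 j).mul_bdd hφ.continuous.aestronglyMeasurable (ae_of_all _ hCφ)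
  have j3 := (i3 j).mul_bdd hφ.continuous.aestronglyMeasurable (ae_of_all _ hCφ)
  have e1 : ∫ x, w x i * (χ x * fderiv ℝ φ x (unitVec j) + fderiv ℝ χ x (unitVec j) * φ x) =
      (∫ x, χ x * w x i * partialDeriv j φ x) + ∫ x, partialDeriv j χ x * w x i * φ x := by
    rw [← integral_add j1 j3]
    congr 1
    ext x
    simp only [partialDeriv]
    ring
  have e2 : ∫ x, G x i j * (χ x * φ x) = ∫ x, χ x * G x i j * φ x := by
    congr 1
    ext x
    ring
  have e3 : ∫ x, (χ x * G x i j + partialDeriv j χ x * w x i) * φ x =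
      (∫ x, χ x * G x i j * φ x) + ∫ x, partialDeriv j χ x * w x i * φ x := by
    rw [← integral_add j2 j3]
    congr 1
    ext x
    ring
  rw [e3]
  rw [e1, e2] at key
  linarith

theorem isWeakGrad_zero : IsWeakGrad (fun _ => 0) (fun _ _ => 0) :=
  ⟨locallyIntegrable_const 0, fun _ => locallyIntegrable_const 0, fun _ _ _ _ => by simp⟩

theorem isTestFunction_slice {Ω : Set E3} {T : ℝ} {lam : SpaceTime → ℝ}
    (h : IsTestFunction (cylinder Ω T) lam) (t : ℝ) : IsTestFunction Ω fun x => lam (x, t) := by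
  have hc : Continuous fun x : E3 => (x, t) := by fun_prop
  have hsub : tsupport (fun x => lam (x, t)) ⊆ (fun x : E3 => (x, t)) ⁻¹' tsupport lam :=
    closure_minimal (fun x hx => subset_tsupport lam hx) ((isClosed_tsupport lam).preimage hc)
  refine ⟨h.1.comp (by fun_prop : ContDiff ℝ ∞ fun x : E3 => (x, t)), ?_,
    fun x hx => (h.2.2 (hsub hx)).1⟩
  refine (h.2.1.isCompact.image continuous_fst).of_isClosed_subset (isClosed_tsupport _) ?_
  exact fun x hx => ⟨(x, t), hsub hx, rfl⟩

theorem partialDeriv_slice {lam : SpaceTime → ℝ} (h : ContDiff ℝ ∞ lam) (t : ℝ) (j : Fin 3)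
    (x : E3) : partialDeriv j (fun x => lam (x, t)) x = spaceDeriv j lam (x, t) := by
  have h1 : HasFDerivAt (fun x : E3 => (x, t)) (ContinuousLinearMap.inl ℝ E3 ℝ) x :=
    hasFDerivAt_prodMk_left x t
  have h2 := ((h.differentiable (by simp)) (x, t)).hasFDerivAt.comp x h1
  rw [partialDeriv, show (fun x => lam (x, t)) = lam ∘ fun x => (x, t) from rfl, h2.fderiv]
  rfl

/-- The spatial derivatives of the localized velocity. -/
noncomputable def locGradient (lam : SpaceTime → ℝ) (u : SpaceTime → E3)
    (Du : SpaceTime → Matrix (Fin 3) (Fin 3) ℝ) (i j : Fin 3) (z : SpaceTime) : ℝ :=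
  lam z * Du z i j + spaceDeriv j lam z * u z i

theorem ae_isWeakGrad_locVelocity {Ω : Set E3} {T : ℝ} {lam : SpaceTime → ℝ}
    (hlam : IsTestFunction (cylinder Ω T) lam) {u : SpaceTime → E3}
    {Du : SpaceTime → Matrix (Fin 3) (Fin 3) ℝ}
    (h : ∀ᵐ t ∂(volume.restrict (Ioo 0 T)),
      HasWeakGradient Ω (fun x => u (x, t)) (fun x => Du (x, t))) (i : Fin 3) :
    ∀ᵐ t, IsWeakGrad (fun x => locVelocity lam u (x, t) i)
      (fun j x => locGradient lam u Du i j (x, t)) := by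
  rw [ae_restrict_iff' measurableSet_Ioo] at h
  filter_upwards [h] with t ht
  by_cases hT : t ∈ Ioo 0 T
  · have := (ht hT).isWeakGrad_mul (isTestFunction_slice hlam t) i
    simp only [partialDeriv_slice hlam.1] at this
    exact this
  · have h0 : (fun x => lam (x, t)) = fun _ => 0 := by
      ext x
      exact image_eq_zero_of_notMem_tsupport fun hx => hT (hlam.2.2 hx).2
    have h1 : ∀ x, lam (x, t) = 0 := fun x => congrFun h0 x
    have h2 : ∀ j x, spaceDeriv j lam (x, t) = 0 := fun j x => by
      rw [← partialDeriv_slice hlam.1, h0, partialDeriv]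
      simp
    simpa [locVelocity, locGradient, h1, h2] using isWeakGrad_zero

/-! ### Bounding Γ by the pressure mass of close pairs -/

theorem lintegral_pair_slices {F : SpaceTime × E3 → ℝ≥0∞} (hF : Measurable F) (s : ℝ) :
    ∫⁻ w, (if ‖displ w‖ < s then F w else 0) =
      ∫⁻ t : ℝ, ∫⁻ x : E3, ∫⁻ y in Metric.ball x s, F ((x, t), y) := by
  have hm : Measurable fun z : SpaceTime => ∫⁻ y in Metric.ball z.1 s, F (z, y) :=
    measurable_lintegral_ball (P := SpaceTime) (c := fun z => z.1) measurable_fst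
      (F := fun z y => F (z, y)) hF s
  rw [lintegral_pair_ball hF, Measure.volume_eq_prod, lintegral_prod_symm' _ hm]

/-- The localized pressure `ρ^{3/2} P_ε`. -/
noncomputable def locPressure (lam : SpaceTime → ℝ) (ε m : ℝ) (ϱ : SpaceTime → ℝ)
    (z : SpaceTime) : ℝ := lam z ^ 6 * pressure ε m ϱ z

/-- `∫∫_{|x - y| < s} ρ^{3/2} P_ε(x,t) ρ(y,t)` -/
noncomputable def pressureMass (lam : SpaceTime → ℝ) (ε m : ℝ) (ϱ : SpaceTime → ℝ)
    (s : ℝ) : ℝ≥0∞ :=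
  ∫⁻ w, if ‖displ w‖ < s then
    ENNReal.ofReal (locPressure lam ε m ϱ w.1) * ENNReal.ofReal (locDensity lam ϱ (other w)) else 0

theorem pressureMass_mono {lam : SpaceTime → ℝ} {ε m : ℝ} {ϱ : SpaceTime → ℝ} {s s' : ℝ}
    (h : s ≤ s') : pressureMass lam ε m ϱ s ≤ pressureMass lam ε m ϱ s' := by
  refine lintegral_mono fun w => ?_
  by_cases h1 : ‖displ w‖ < s
  · rw [if_pos h1, if_pos (h1.trans_le h)]
  · rw [if_neg h1]
    exact zero_le

section

variable {Ω : Set E3} {T ε m : ℝ} {E MS Mf : ℝ≥0}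
  {S : SpaceTime → Matrix (Fin 3) (Fin 3) ℝ} {f : SpaceTime → E3}
  {ϱ : SpaceTime → ℝ} {u : SpaceTime → E3} {lam : SpaceTime → ℝ}

theorem IsNormalSolution.measurable_locPressure (h : IsNormalSolution Ω T ε m E MS Mf S f ϱ u)
    (hlam : IsTestFunction (cylinder Ω T) lam) : Measurable (locPressure lam ε m ϱ) := by
  have h1 := h.measurable_pressure
  have h2 := hlam.1.continuous.measurable
  unfold locPressure
  fun_prop

theorem IsNormalSolution.locPressure_nonneg (h : IsNormalSolution Ω T ε m E MS Mf S f ϱ u)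
    (hε : 0 < ε) (z : SpaceTime) : 0 ≤ locPressure lam ε m ϱ z :=
  mul_nonneg (by positivity) (h.pressure_nonneg hε z)

theorem IsNormalSolution.locDensity_rpow_le (h : IsNormalSolution Ω T ε m E MS Mf S f ϱ u)
    (hε : 0 < ε) (z : SpaceTime) :
    ENNReal.ofReal (locDensity lam ϱ z) ^ (3 / 2 : ℝ) ≤
      ENNReal.ofReal (locPressure lam ε m ϱ z) := by
  rw [ENNReal.ofReal_rpow_of_nonneg (h.locDensity_nonneg z) (by norm_num)]
  refine ENNReal.ofReal_le_ofReal ?_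
  have e : (lam z ^ 4) ^ (3 / 2 : ℝ) = lam z ^ 6 := by
    rw [show lam z ^ 4 = (lam z ^ 2) ^ (2 : ℕ) by ring, ← Real.rpow_natCast,
      ← Real.rpow_mul (sq_nonneg _)]
    norm_num
    ring
  rw [locDensity, Real.mul_rpow (by positivity) (h.density_nonneg z), e, locPressure]
  gcongr
  exact h.rpow_le_pressure hε z

theorem IsNormalSolution.longEnergy_eq (h : IsNormalSolution Ω T ε m E MS Mf S f ϱ u)
    (w : SpaceTime × E3) :
    longEnergy lam ε m ϱ u w = pairDensity lam ϱ w * (1 / 2 * ‖projPar (displ w)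
        (locVelocity lam u w.1 - locVelocity lam u (other w))‖ ^ 2) +
      locPressure lam ε m ϱ w.1 * locDensity lam ϱ (other w) := by
  rw [locPressure, ← locDensity_mul_rpow w.1 (h.density_nonneg _)]
  simp only [longEnergy, energyPar, pairDensity, displ, other]
  ring

theorem IsNormalSolution.perpEnergy_eq (h : IsNormalSolution Ω T ε m E MS Mf S f ϱ u)
    (w : SpaceTime × E3) :
    perpEnergy lam ε m ϱ u w = pairDensity lam ϱ w * (1 / 2 * ‖projPerp (displ w)
        (locVelocity lam u w.1 - locVelocity lam u (other w))‖ ^ 2) +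
      2 * (locPressure lam ε m ϱ w.1 * locDensity lam ϱ (other w)) := by
  rw [locPressure, ← locDensity_mul_rpow w.1 (h.density_nonneg _)]
  simp only [perpEnergy, energyPerp, pairDensity, displ, other]
  ring

theorem IsNormalSolution.pressureMass_le_par (h : IsNormalSolution Ω T ε m E MS Mf S f ϱ u)
    (hε : 0 < ε) (hlam : IsTestFunction (cylinder Ω T) lam) (s : ℝ) :
    pressureMass lam ε m ϱ s ≤ pairEnergy (locDensity lam ϱ) (energyPar lam ε m ϱ u) s := by
  rw [h.pairEnergy_par hlam]
  refine lintegral_mono fun w => ?_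
  simp only
  split_ifs
  · rw [← ENNReal.ofReal_mul (h.locPressure_nonneg hε _), h.longEnergy_eq]
    have := h.pairDensity_nonneg (lam := lam) w
    exact ENNReal.ofReal_le_ofReal (le_add_of_nonneg_left (by positivity))
  · exact le_rfl

/-- Dropping the kinetic term of E^⊥ leaves the pressure with its weight 2. In this way W controls
the integral of 2X(s)/s². -/
theorem IsNormalSolution.two_mul_pressureMass_le_perp
    (h : IsNormalSolution Ω T ε m E MS Mf S f ϱ u)
    (hε : 0 < ε) (hlam : IsTestFunction (cylinder Ω T) lam) (s : ℝ) :
    2 * pressureMass lam ε m ϱ s ≤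
      pairEnergy (locDensity lam ϱ) (energyPerp lam ε m ϱ u) s := by
  rw [h.pairEnergy_perp hlam, pressureMass, ← lintegral_const_mul' _ _ (by simp)]
  refine lintegral_mono fun w => ?_
  simp only
  split_ifs
  · rw [← ENNReal.ofReal_mul (h.locPressure_nonneg hε _), ← ENNReal.ofReal_ofNat 2,
      ← ENNReal.ofReal_mul (by norm_num), h.perpEnergy_eq]
    have := h.pairDensity_nonneg (lam := lam) w
    exact ENNReal.ofReal_le_ofReal (le_add_of_nonneg_left (by positivity))
  · simp

theorem IsNormalSolution.pressureMass_eq (h : IsNormalSolution Ω T ε m E MS Mf S f ϱ u)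
    (hlam : IsTestFunction (cylinder Ω T) lam) (s : ℝ) :
    pressureMass lam ε m ϱ s =
      ∫⁻ t, pairMass (fun x => ENNReal.ofReal (locPressure lam ε m ϱ (x, t)))
        (fun y => ENNReal.ofReal (locDensity lam ϱ (y, t))) s := by
  have m1 := h.measurable_locPressure hlam
  have m2 := h.measurable_locDensity hlam
  have m3 := measurable_other
  rw [pressureMass, lintegral_pair_slices (F := fun w => ENNReal.ofReal (locPressure lam ε m ϱ w.1) *
    ENNReal.ofReal (locDensity lam ϱ (other w))) (by fun_prop)]
  refine lintegral_congr fun t => lintegral_congr fun x => ?_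
  exact lintegral_const_mul' (ENNReal.ofReal (locPressure lam ε m ϱ (x, t)))
    (fun y => ENNReal.ofReal (locDensity lam ϱ (y, t))) ENNReal.ofReal_ne_top

theorem IsNormalSolution.measurable_pairMass (h : IsNormalSolution Ω T ε m E MS Mf S f ϱ u)
    (hlam : IsTestFunction (cylinder Ω T) lam) (s : ℝ) :
    Measurable fun t => pairMass (fun x => ENNReal.ofReal (locPressure lam ε m ϱ (x, t)))
        (fun y => ENNReal.ofReal (locDensity lam ϱ (y, t))) s := by
  have m1 := h.measurable_locPressure hlam
  have m2 := h.measurable_locDensity hlam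
  have hb : Measurable fun q : ℝ × E3 =>
      ∫⁻ y in Metric.ball q.2 s, ENNReal.ofReal (locDensity lam ϱ (y, q.1)) :=
    measurable_lintegral_ball (c := fun q : ℝ × E3 => q.2) measurable_snd
      (F := fun q y => ENNReal.ofReal (locDensity lam ϱ (y, q.1)))
      (by unfold Function.uncurry; fun_prop) s
  exact Measurable.lintegral_prod_right' (f := fun q : ℝ × E3 =>
    ENNReal.ofReal (locPressure lam ε m ϱ (q.2, q.1)) *
      ∫⁻ y in Metric.ball q.2 s, ENNReal.ofReal (locDensity lam ϱ (y, q.1)))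
    (by fun_prop)

theorem IsNormalSolution.measurable_locVelocity_apply
    (h : IsNormalSolution Ω T ε m E MS Mf S f ϱ u)
    (hlam : IsTestFunction (cylinder Ω T) lam) (i : Fin 3) :
    Measurable fun z => locVelocity lam u z i :=
  (EuclideanSpace.proj i : E3 →L[ℝ] ℝ).continuous.measurable.comp (h.measurable_locVelocity hlam)

theorem IsNormalSolution.measurable_increment (h : IsNormalSolution Ω T ε m E MS Mf S f ϱ u)
    (hlam : IsTestFunction (cylinder Ω T) lam) (i : Fin 3) :
    Measurable fun w : SpaceTime × E3 => ENNReal.ofReal (pairDensity lam ϱ w *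
      (locVelocity lam u w.1 i - locVelocity lam u (other w) i) ^ 2) := by
  have m2 := h.measurable_locDensity hlam
  have m3 := h.measurable_locVelocity_apply hlam i
  have m4 : Measurable (pairDensity lam ϱ) :=
    (m2.comp measurable_fst).mul (m2.comp measurable_other)
  exact (m4.mul (((m3.comp measurable_fst).sub
    (m3.comp measurable_other)).pow_const 2)).ennreal_ofReal

theorem IsNormalSolution.fluctuation_eq (h : IsNormalSolution Ω T ε m E MS Mf S f ϱ u)
    (hlam : IsTestFunction (cylinder Ω T) lam) (i : Fin 3) (s : ℝ) :
    ∫⁻ w, (if ‖displ w‖ < s then ENNReal.ofReal (pairDensity lam ϱ w *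
        (locVelocity lam u w.1 i - locVelocity lam u (other w) i) ^ 2) else 0) =
      ∫⁻ t, fluctuation (fun x => ENNReal.ofReal (locDensity lam ϱ (x, t)))
        (fun x => locVelocity lam u (x, t) i) s := by
  rw [lintegral_pair_slices (h.measurable_increment hlam i)]
  refine lintegral_congr fun t => lintegral_congr fun x => lintegral_congr fun y => ?_
  rw [ENNReal.ofReal_mul (h.pairDensity_nonneg _), pairDensity,
    ENNReal.ofReal_mul (h.locDensity_nonneg _), ← sq_abs, ENNReal.ofReal_pow (abs_nonneg _),
    ← Real.norm_eq_abs, ofReal_norm]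
  rfl

/-- The longitudinal projection is bounded by the full increment, so the interpolation can be done
component by component. -/
theorem IsNormalSolution.pairEnergy_par_le (h : IsNormalSolution Ω T ε m E MS Mf S f ϱ u)
    (hε : 0 < ε) (hlam : IsTestFunction (cylinder Ω T) lam) (s : ℝ) :
    pairEnergy (locDensity lam ϱ) (energyPar lam ε m ϱ u) s ≤
      (∑ i, ∫⁻ t, fluctuation (fun x => ENNReal.ofReal (locDensity lam ϱ (x, t)))
        (fun x => locVelocity lam u (x, t) i) s) + pressureMass lam ε m ϱ s := by
  have m4 : ∀ i, Measurable fun w : SpaceTime × E3 => (if ‖displ w‖ < s then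
      ENNReal.ofReal (pairDensity lam ϱ w *
        (locVelocity lam u w.1 i - locVelocity lam u (other w) i) ^ 2) else 0) := fun i =>
    Measurable.ite (measurableSet_lt measurable_displ.norm measurable_const)
      (h.measurable_increment hlam i) measurable_const
  simp only [← h.fluctuation_eq hlam]
  rw [h.pairEnergy_par hlam, pressureMass, ← lintegral_finsetSum _ fun i _ => m4 i,
    ← lintegral_add_left (Finset.measurable_sum _ fun i _ => m4 i)]
  refine lintegral_mono fun w => ?_
  simp only
  split_ifs
  swap
  · simp
  have hd := h.pairDensity_nonneg (lam := lam) w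
  rw [← ENNReal.ofReal_mul (h.locPressure_nonneg hε _), h.longEnergy_eq,
    ← ENNReal.ofReal_sum_of_nonneg (fun i _ => by positivity)]
  refine ENNReal.ofReal_add_le.trans ?_
  gcongr
  rw [← Finset.mul_sum]
  gcongr
  have h1 := projPerp_norm_sq (displ w) (locVelocity lam u w.1 - locVelocity lam u (other w))
  have h2 := sq_nonneg ‖projPerp (displ w)
    (locVelocity lam u w.1 - locVelocity lam u (other w))‖
  have h3 : ‖locVelocity lam u w.1 - locVelocity lam u (other w)‖ ^ 2 =
      ∑ i, (locVelocity lam u w.1 i - locVelocity lam u (other w) i) ^ 2 := by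
    rw [EuclideanSpace.norm_sq_eq]
    simp
  have h4 := sq_nonneg ‖locVelocity lam u w.1 - locVelocity lam u (other w)‖
  rw [← h3]
  linarith

theorem IsNormalSolution.lintegral_kinetic_le (h : IsNormalSolution Ω T ε m E MS Mf S f ϱ u)
    {L : ℝ} (hL : CutoffBound lam L) (i : Fin 3) (t : ℝ) :
    ∫⁻ x, ENNReal.ofReal (locDensity lam ϱ (x, t)) * ‖locVelocity lam u (x, t) i‖ₑ ^ 2 ≤
      ENNReal.ofReal L * E := by
  have hL1 := hL.one_le
  calc _ ≤ ∫⁻ x, ENNReal.ofReal L * ENNReal.ofReal (ϱ (x, t) * ‖u (x, t)‖ ^ 2) := by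
        refine lintegral_mono fun x => ?_
        have h0 := h.density_nonneg (x, t)
        have h1 : |u (x, t) i| ≤ ‖u (x, t)‖ := PiLp.norm_apply_le (u (x, t)) i
        rw [← ofReal_norm, ← ENNReal.ofReal_pow (norm_nonneg _), Real.norm_eq_abs, sq_abs,
          ← ENNReal.ofReal_mul (h.locDensity_nonneg _), ← ENNReal.ofReal_mul (by linarith)]
        refine ENNReal.ofReal_le_ofReal ?_
        have e : locDensity lam ϱ (x, t) * locVelocity lam u (x, t) i ^ 2 =
            lam (x, t) ^ 6 * (ϱ (x, t) * |u (x, t) i| ^ 2) := by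
          simp only [locDensity, locVelocity, PiLp.smul_apply, smul_eq_mul, sq_abs]
          ring
        rw [e]
        gcongr
        exact (le_abs_self _).trans (hL.six _)
    _ ≤ _ := by
        rw [lintegral_const_mul' _ _ ENNReal.ofReal_ne_top]
        gcongr
        exact h.kinetic_le t

/-- The localized gradient is λ∇u + u⊗∇λ, so its L² norm is controlled by the W^{1,2} norm of u,
with a constant that depends on λ only. -/
theorem exists_gradient_bound (hlam : IsTestFunction (cylinder Ω T) lam) (E : ℝ≥0) :
    ∃ A : ℝ≥0, ∀ (u : SpaceTime → E3) (Du : SpaceTime → Matrix (Fin 3) (Fin 3) ℝ),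
      Measurable u → (∀ i j, Measurable fun z => Du z i j) →
      ∫⁻ z in cylinder Ω T, ENNReal.ofReal (‖u z‖ ^ 2 + ∑ i, ∑ j, Du z i j ^ 2) ≤
        (E : ℝ≥0∞) ^ 2 →
      ∀ i j, ∫⁻ z, ‖locGradient lam u Du i j z‖ₑ ^ 2 ≤ A := by
  obtain ⟨B, hB⟩ := hlam.2.1.exists_bound_of_continuous hlam.1.continuous
  have hd : ∀ j, ∃ C, ∀ z, ‖spaceDeriv j lam z‖ ≤ C := fun j =>
    (hlam.2.1.fderiv_apply ℝ _).exists_bound_of_continuous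
      ((hlam.1.continuous_fderiv (by simp)).clm_apply continuous_const)
  choose D hD using hd
  have hB0 := (norm_nonneg _).trans (hB 0)
  have hD0 := fun j => (norm_nonneg _).trans (hD j 0)
  set K := 2 * (B ^ 2 + ∑ j, D j ^ 2) with hK
  refine ⟨K.toNNReal * E ^ 2, fun u Du hu hDu hE i j => ?_⟩
  have hz : ∀ z, z ∉ cylinder Ω T → locGradient lam u Du i j z = 0 := fun z hz => by
    have h1 : lam z = 0 := image_eq_zero_of_notMem_tsupport fun h => hz (hlam.2.2 h)
    have h2 : spaceDeriv j lam z = 0 := by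
      rw [spaceDeriv, fderiv_of_notMem_tsupport ℝ fun h => hz (hlam.2.2 h)]
      rfl
    rw [locGradient, h1, h2]
    simp
  have hpt : ∀ z, ‖locGradient lam u Du i j z‖ₑ ^ 2 ≤
      ENNReal.ofReal K * ENNReal.ofReal (‖u z‖ ^ 2 + ∑ i, ∑ j, Du z i j ^ 2) := fun z => by
    rw [← ofReal_norm, ← ENNReal.ofReal_pow (norm_nonneg _), Real.norm_eq_abs, sq_abs,
      ← ENNReal.ofReal_mul (by positivity)]
    refine ENNReal.ofReal_le_ofReal ?_
    have h1 : lam z ^ 2 ≤ B ^ 2 := by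
      rw [← sq_abs]; have := hB z; rw [Real.norm_eq_abs] at this; gcongr
    have h2 : spaceDeriv j lam z ^ 2 ≤ ∑ j, D j ^ 2 := by
      refine le_trans ?_ (Finset.single_le_sum (fun j _ => sq_nonneg (D j)) (Finset.mem_univ j))
      rw [← sq_abs]; have := hD j z; rw [Real.norm_eq_abs] at this; gcongr
    have h3 : u z i ^ 2 ≤ ‖u z‖ ^ 2 := by
      rw [← sq_abs]
      have : |u z i| ≤ ‖u z‖ := PiLp.norm_apply_le (u z) i
      gcongr
    have h4 : Du z i j ^ 2 ≤ ∑ i, ∑ j, Du z i j ^ 2 :=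
      (Finset.single_le_sum (f := fun j => Du z i j ^ 2) (fun _ _ => sq_nonneg _)
        (Finset.mem_univ j)).trans
      (Finset.single_le_sum (f := fun i => ∑ j, Du z i j ^ 2)
        (fun _ _ => Finset.sum_nonneg fun _ _ => sq_nonneg _) (Finset.mem_univ i))
    have hs : 0 ≤ ∑ j, D j ^ 2 := by positivity
    calc locGradient lam u Du i j z ^ 2 ≤
        2 * (lam z ^ 2 * Du z i j ^ 2 + spaceDeriv j lam z ^ 2 * u z i ^ 2) := by
          rw [locGradient]
          nlinarith [sq_nonneg (lam z * Du z i j - spaceDeriv j lam z * u z i)]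
      _ ≤ 2 * (B ^ 2 * (∑ i, ∑ j, Du z i j ^ 2) + (∑ j, D j ^ 2) * ‖u z‖ ^ 2) := by gcongr
      _ ≤ _ := by
          have : 0 ≤ ∑ i, ∑ j, Du z i j ^ 2 := (sq_nonneg _).trans h4
          rw [hK]
          nlinarith [mul_nonneg hs this, mul_nonneg (sq_nonneg B) (sq_nonneg ‖u z‖)]
  calc _ = ∫⁻ z in cylinder Ω T, ‖locGradient lam u Du i j z‖ₑ ^ 2 := by
        rw [setLIntegral_eq_of_support_subset]
        intro z hz'
        by_contra hc
        exact hz' (by simp [hz z hc])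
    _ ≤ ∫⁻ z in cylinder Ω T,
        ENNReal.ofReal K * ENNReal.ofReal (‖u z‖ ^ 2 + ∑ i, ∑ j, Du z i j ^ 2) :=
        lintegral_mono hpt
    _ ≤ _ := by
        rw [lintegral_const_mul' _ _ ENNReal.ofReal_ne_top, ENNReal.coe_mul, ENNReal.coe_pow]
        gcongr
        rfl

/-- The fixed-time interpolation is integrated in time. The pressure term of Γ enters to the first
power and is brought to the power 4/7 by the uniform bound on Γ. -/
theorem exists_Gam_le_pressureMass (hΩ : IsOpen Ω) (hΩb : Bornology.IsBounded Ω)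
    (hlam : IsTestFunction (cylinder Ω T) lam) (E MS Mf : ℝ≥0) :
    ∃ C : ℝ≥0, ∀ (m ε : ℝ) (S : SpaceTime → Matrix (Fin 3) (Fin 3) ℝ) (f : SpaceTime → E3)
      (ϱ : SpaceTime → ℝ) (u : SpaceTime → E3), 0 < ε →
      IsNormalSolution Ω T ε m E MS Mf S f ϱ u → ∀ s, 0 < s → Gam lam ε m ϱ u s ≤
        C * (ENNReal.ofReal (1 / s) * pressureMass lam ε m ϱ (4 * s)) ^ (4 / 7 : ℝ) := by
  obtain ⟨C0, hC0⟩ := exists_Gam_le hΩ hΩb hlam E MS Mf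
  obtain ⟨C1, hC1⟩ := exists_fluctuation_le
  obtain ⟨L, hL⟩ := exists_cutoffBound hlam
  obtain ⟨A, hA⟩ := exists_gradient_bound hlam E
  refine ⟨3 * C1 * (L.toNNReal * E) ^ (4 / 7 : ℝ) * (3 * A) ^ (3 / 7 : ℝ)
    + (4 * C0) ^ (3 / 7 : ℝ), fun m ε S f ϱ u hε h s hs => ?_⟩
  obtain ⟨Du, hDm, hDw, hDE⟩ := h.gradient
  set X := pressureMass lam ε m ϱ (4 * s) with hX
  set τ := ENNReal.ofReal (1 / s) with hτ
  set σ := ENNReal.ofReal s with hσ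
  -- The prefactor 1/s of Γ and the gain s^{3/7} of the interpolation combine to exactly the power
  -- that accompanies X^{4/7}.
  have hτσ : τ * σ ^ (3 / 7 : ℝ) = τ ^ (4 / 7 : ℝ) := by
    rw [hτ, hσ, ENNReal.ofReal_rpow_of_pos hs, ENNReal.ofReal_rpow_of_pos (by positivity),
      ← ENNReal.ofReal_mul (by positivity)]
    congr 1
    rw [one_div, ← Real.rpow_neg_one, ← Real.rpow_mul hs.le, ← Real.rpow_add hs]
    norm_num
  have mR := h.measurable_locDensity hlam
  have mP := h.measurable_locPressure hlam
  have mv := h.measurable_locVelocity hlam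
  have mu := h.velocity_meas
  have mg : ∀ i j, Measurable (locGradient lam u Du i j) := fun i j => by
    have h1 := hlam.1.continuous.measurable
    have h2 : Measurable (spaceDeriv j lam) :=
      ((hlam.1.continuous_fderiv (by simp)).clm_apply continuous_const).measurable
    have h3 := hDm i j
    unfold locGradient
    fun_prop
  have hfl : ∀ i, ∫⁻ t, fluctuation (fun x => ENNReal.ofReal (locDensity lam ϱ (x, t)))
        (fun x => locVelocity lam u (x, t) i) s ≤
      C1 * σ ^ (3 / 7 : ℝ) * (ENNReal.ofReal L * E) ^ (4 / 7 : ℝ) *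
        (X ^ (4 / 7 : ℝ) * (3 * A : ℝ≥0∞) ^ (3 / 7 : ℝ)) := by
    intro i
    have hae := ae_isWeakGrad_locVelocity hlam hDw i
    have mvi := h.measurable_locVelocity_apply hlam i
    set b : ℝ → ℝ≥0∞ := fun t => pairMass (fun x => ENNReal.ofReal (locPressure lam ε m ϱ (x, t)))
        (fun y => ENNReal.ofReal (locDensity lam ϱ (y, t))) (4 * s) with hb
    set a : ℝ → ℝ≥0∞ := fun t => ∑ j, ∫⁻ x, ‖locGradient lam u Du i j (x, t)‖ₑ ^ 2 with ha
    have mb : Measurable b := h.measurable_pairMass hlam (4 * s)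
    have mgj : ∀ j, Measurable fun t => ∫⁻ x, ‖locGradient lam u Du i j (x, t)‖ₑ ^ 2 := fun j =>
      Measurable.lintegral_prod_left' (f := fun z : SpaceTime => ‖locGradient lam u Du i j z‖ₑ ^ 2)
        (by have := mg i j; fun_prop)
    have ma : Measurable a := Finset.measurable_sum _ fun j _ => mgj j
    have hai : ∫⁻ t, a t ≤ 3 * A := by
      rw [ha, lintegral_finsetSum _ fun j _ => mgj j]
      calc _ ≤ ∑ j : Fin 3, (A : ℝ≥0∞) := by
            refine Finset.sum_le_sum fun j _ => ?_
            have := hA u Du mu hDm hDE i j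
            rwa [Measure.volume_eq_prod, lintegral_prod_symm' _
              (by have := mg i j; fun_prop)] at this
        _ = _ := by simp
    calc _ ≤ ∫⁻ t, (C1 * σ ^ (3 / 7 : ℝ) * (ENNReal.ofReal L * E) ^ (4 / 7 : ℝ)) *
          (b t ^ (4 / 7 : ℝ) * a t ^ (3 / 7 : ℝ)) := by
          refine lintegral_mono_ae ?_
          filter_upwards [hae] with t ht
          have key := hC1 (fun x => ENNReal.ofReal (locDensity lam ϱ (x, t)))
            (fun x => ENNReal.ofReal (locPressure lam ε m ϱ (x, t)))
            (mR.comp measurable_prodMk_right).ennreal_ofReal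
            (mP.comp measurable_prodMk_right).ennreal_ofReal (fun x => h.locDensity_rpow_le hε _)
            (fun x => locVelocity lam u (x, t) i) (fun j x => locGradient lam u Du i j (x, t))
            (mvi.comp measurable_prodMk_right) ht s hs
          refine key.trans ?_
          calc _ ≤ C1 * (σ ^ (3 / 7 : ℝ) * b t ^ (4 / 7 : ℝ) *
                (ENNReal.ofReal L * E) ^ (4 / 7 : ℝ) * a t ^ (3 / 7 : ℝ)) := by
                gcongr
                exact h.lintegral_kinetic_le hL i t
            _ = _ := by ring
      _ = (C1 * σ ^ (3 / 7 : ℝ) * (ENNReal.ofReal L * E) ^ (4 / 7 : ℝ)) *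
          ∫⁻ t, b t ^ (4 / 7 : ℝ) * a t ^ (3 / 7 : ℝ) := lintegral_const_mul _ (by fun_prop)
      _ ≤ _ := by
          gcongr
          -- Hölder in time with weights 4/7 and 3/7. The kinetic energy was bounded uniformly in t
          -- and is already outside.
          refine (ENNReal.lintegral_mul_norm_pow_le mb.aemeasurable ma.aemeasurable
            (by norm_num) (by norm_num) (by norm_num)).trans ?_
          rw [hX, h.pressureMass_eq hlam]
          gcongr
  have hY : (τ * X) ≤ (4 * C0) ^ (3 / 7 : ℝ) * (τ * X) ^ (4 / 7 : ℝ) := by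
    have h1 : τ * X ≤ 4 * C0 := by
      calc τ * X ≤ τ * pairEnergy (locDensity lam ϱ) (energyPar lam ε m ϱ u) (4 * s) := by
            gcongr
            exact h.pressureMass_le_par hε hlam _
        _ = 4 * Gam lam ε m ϱ u (4 * s) := by
            -- The prefactor 1/s is rewritten for the scale 4s, at which X is taken.
            have e : τ = 4 * ENNReal.ofReal (1 / (4 * s)) := by
              rw [← ENNReal.ofReal_ofNat 4, ← ENNReal.ofReal_mul (by norm_num), hτ]
              congr 1
              field_simp
            rw [Gam, e, mul_assoc]
        _ ≤ _ := by
            gcongr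
            exact hC0 m ε S f ϱ u hε h _ (by positivity)
    calc τ * X = (τ * X) ^ (3 / 7 : ℝ) * (τ * X) ^ (4 / 7 : ℝ) := by
          rw [← ENNReal.rpow_add_of_nonneg _ _ (by norm_num) (by norm_num)]
          norm_num
      _ ≤ _ := by gcongr
  calc Gam lam ε m ϱ u s ≤ τ * ((∑ i : Fin 3, C1 * σ ^ (3 / 7 : ℝ) *
        (ENNReal.ofReal L * E) ^ (4 / 7 : ℝ) *
        (X ^ (4 / 7 : ℝ) * (3 * A : ℝ≥0∞) ^ (3 / 7 : ℝ))) + X) := by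
        rw [Gam]
        gcongr
        refine (h.pairEnergy_par_le hε hlam s).trans ?_
        gcongr with i
        · exact hfl i
        · exact pressureMass_mono (by linarith)
    _ = 3 * C1 * (ENNReal.ofReal L * E) ^ (4 / 7 : ℝ) * (3 * A : ℝ≥0∞) ^ (3 / 7 : ℝ) *
        (τ * σ ^ (3 / 7 : ℝ) * X ^ (4 / 7 : ℝ)) + τ * X := by
        simp only [Finset.sum_const, Finset.card_univ, Fintype.card_fin, nsmul_eq_mul]
        push_cast
        ring
    _ = 3 * C1 * (ENNReal.ofReal L * E) ^ (4 / 7 : ℝ) * (3 * A : ℝ≥0∞) ^ (3 / 7 : ℝ) *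
        (τ * X) ^ (4 / 7 : ℝ) + τ * X := by
        rw [hτσ, ENNReal.mul_rpow_of_nonneg τ X (by norm_num)]
    _ ≤ 3 * C1 * (ENNReal.ofReal L * E) ^ (4 / 7 : ℝ) * (3 * A : ℝ≥0∞) ^ (3 / 7 : ℝ) *
        (τ * X) ^ (4 / 7 : ℝ) + (4 * C0) ^ (3 / 7 : ℝ) * (τ * X) ^ (4 / 7 : ℝ) := by gcongr
    _ = _ := by
        rw [← add_mul]
        congr 1
        push_cast
        rw [ENNReal.coe_rpow_of_nonneg _ (by norm_num),
          ENNReal.coe_rpow_of_nonneg _ (by norm_num),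
          ENNReal.coe_rpow_of_nonneg _ (by norm_num)]
        push_cast
        rfl

end

/-! ### Bootstrapping the logarithmic decay -/

theorem lintegral_Ioo_one_div {a b : ℝ} (ha : 0 < a) (hab : a ≤ b) :
    ∫⁻ σ in Ioo a b, ENNReal.ofReal (1 / σ) = ENNReal.ofReal (Real.log (b / a)) := by
  have hb := ha.trans_le hab
  have hi : IntervalIntegrable (fun σ : ℝ => 1 / σ) volume a b := by
    refine intervalIntegral.intervalIntegrable_one_div (fun x hx => ?_) continuousOn_id
    rw [uIcc_of_le hab] at hx
    exact (ha.trans_le hx.1).ne'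
  rw [intervalIntegrable_iff_integrableOn_Ioo_of_le hab] at hi
  rw [← integral_one_div_of_pos ha hb, intervalIntegral.integral_of_le hab,
    integral_Ioc_eq_integral_Ioo, ofReal_integral_eq_lintegral_ofReal hi]
  filter_upwards [ae_restrict_mem measurableSet_Ioo] with σ hσ
  have := ha.trans hσ.1
  positivity

/-- With x = |log r| the left side is √r, so error terms of size √r are absorbed into any power of
|log r|. The constant 2^n n! comes from one term of the exponential series with n ≥ μ. -/
theorem exists_exp_neg_half_le (μ : ℝ) :
    ∃ K : ℝ, 0 ≤ K ∧ ∀ x : ℝ, 1 ≤ x → Real.exp (-x / 2) ≤ K * x ^ (-μ) := by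
  obtain ⟨n, hn⟩ := exists_nat_ge μ
  refine ⟨2 ^ n * n.factorial, by positivity, fun x hx => ?_⟩
  have h1 := Real.pow_div_factorial_le_exp (x / 2) (by linarith) n
  have hx0 : 0 < x := by linarith
  rw [div_pow, div_div, div_le_iff₀ (by positivity)] at h1
  have h2 : x ^ μ ≤ x ^ n := by
    rw [← Real.rpow_natCast]
    exact Real.rpow_le_rpow_of_exponent_le hx hn
  rw [neg_div, Real.exp_neg, Real.rpow_neg hx0.le, ← div_eq_mul_inv,
    le_div_iff₀ (by positivity), inv_mul_le_iff₀ (Real.exp_pos _)]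
  linarith

/-- The relations between the quantities `Γ`, `W` and the weighted mass `X` of close pairs. -/
structure DecaySystem (C : ℝ≥0) (Γ V X : ℝ → ℝ≥0∞) : Prop where
  propagation : ∀ r s, 0 < r → r ≤ s / 2 → Γ r + V r ≤ C * (Γ s + ENNReal.ofReal s)
  bound : ∀ s, 0 < s → Γ s ≤ C
  interpolation : ∀ s, 0 < s → Γ s ≤ C * (ENNReal.ofReal (1 / s) * X (4 * s)) ^ (4 / 7 : ℝ)
  weight : ∀ R, ∫⁻ s in Ioo 0 R, 2 * X s * ENNReal.ofReal (1 / s ^ 2) ≤ V R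

section

variable {C : ℝ≥0} {Γ V X : ℝ → ℝ≥0∞}

theorem DecaySystem.le_const (h : DecaySystem C Γ V X) {r : ℝ} (hr : 0 < r) (hr1 : r ≤ 1 / 2) :
    Γ r + V r ≤ ENNReal.ofReal (C * (C + 1)) := by
  refine (h.propagation r (2 * r) hr (by linarith)).trans ?_
  rw [ENNReal.ofReal_mul C.coe_nonneg, ENNReal.ofReal_add C.coe_nonneg zero_le_one,
    ENNReal.ofReal_coe_nnreal]
  gcongr
  · exact h.bound _ (by positivity)
  · linarith

/-- A mean value argument for dσ/σ on (a, b): if X(σ)/σ exceeded its target everywhere, the weight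
inequality would make V(b) too large. -/
theorem DecaySystem.exists_scale (h : DecaySystem C Γ V X) {a b w : ℝ} (ha : 0 < a) (hab : a < b)
    (hw : V b ≤ ENNReal.ofReal w) (hw0 : 0 ≤ w) :
    ∃ σ ∈ Ioo a b, ENNReal.ofReal (4 / σ) * X σ ≤
      ENNReal.ofReal (2 * (w + b) / Real.log (b / a)) := by
  by_contra! hcon
  have hb : 0 < b := ha.trans hab
  have hlog : 0 < Real.log (b / a) := Real.log_pos ((one_lt_div ha).2 hab)
  -- Chosen so that (K/2) log(b/a) = w + b. The surplus b > 0 makes the contradiction with V(b) ≤ w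
  -- strict, also when w = 0.
  set K := 2 * (w + b) / Real.log (b / a) with hK
  have hK0 : 0 < K := by positivity
  have h1 : ENNReal.ofReal (w + b) ≤ V b := by
    calc ENNReal.ofReal (w + b) = ENNReal.ofReal (K / 2) * ENNReal.ofReal (Real.log (b / a)) := by
          rw [← ENNReal.ofReal_mul (by positivity), hK]
          congr 1
          field_simp
      _ = ∫⁻ σ in Ioo a b, ENNReal.ofReal (K / 2) * ENNReal.ofReal (1 / σ) := by
          rw [lintegral_const_mul' _ _ ENNReal.ofReal_ne_top, lintegral_Ioo_one_div ha hab.le]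
      _ ≤ ∫⁻ σ in Ioo a b, 2 * X σ * ENNReal.ofReal (1 / σ ^ 2) := by
          refine setLIntegral_mono' measurableSet_Ioo fun σ hσ => ?_
          have hσ0 : 0 < σ := ha.trans hσ.1
          have e1 : ENNReal.ofReal (K / 2) * ENNReal.ofReal (1 / σ) =
              ENNReal.ofReal (1 / (2 * σ)) * ENNReal.ofReal K := by
            rw [← ENNReal.ofReal_mul (by positivity), ← ENNReal.ofReal_mul (by positivity)]
            congr 1
            field_simp
          have e2 : 2 * X σ * ENNReal.ofReal (1 / σ ^ 2) =
              ENNReal.ofReal (1 / (2 * σ)) * (ENNReal.ofReal (4 / σ) * X σ) := by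
            rw [← mul_assoc, ← ENNReal.ofReal_mul (by positivity),
              show 1 / (2 * σ) * (4 / σ) = 2 * (1 / σ ^ 2) by field_simp; norm_num,
              ENNReal.ofReal_mul zero_le_two, ENNReal.ofReal_ofNat]
            ring
          rw [e1, e2]
          gcongr
          exact (hcon σ hσ).le
      _ ≤ ∫⁻ σ in Ioo 0 b, 2 * X σ * ENNReal.ofReal (1 / σ ^ 2) :=
          lintegral_mono_set (Ioo_subset_Ioo_left ha.le)
      _ ≤ V b := h.weight b
  have h2 := (ENNReal.ofReal_le_ofReal_iff hw0).1 (h1.trans hw)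
  linarith

/-- Pigeonhole in (8r, √r) gives a scale σ with small X(σ)/σ. Interpolation makes Γ(σ/4) small, and
propagation carries this down to r. The lower end 8r ensures r ≤ (σ/4)/2. -/
theorem DecaySystem.improve (h : DecaySystem C Γ V X) {r w : ℝ} (hr : 0 < r)
    (hr9 : 9 ≤ -Real.log r) (hw : V (√r) ≤ ENNReal.ofReal w) (hw0 : 0 ≤ w) :
    Γ r + V r ≤ ENNReal.ofReal
      (C * (C * (8 * (w + √r) / (-Real.log r)) ^ (4 / 7 : ℝ) + √r)) := by
  have hsr : 0 < √r := Real.sqrt_pos.2 hr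
  -- With 9 ≤ |log r| this gives log 8 ≤ |log r|/4. Then log(√r/(8r)) = |log r|/2 - log 8 is at
  -- least |log r|/4, and the interval (8r, √r) is nonempty.
  have hlog8 : Real.log 8 ≤ 9 / 4 := by
    rw [show (8 : ℝ) = 2 ^ 3 by norm_num, Real.log_pow]
    have := Real.log_two_lt_d9
    push_cast
    linarith
  have hlog : -Real.log r / 4 ≤ Real.log (√r / (8 * r)) := by
    rw [Real.log_div hsr.ne' (by positivity), Real.log_mul (by norm_num) hr.ne',
      Real.log_sqrt hr.le]
    linarith
  have hab : 8 * r < √r := by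
    have h1 : 0 < Real.log (√r / (8 * r)) := by linarith
    have h2 := (Real.log_pos_iff (by positivity)).1 h1
    rwa [one_lt_div (by positivity)] at h2
  obtain ⟨σ, hσ, hX⟩ := h.exists_scale (by positivity) hab hw hw0
  have hσ0 : 0 < σ := lt_trans (by positivity) hσ.1
  refine (h.propagation r (σ / 4) hr (by linarith [hσ.1])).trans ?_
  have hΓ := h.interpolation (σ / 4) (by positivity)
  rw [show 1 / (σ / 4) = 4 / σ by field_simp, mul_div_cancel₀ σ (by norm_num : (4 : ℝ) ≠ 0)] at hΓ
  have hK : 2 * (w + √r) / Real.log (√r / (8 * r)) ≤ 8 * (w + √r) / (-Real.log r) := by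
    rw [show 8 * (w + √r) / (-Real.log r) = 2 * (w + √r) / (-Real.log r / 4) by
      field_simp; norm_num]
    gcongr
  have hK0 : 0 ≤ 8 * (w + √r) / (-Real.log r) :=
    div_nonneg (by positivity) (by linarith)
  rw [ENNReal.ofReal_mul C.coe_nonneg, ENNReal.ofReal_add (by positivity) hsr.le,
    ENNReal.ofReal_mul C.coe_nonneg, ENNReal.ofReal_coe_nnreal,
    ← ENNReal.ofReal_rpow_of_nonneg hK0 (by norm_num)]
  gcongr
  · refine hΓ.trans ?_
    gcongr
    exact hX.trans (ENNReal.ofReal_le_ofReal hK)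
  · linarith [hσ.2]

/-- A bound `c |log r|^{-μ}` that depends on the constant `C` only. -/
def HasLogDecay (C : ℝ≥0) (μ : ℝ) : Prop :=
  ∃ c : ℝ, 0 ≤ c ∧ ∀ Γ V X : ℝ → ℝ≥0∞, DecaySystem C Γ V X → ∀ r ∈ Ioo (0 : ℝ) (Real.exp (-1)),
    Γ r + V r ≤ ENNReal.ofReal (c * (-Real.log r) ^ (-μ))

theorem exp_neg_one_le_half : Real.exp (-1) ≤ 1 / 2 := by
  rw [Real.exp_neg, inv_le_comm₀ (Real.exp_pos _) (by norm_num)]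
  linarith [Real.exp_one_gt_d9]

theorem one_lt_neg_log {r : ℝ} (hr : r ∈ Ioo (0 : ℝ) (Real.exp (-1))) : 1 < -Real.log r := by
  have := (Real.log_lt_iff_lt_exp hr.1).2 hr.2
  linarith

theorem hasLogDecay_zero (C : ℝ≥0) : HasLogDecay C 0 := by
  refine ⟨C * (C + 1), by positivity, fun Γ V X h r hr => ?_⟩
  rw [neg_zero, Real.rpow_zero, mul_one]
  exact h.le_const hr.1 (hr.2.le.trans exp_neg_one_le_half)

/-- The decay known at √r costs only a factor 2^μ, since |log √r| = |log r|/2. The division by |log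
r| gains one power, and the interpolation raises the result to 4/7. -/
theorem HasLogDecay.step {μ : ℝ} (h : HasLogDecay C μ) (hμ : 0 ≤ μ) :
    HasLogDecay C (4 / 7 * (1 + μ)) := by
  obtain ⟨c, hc0, hc⟩ := h
  set ν := 4 / 7 * (1 + μ) with hν
  have hν0 : 0 ≤ ν := by positivity
  obtain ⟨K, hK0, hK⟩ := exists_exp_neg_half_le μ
  obtain ⟨K', hK0', hK'⟩ := exists_exp_neg_half_le ν
  set A := 8 * (c * 2 ^ μ + K) with hA
  have hA0 : 0 ≤ A := by positivity
  refine ⟨C * (C * A ^ (4 / 7 : ℝ) + K') + C * (C + 1) * 9 ^ ν, by positivity,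
    fun Γ V X hd r hr => ?_⟩
  have hr0 := hr.1
  have hl := one_lt_neg_log hr
  set l := -Real.log r with hl_def
  have hl0 : 0 < l := by linarith
  by_cases h9 : 9 ≤ l
  · have hsq : √r = Real.exp (-l / 2) := by
      rw [hl_def, neg_neg, Real.sqrt_eq_rpow, Real.rpow_def_of_pos hr0]
      ring_nf
    have hlog : -Real.log (√r) = l / 2 := by
      rw [Real.log_sqrt hr0.le]; ring
    have hsr : √r ∈ Ioo (0 : ℝ) (Real.exp (-1)) := by
      refine ⟨Real.sqrt_pos.2 hr0, ?_⟩
      rw [hsq, Real.exp_lt_exp]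
      linarith
    have hV : V (√r) ≤ ENNReal.ofReal (c * (l / 2) ^ (-μ)) := by
      have := hc Γ V X hd (√r) hsr
      rw [hlog] at this
      exact le_add_self.trans this
    refine (hd.improve hr0 h9 hV (by positivity)).trans (ENNReal.ofReal_le_ofReal ?_)
    have e1 : (l / 2) ^ (-μ) = 2 ^ μ * l ^ (-μ) := by
      rw [Real.div_rpow hl0.le zero_le_two, Real.rpow_neg zero_le_two, div_inv_eq_mul, mul_comm]
    have h1 : 8 * (c * (l / 2) ^ (-μ) + √r) / l ≤ A * l ^ (-(1 + μ)) := by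
      rw [div_le_iff₀ hl0, mul_assoc, ← Real.rpow_add_one hl0.ne', hA, e1,
        show -(1 + μ) + 1 = -μ by ring]
      have := hK l hl.le
      rw [← hsq] at this
      nlinarith
    have h2 : (8 * (c * (l / 2) ^ (-μ) + √r) / l) ^ (4 / 7 : ℝ) ≤
        A ^ (4 / 7 : ℝ) * l ^ (-ν) := by
      refine (Real.rpow_le_rpow (by positivity) h1 (by norm_num)).trans (le_of_eq ?_)
      rw [Real.mul_rpow hA0 (by positivity), ← Real.rpow_mul hl0.le]
      congr 2
      rw [hν]; ring
    have h3 := hK' l hl.le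
    rw [← hsq] at h3
    calc C * (C * (8 * (c * (l / 2) ^ (-μ) + √r) / l) ^ (4 / 7 : ℝ) + √r) ≤
          C * (C * (A ^ (4 / 7 : ℝ) * l ^ (-ν)) + K' * l ^ (-ν)) := by gcongr
      _ = C * (C * A ^ (4 / 7 : ℝ) + K') * l ^ (-ν) := by ring
      _ ≤ _ := by
          gcongr
          have : (0 : ℝ) ≤ C * (C + 1) * 9 ^ ν := by positivity
          linarith
  -- For 1 < |log r| < 9 the uniform bound suffices, the power of |log r| being bounded below by
  -- 9^{-ν}.
  · refine (hd.le_const hr0 (hr.2.le.trans exp_neg_one_le_half)).trans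
      (ENNReal.ofReal_le_ofReal ?_)
    have h1 : 1 ≤ 9 ^ ν * l ^ (-ν) := by
      rw [Real.rpow_neg hl0.le, ← div_eq_mul_inv, one_le_div (by positivity)]
      exact Real.rpow_le_rpow hl0.le (by linarith) hν0
    calc (C * (C + 1) : ℝ) = C * (C + 1) * 1 := by ring
      _ ≤ C * (C + 1) * (9 ^ ν * l ^ (-ν)) := by gcongr
      _ ≤ (C * (C * A ^ (4 / 7 : ℝ) + K')) * l ^ (-ν) + C * (C + 1) * (9 ^ ν * l ^ (-ν)) :=
          le_add_of_nonneg_left (by positivity)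
      _ = _ := by ring

/-- The map μ ↦ (4/7)(1 + μ) contracts to its fixed point 4/3. From 0 its n-th iterate is (4/3)(1 -
(4/7)^n), so finitely many steps pass any μ < 4/3. A larger exponent gives the stronger bound
because |log r| > 1. -/
theorem hasLogDecay_of_lt (C : ℝ≥0) {μ : ℝ} (hμ : μ < 4 / 3) : HasLogDecay C μ := by
  have hn : ∀ n : ℕ, HasLogDecay C (4 / 3 * (1 - (4 / 7) ^ n)) := by
    intro n
    induction n with
    | zero => simpa using hasLogDecay_zero C
    | succ n ih =>
      have h1 : ((4 : ℝ) / 7) ^ n ≤ 1 := pow_le_one₀ (by norm_num) (by norm_num)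
      have := ih.step (by linarith)
      rwa [show (4 : ℝ) / 7 * (1 + 4 / 3 * (1 - (4 / 7) ^ n)) = 4 / 3 * (1 - (4 / 7) ^ (n + 1)) by
        rw [pow_succ]; ring] at this
  obtain ⟨n, hn'⟩ := exists_pow_lt_of_lt_one (show 0 < 1 - 3 / 4 * μ by linarith)
    (show (4 : ℝ) / 7 < 1 by norm_num)
  obtain ⟨c, hc0, hc⟩ := hn n
  refine ⟨c, hc0, fun Γ V X h r hr => (hc Γ V X h r hr).trans (ENNReal.ofReal_le_ofReal ?_)⟩
  gcongr
  · exact (one_lt_neg_log hr).le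
  · linarith

end

/-! ### The decay for normalized solutions -/

theorem exists_logDecay_of_isNormalSolution {Ω : Set E3} (hΩ : IsOpen Ω)
    (hΩb : Bornology.IsBounded Ω) {T : ℝ} {lam : SpaceTime → ℝ}
    (hlam : IsTestFunction (cylinder Ω T) lam) (E MS Mf : ℝ≥0) {μ : ℝ} (hμ : μ < 4 / 3) :
    ∃ c : ℝ, 0 ≤ c ∧ ∀ (m ε : ℝ) (S : SpaceTime → Matrix (Fin 3) (Fin 3) ℝ)
      (f : SpaceTime → E3) (ϱ : SpaceTime → ℝ) (u : SpaceTime → E3), 0 < ε →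
      IsNormalSolution Ω T ε m E MS Mf S f ϱ u → ∀ r ∈ Ioo (0 : ℝ) (Real.exp (-1)),
      Gam lam ε m ϱ u r + W lam ε m ϱ u r ≤ ENNReal.ofReal (c * (-Real.log r) ^ (-μ)) := by
  obtain ⟨C1, h1⟩ := exists_Gam_add_W_le hΩ hΩb hlam E MS Mf
  obtain ⟨C2, h2⟩ := exists_Gam_le hΩ hΩb hlam E MS Mf
  obtain ⟨C3, h3⟩ := exists_Gam_le_pressureMass hΩ hΩb hlam E MS Mf
  obtain ⟨c, hc0, hc⟩ := hasLogDecay_of_lt (C1 + C2 + C3) hμ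
  refine ⟨c, hc0, fun m ε S f ϱ u hε h => hc _ _ (pressureMass lam ε m ϱ) ⟨?_, ?_, ?_, ?_⟩⟩
  · refine fun r s hr hrs => (h1 m ε S f ϱ u hε h r s hr hrs).trans ?_
    gcongr
    rw [add_assoc]
    exact le_self_add
  · refine fun s hs => (h2 m ε S f ϱ u hε h s hs).trans ?_
    rw [ENNReal.coe_le_coe, add_right_comm]
    exact le_add_self
  · refine fun s hs => (h3 m ε S f ϱ u hε h s hs).trans ?_
    gcongr
    exact le_add_self
  · intro R
    rw [W]
    gcongr
    exact h.two_mul_pressureMass_le_perp hε hlam _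

/-! ### Passage from weak solutions to normalized ones -/

/-- Where ρ vanishes at the first point, nothing is asked of the energies. They contain P_ε at the
original density, which is not localized and may differ outside the cylinder. -/
theorem pairEnergy_congr {ρ ρ' : SpaceTime → ℝ} {e e' : E3 → E3 → ℝ → ℝ}
    (h : ∀ᵐ z, ρ z = ρ' z ∧
      (ρ z ≠ 0 → ∀ᵐ y, ρ (y, z.2) * e z.1 y z.2 = ρ' (y, z.2) * e' z.1 y z.2)) (s : ℝ) :
    pairEnergy ρ e s = pairEnergy ρ' e' s := by
  refine lintegral_congr_ae ?_
  filter_upwards [h] with z hz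
  by_cases h0 : ρ z = 0
  · rw [← hz.1, h0]
    simp
  · rw [hz.1]
    congr 1
    refine lintegral_congr_ae ?_
    filter_upwards [ae_restrict_of_ae (hz.2 h0)] with y hy
    rw [hy]

theorem ae_ae_slice {p : SpaceTime → Prop} (h : ∀ᵐ z, p z) : ∀ᵐ t : ℝ, ∀ᵐ y : E3, p (y, t) := by
  have h1 : ∀ᵐ q : ℝ × E3, p q.swap :=
    (Measure.measurePreserving_swap (μ := (volume : Measure ℝ))
      (ν := (volume : Measure E3))).quasiMeasurePreserving.ae h
  exact Measure.ae_ae_of_ae_prod h1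

section

variable {Ω : Set E3} {T : ℝ} {lam ϱ ϱ' : SpaceTime → ℝ} {u u' : SpaceTime → E3}

/-- The localized pair energies depend only on the solution in the cylinder, up to null sets. -/
theorem pairEnergy_eq_of_ae_eq (hlam : IsTestFunction (cylinder Ω T) lam)
    (hϱ : ∀ᵐ z, z ∈ cylinder Ω T → ϱ z = ϱ' z) (hu : ∀ᵐ z, z ∈ cylinder Ω T → u z = u' z)
    {e e' : E3 → E3 → ℝ → ℝ}
    (he : ∀ x y t, ϱ (x, t) = ϱ' (x, t) → locVelocity lam u (x, t) = locVelocity lam u' (x, t) →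
      locVelocity lam u (y, t) = locVelocity lam u' (y, t) → e x y t = e' x y t) (s : ℝ) :
    pairEnergy (locDensity lam ϱ) e s = pairEnergy (locDensity lam ϱ') e' s := by
  have hl : ∀ z, z ∉ cylinder Ω T → lam z = 0 := fun z hz =>
    image_eq_zero_of_notMem_tsupport fun h => hz (hlam.2.2 h)
  have hρ : ∀ᵐ z, locDensity lam ϱ z = locDensity lam ϱ' z := by
    filter_upwards [hϱ] with z hz
    by_cases hc : z ∈ cylinder Ω T
    · rw [locDensity, locDensity, hz hc]
    · simp [locDensity, hl z hc]
  have hv : ∀ᵐ z, locVelocity lam u z = locVelocity lam u' z := by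
    filter_upwards [hu] with z hz
    by_cases hc : z ∈ cylinder Ω T
    · rw [locVelocity, locVelocity, hz hc]
    · simp [locVelocity, hl z hc]
  have hs : ∀ᵐ z : SpaceTime, ∀ᵐ y : E3, locDensity lam ϱ (y, z.2) = locDensity lam ϱ' (y, z.2) ∧
      locVelocity lam u (y, z.2) = locVelocity lam u' (y, z.2) :=
    (Measure.quasiMeasurePreserving_snd (μ := (volume : Measure E3))
      (ν := (volume : Measure ℝ))).ae (ae_ae_slice (hρ.and hv))
  refine pairEnergy_congr ?_ s
  filter_upwards [hϱ, hρ, hv, hs] with z h1 h2 h3 h4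
  refine ⟨h2, fun h0 => ?_⟩
  have hz : z ∈ cylinder Ω T := by
    by_contra hc
    exact h0 (by simp [locDensity, hl z hc])
  filter_upwards [h4] with y hy
  rw [hy.1, he z.1 y z.2 (h1 hz) h3 hy.2]

theorem Gam_eq_of_ae_eq (hlam : IsTestFunction (cylinder Ω T) lam)
    (hϱ : ∀ᵐ z, z ∈ cylinder Ω T → ϱ z = ϱ' z) (hu : ∀ᵐ z, z ∈ cylinder Ω T → u z = u' z)
    (ε m r : ℝ) : Gam lam ε m ϱ u r = Gam lam ε m ϱ' u' r := by
  rw [Gam, Gam, pairEnergy_eq_of_ae_eq hlam hϱ hu]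
  intro x y t h1 h2 h3
  simp only [energyPar, locDensity, h1, h2, h3]

theorem W_eq_of_ae_eq (hlam : IsTestFunction (cylinder Ω T) lam)
    (hϱ : ∀ᵐ z, z ∈ cylinder Ω T → ϱ z = ϱ' z) (hu : ∀ᵐ z, z ∈ cylinder Ω T → u z = u' z)
    (ε m r : ℝ) : W lam ε m ϱ u r = W lam ε m ϱ' u' r := by
  rw [W, W]
  refine lintegral_congr fun s => ?_
  rw [pairEnergy_eq_of_ae_eq hlam hϱ hu]
  intro x y t h1 h2 h3
  simp only [energyPerp, locDensity, h1, h2, h3]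

end

theorem LocallyIntegrableOn.congr_ae_restrict {F : Type*} [NormedAddCommGroup F] {Ω : Set E3}
    {w w' : E3 → F} (h : LocallyIntegrableOn w Ω)
    (hw : w =ᵐ[volume.restrict Ω] w') : LocallyIntegrableOn w' Ω := fun x hx => by
  obtain ⟨s, hs, hi⟩ := h x hx
  refine ⟨s ∩ Ω, inter_mem hs self_mem_nhdsWithin, ?_⟩
  have h1 : IntegrableOn w (s ∩ Ω) := hi.mono_set inter_subset_left
  exact h1.congr_fun_ae (ae_restrict_of_ae_restrict_of_subset inter_subset_right hw)

theorem HasWeakGradient.congr_ae {Ω : Set E3} {w w' : E3 → E3}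
    {G G' : E3 → Matrix (Fin 3) (Fin 3) ℝ} (h : HasWeakGradient Ω w G)
    (hw : w =ᵐ[volume.restrict Ω] w') (hG : G =ᵐ[volume.restrict Ω] G') :
    HasWeakGradient Ω w' G' := by
  have hG' : ∀ i j, (fun x => G x i j) =ᵐ[volume.restrict Ω] fun x => G' x i j := fun i j => by
    filter_upwards [hG] with x hx
    rw [hx]
  refine ⟨LocallyIntegrableOn.congr_ae_restrict h.1 hw,
    fun i j => LocallyIntegrableOn.congr_ae_restrict (h.2.1 i j) (hG' i j), ?_⟩
  intro φ hφ i j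
  have e1 : ∫ x in Ω, w' x i * fderiv ℝ φ x (unitVec j) =
      ∫ x in Ω, w x i * fderiv ℝ φ x (unitVec j) := integral_congr_ae (by
    filter_upwards [hw] with x hx
    rw [hx])
  have e2 : ∫ x in Ω, G' x i j * φ x = ∫ x in Ω, G x i j * φ x := integral_congr_ae (by
    filter_upwards [hG] with x hx
    rw [hx])
  rw [e1, e2]
  exact h.2.2 φ hφ i j

section

variable {Ω : Set E3} {T ε m : ℝ} {E MS Mf : ℝ≥0}
  {S S' : SpaceTime → Matrix (Fin 3) (Fin 3) ℝ} {f f' : SpaceTime → E3}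
  {ϱ ϱ' : SpaceTime → ℝ} {u u' : SpaceTime → E3}

theorem MomentumBalance.congr_ae (h : MomentumBalance Ω T ε m S f ϱ u)
    (hS : S =ᵐ[volume.restrict (cylinder Ω T)] S') (hf : f =ᵐ[volume.restrict (cylinder Ω T)] f')
    (hϱ : ϱ =ᵐ[volume.restrict (cylinder Ω T)] ϱ')
    (hu : u =ᵐ[volume.restrict (cylinder Ω T)] u') : MomentumBalance Ω T ε m S' f' ϱ' u' := by
  intro ξ hξ
  refine Eq.trans ?_ (h ξ hξ)
  congr 1
  · congr 1
    · refine integral_congr_ae ?_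
      filter_upwards [hϱ, hu] with z h1 h2
      rw [h1, h2]
    · refine integral_congr_ae ?_
      filter_upwards [hϱ, hu, hS] with z h1 h2 h3
      rw [h1, h2, h3]
  · refine integral_congr_ae ?_
    filter_upwards [hϱ, hf] with z h1 h2
    rw [h1, h2]

theorem MassBalance.congr_ae (h : MassBalance Ω T ϱ u)
    (hϱ : ϱ =ᵐ[volume.restrict (cylinder Ω T)] ϱ')
    (hu : u =ᵐ[volume.restrict (cylinder Ω T)] u') : MassBalance Ω T ϱ' u' := by
  intro ψ hψ
  rw [← h ψ hψ]
  refine integral_congr_ae ?_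
  filter_upwards [hϱ, hu] with z h1 h2
  rw [h1, h2]

theorem volume_restrict_cylinder (Ω : Set E3) (T : ℝ) :
    (volume : Measure SpaceTime).restrict (cylinder Ω T) =
      (volume.restrict Ω).prod (volume.restrict (Ioo 0 T)) := by
  rw [Measure.prod_restrict, cylinder, Measure.volume_eq_prod]

theorem ae_ae_slice_cylinder {p : SpaceTime → Prop}
    (h : ∀ᵐ z ∂(volume.restrict (cylinder Ω T)), p z) :
    ∀ᵐ t ∂(volume.restrict (Ioo 0 T)), ∀ᵐ x ∂(volume.restrict Ω), p (x, t) := by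
  rw [volume_restrict_cylinder] at h
  have h1 : ∀ᵐ q ∂((volume.restrict (Ioo 0 T)).prod (volume.restrict Ω)), p q.swap :=
    Measure.measurePreserving_swap.quasiMeasurePreserving.ae h
  exact Measure.ae_ae_of_ae_prod h1

theorem ae_cylinder_of_ae_time {p : ℝ → Prop} (h : ∀ᵐ t ∂(volume.restrict (Ioo 0 T)), p t) :
    ∀ᵐ z ∂((volume : Measure SpaceTime).restrict (cylinder Ω T)), p z.2 := by
  rw [volume_restrict_cylinder]
  exact Measure.quasiMeasurePreserving_snd.ae h

/-- Slices at times outside J vanish, so a bound at the times of J becomes a bound at every time. -/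
theorem lintegral_indicator_slice {G : Set SpaceTime} {J : Set ℝ} (hG : G ⊆ Ω ×ˢ J)
    (hΩ : IsOpen Ω) {g : SpaceTime → ℝ≥0∞} {C : ℝ≥0∞} (hg : ∀ z, z ∉ G → g z = 0)
    {g' : SpaceTime → ℝ≥0∞} (hgg : ∀ z ∈ G, g z = g' z)
    (hJ : ∀ t ∈ J, ∫⁻ x in Ω, g' (x, t) ≤ C) (t : ℝ) : ∫⁻ x, g (x, t) ≤ C := by
  by_cases ht : t ∈ J
  · refine le_trans ?_ (hJ t ht)
    rw [← lintegral_indicator hΩ.measurableSet]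
    refine lintegral_mono fun x => ?_
    by_cases hx : (x, t) ∈ G
    · rw [indicator_of_mem (hG hx).1, hgg _ hx]
    · rw [hg _ hx]
      exact zero_le
  · have : ∀ x, g (x, t) = 0 := fun x => hg _ fun hx => ht (hG hx).2
    simp [this]

/-- A weak solution agrees almost everywhere in the cylinder with a normalized one. -/
theorem IsWeakSolution.exists_isNormalSolution (h : IsWeakSolution Ω T ε m E MS Mf S f ϱ u)
    (hΩ : IsOpen Ω) :
    ∃ S' f' ϱ' u', IsNormalSolution Ω T ε m E MS Mf S' f' ϱ' u' ∧
      (∀ᵐ z, z ∈ cylinder Ω T → ϱ z = ϱ' z) ∧ (∀ᵐ z, z ∈ cylinder Ω T → u z = u' z) := by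
  have hQ := measurableSet_cylinder hΩ T
  obtain ⟨Du, hDm, hDw, hDE⟩ := h.energy_le
  set ν := (volume : Measure SpaceTime).restrict (cylinder Ω T) with hν
  -- measurable representatives
  set R : SpaceTime → ℝ := fun z => max (h.density_meas.mk ϱ z) 0 with hR
  set U : SpaceTime → E3 := h.velocity_meas.mk u with hU
  set S1 : SpaceTime → Matrix (Fin 3) (Fin 3) ℝ := fun z i j => (h.stress_meas i j).mk _ z with hS1
  set F : SpaceTime → E3 := h.force_meas.mk f with hF
  set D : SpaceTime → Matrix (Fin 3) (Fin 3) ℝ := fun z i j => (hDm i j).mk _ z with hD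
  have mR : Measurable R := h.density_meas.stronglyMeasurable_mk.measurable.max measurable_const
  have mU : Measurable U := h.velocity_meas.stronglyMeasurable_mk.measurable
  have mS : ∀ i j, Measurable fun z => S1 z i j := fun i j =>
    (h.stress_meas i j).stronglyMeasurable_mk.measurable
  have mF : Measurable F := h.force_meas.stronglyMeasurable_mk.measurable
  have mD : ∀ i j, Measurable fun z => D z i j := fun i j =>
    (hDm i j).stronglyMeasurable_mk.measurable
  have nR : ∀ z, 0 ≤ R z := fun z => le_max_right _ _
  have eR : ϱ =ᵐ[ν] R := by
    filter_upwards [h.density_meas.ae_eq_mk, h.density_nonneg] with z h1 h2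
    simp only [hR]
    rw [← h1, max_eq_left h2]
  have eU : u =ᵐ[ν] U := h.velocity_meas.ae_eq_mk
  have eS : S =ᵐ[ν] S1 := by
    have : ∀ᵐ z ∂ν, ∀ i j, S z i j = S1 z i j := by
      rw [ae_all_iff]; intro i
      rw [ae_all_iff]; intro j
      exact (h.stress_meas i j).ae_eq_mk
    filter_upwards [this] with z hz
    ext i j
    exact hz i j
  have eF : f =ᵐ[ν] F := h.force_meas.ae_eq_mk
  have eD : Du =ᵐ[ν] D := by
    have : ∀ᵐ z ∂ν, ∀ i j, Du z i j = D z i j := by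
      rw [ae_all_iff]; intro i
      rw [ae_all_iff]; intro j
      exact (hDm i j).ae_eq_mk
    filter_upwards [this] with z hz
    ext i j
    exact hz i j
  -- the energy bounds
  have hE1 := (le_self_add.trans le_self_add).trans hDE
  have hE2 := (le_add_self.trans le_self_add).trans hDE
  have hE3 := le_add_self.trans hDE
  have sq_of_rpow : ∀ {a : ℝ≥0∞} {b : ℝ≥0}, a ^ (1 / 2 : ℝ) ≤ b → a ≤ (b : ℝ≥0∞) ^ 2 := by
    intro a b hab
    calc a = (a ^ (1 / 2 : ℝ)) ^ 2 := by
          rw [← ENNReal.rpow_natCast, ← ENNReal.rpow_mul]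
          norm_num
      _ ≤ _ := by gcongr
  set gp : SpaceTime → ℝ≥0∞ := fun z =>
    ENNReal.ofReal (R z ^ (3 / 2 : ℝ) * pressureFactor ε m (R z)) with hgp
  set gk : SpaceTime → ℝ≥0∞ := fun z => ENNReal.ofReal (R z * ‖U z‖ ^ 2) with hgk
  have mgp : Measurable gp := by
    simp only [hgp]
    unfold pressureFactor
    fun_prop
  have mgk : Measurable gk := by
    simp only [hgk]
    fun_prop
  have mip : Measurable fun t => ∫⁻ x in Ω, gp (x, t) := mgp.lintegral_prod_left'
  have mik : Measurable fun t => ∫⁻ x in Ω, gk (x, t) := mgk.lintegral_prod_left'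
  -- These are the times at which the slice bounds really hold. The essential suprema make them
  -- almost all of (0, T).
  set J : Set ℝ := {t | t ∈ Ioo 0 T ∧ ∫⁻ x in Ω, gp (x, t) ≤ E ∧ ∫⁻ x in Ω, gk (x, t) ≤ E} with hJ
  have mJ : MeasurableSet J := measurableSet_Ioo.inter
    ((measurableSet_le mip measurable_const).inter (measurableSet_le mik measurable_const))
  have aeJ : ∀ᵐ t ∂(volume.restrict (Ioo 0 T)), t ∈ J := by
    have b1 := ENNReal.ae_le_essSup (μ := volume.restrict (Ioo 0 T)) fun t => ∫⁻ x in Ω,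
      ENNReal.ofReal (ϱ (x, t) ^ (3 / 2 : ℝ) * pressureFactor ε m (ϱ (x, t)))
    have b2 := ENNReal.ae_le_essSup (μ := volume.restrict (Ioo 0 T)) fun t => ∫⁻ x in Ω,
      ENNReal.ofReal (ϱ (x, t) * ‖u (x, t)‖ ^ 2)
    filter_upwards [b1, b2, ae_restrict_mem measurableSet_Ioo,
      ae_ae_slice_cylinder (eR.and eU)] with t h1 h2 h3 h4
    refine ⟨h3, ?_, ?_⟩
    · refine le_trans (le_of_eq (lintegral_congr_ae ?_)) (h1.trans hE1)
      filter_upwards [h4] with x hx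
      simp only [hgp]
      rw [hx.1]
    · refine le_trans (le_of_eq (lintegral_congr_ae ?_)) (h2.trans hE2)
      filter_upwards [h4] with x hx
      simp only [hgk]
      rw [hx.1, hx.2]
  -- the good set
  set G : Set SpaceTime := Ω ×ˢ J ∩ {z | ‖F z‖ ≤ Mf} with hG
  have mG : MeasurableSet G := (hΩ.measurableSet.prod mJ).inter
    (measurableSet_le mF.norm measurable_const)
  have hGQ : G ⊆ cylinder Ω T := fun z hz => ⟨hz.1.1, hz.1.2.1⟩
  have hGJ : G ⊆ Ω ×ˢ J := inter_subset_left
  have aeG : ∀ᵐ z ∂ν, z ∈ G := by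
    filter_upwards [ae_cylinder_of_ae_time (Ω := Ω) aeJ, ae_restrict_mem hQ, h.force_le, eF]
      with z h1 h2 h3 h4
    exact ⟨⟨h2.1, h1⟩, (congrArg norm h4).symm.trans_le h3⟩
  -- The good set has full measure in the cylinder, so cutting a representative down to it changes
  -- nothing almost everywhere.
  have ind : ∀ {F' : Type} [Zero F'] {g g' : SpaceTime → F'}, g =ᵐ[ν] g' → g =ᵐ[ν] G.indicator g' :=
    fun {F'} _ {g g'} hg => by
      filter_upwards [hg, aeG] with z h1 h2
      rw [indicator_of_mem h2, h1]
  have eR' := ind eR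
  have eU' := ind eU
  have eS' := ind eS
  have eF' := ind eF
  have hGn : ∀ z, z ∉ cylinder Ω T → z ∉ G := fun z hz hz' => hz (hGQ hz')
  refine ⟨G.indicator S1, G.indicator F, G.indicator R, G.indicator U, ?_,
    (ae_restrict_iff' hQ).1 eR', (ae_restrict_iff' hQ).1 eU'⟩
  refine
    { density_meas := mR.indicator mG
      velocity_meas := mU.indicator mG
      stress_meas := fun i j => ?_
      force_meas := mF.indicator mG
      density_nonneg := fun z => indicator_nonneg (fun z _ => nR z) z
      density_zero := fun z hz => indicator_of_notMem (hGn z hz) _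
      stress_zero := fun z hz => indicator_of_notMem (hGn z hz) _
      pressure_le := ?_
      kinetic_le := ?_
      gradient := ⟨D, mD, ?_, ?_⟩
      stress_le := ?_
      force_le := fun z => ?_
      momentum := h.momentum.congr_ae eS' eF' eR' eU'
      mass := h.mass.congr_ae eR' eU' }
  · have : (fun z => G.indicator S1 z i j) = G.indicator fun z => S1 z i j := by
      ext z
      by_cases hz : z ∈ G <;> simp [hz]
    rw [this]
    exact (mS i j).indicator mG
  · refine lintegral_indicator_slice (g := fun z => ENNReal.ofReal (G.indicator R z ^ (3 / 2 : ℝ) *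
      pressureFactor ε m (G.indicator R z))) hGJ hΩ (fun z hz => ?_) (g' := gp) (fun z hz => ?_)
      (fun t ht => ht.2.1)
    · rw [indicator_of_notMem hz, Real.zero_rpow (by norm_num)]
      simp
    · rw [indicator_of_mem hz]
  · refine lintegral_indicator_slice (g := fun z => ENNReal.ofReal (G.indicator R z *
      ‖G.indicator U z‖ ^ 2)) hGJ hΩ (fun z hz => ?_) (g' := gk) (fun z hz => ?_)
      (fun t ht => ht.2.2)
    · rw [indicator_of_notMem hz]
      simp
    · rw [indicator_of_mem hz, indicator_of_mem hz]
  · filter_upwards [hDw, ae_ae_slice_cylinder (eU'.and eD)] with t h1 h2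
    refine h1.congr_ae ?_ ?_
    · filter_upwards [h2] with x hx using hx.1
    · filter_upwards [h2] with x hx using hx.2
  · refine le_trans (le_of_eq (lintegral_congr_ae ?_)) (sq_of_rpow hE3)
    filter_upwards [eU', eD] with z h1 h2
    rw [h1, h2]
  · refine le_trans ?_ (sq_of_rpow h.stress_le)
    rw [← setLIntegral_eq_of_support_subset (s := cylinder Ω T)]
    · refine le_of_eq (lintegral_congr_ae ?_)
      filter_upwards [eS'] with z h1
      rw [h1]
    · intro z hz
      by_contra hc
      exact hz (by simp [indicator_of_notMem (hGn z hc)])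
  · by_cases hz : z ∈ G
    · rw [indicator_of_mem hz]
      exact hz.2
    · rw [indicator_of_notMem hz, norm_zero]
      exact Mf.coe_nonneg

end

end CompressibleNS

theorem proposition4p1
    (Ω : Set CompressibleNS.E3) (hΩ : IsOpen Ω) (hΩb : Bornology.IsBounded Ω)
    (T : ℝ) (hT : 0 < T)
    (lam : CompressibleNS.SpaceTime → ℝ)
    (hlam : CompressibleNS.IsTestFunction (CompressibleNS.cylinder Ω T) lam)
    (hlam_nonneg : ∀ z, 0 ≤ lam z)
    (E MS Mf : ℝ≥0) (μ : ℝ) (hμ : μ < 4 / 3) :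
    ∃ c : ℝ, 0 < c ∧
      ∀ (m ε : ℝ), 1 < m → 0 < ε →
      ∀ (S : CompressibleNS.SpaceTime → Matrix (Fin 3) (Fin 3) ℝ)
        (f : CompressibleNS.SpaceTime → CompressibleNS.E3)
        (ϱ : CompressibleNS.SpaceTime → ℝ)
        (u : CompressibleNS.SpaceTime → CompressibleNS.E3),
        CompressibleNS.IsWeakSolution Ω T ε m E MS Mf S f ϱ u →
        ∀ r ∈ Ioo (0 : ℝ) (Real.exp (-1)),
          CompressibleNS.Gam lam ε m ϱ u r + CompressibleNS.W lam ε m ϱ u r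
            ≤ ENNReal.ofReal (c * |Real.log r| ^ (-μ)) := by
  obtain ⟨c, hc0, hc⟩ :=
    CompressibleNS.exists_logDecay_of_isNormalSolution hΩ hΩb hlam E MS Mf hμ
  -- The constant c is only nonnegative, and the added 1 makes it positive.
  refine ⟨c + 1, by positivity, fun m ε _ hε S f ϱ u h r hr => ?_⟩
  obtain ⟨S', f', ϱ', u', hn, hϱ, hu⟩ := h.exists_isNormalSolution hΩ
  rw [CompressibleNS.Gam_eq_of_ae_eq hlam hϱ hu, CompressibleNS.W_eq_of_ae_eq hlam hϱ hu]
  refine (hc m ε S' f' ϱ' u' hε hn r hr).trans (ENNReal.ofReal_le_ofReal ?_)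
  have hl := CompressibleNS.one_lt_neg_log hr
  rw [abs_of_neg (by linarith)]
  gcongr
  linarith
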